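/- **Setting.** Let $d,r\in\mathbb N$ and let $\ell^2(\mathbb Z^d)\otimes\mathbb C^{2r}$, $\mathbb C^{2r}=\mathbb C^r\otimes\mathbb C^2$, be the particle-hole Hilbert space, with $\pi_l$ the partial isometry onto the fiber $\mathbb C^{2r}$ over $l\in\mathbb Z^d$; $|\cdot|$ is the sup norm on $\mathbb Z^d$. Let $H_{\mu,0}$ be a bounded self-adjoint operator on it which has finite range ($\pi_nH_{\mu,0}\pi_m^*=0$ if $|n-m|$ is larger than some $R_0$) and is periodic ($\pi_{n+pk}H_{\mu,0}\pi_{m+pk}^*=\pi_nH_{\mu,0}\pi_m^*$ for some integer $p\ge1$ and all $k,n,m\in\mathbb Z^d$). Let $R\in\mathbb N$, let $W_j$, $|j|\le R$, be complex $2r\times 2r$ matrices with $W_{-j}=W_j^*$, and let $v_{j,l}=v_{-j,l+j}$, $l\in\mathbb Z^d$, $|j|\le R$, be real random variables. For $\lambda>0$ set $$H_{\mu,\lambda}=H_{\mu,0}+\lambda V,\qquad V=\sum_{l\in\mathbb Z^d}\sum_{|j|\le R}v_{j,l}\,\pi_{l+j}^*W_j\pi_l ,$$ on the maximal domain $\{\psi\in\ell^2: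 V\psi\in\ell^2\}$. It is assumed that $H_{\mu,0}$ and all the $W_j$ have the same (even or odd) particle-hole symmetry $J^*\overline{A}J=-A$ with $J=\begin{pmatrix}0&\mathbf 1\\ \mathbf 1&0\end{pmatrix}$ or $J=\begin{pmatrix}0&-\mathbf 1\\ \mathbf 1&0\end{pmatrix}$. **Hypothesis.** Apart from the identity $v_{j,l}=v_{-j,l+j}$ the $v_{j,l}$ are independent. For each fixed $j$ all $v_{j,l}$ have the same distribution $\nu_j$, which is uniformly $\alpha$-Hölder continuous, $\nu_j([a,b])\le C(b-a)^\alpha$ for all $a\le b$ with some constant $C$ and $\alpha>0$, and $1-\nu_j([-a,a])$ decays in $a$ faster than any polynomial. **Theorem.** There is $s_0\in(0,1]$, depending only on $\alpha$ and $r$, such that the following holds. Given $K$, there is $C_3>0$, and for every $s\in(0,s_0)$ there is $C_1>0$, such that for every compact interval $I\subset[-K,K]$ with $D=\mathrm{dist}(I,\sigma(H_{\mu,0}))>0$ there is $C_2>0$ with the following property. For all $0<\lambda\le C_1D^{1+1/s}$, almost surely $(z-H_{\mu,\lambda})^{-1}$ exists as a bounded operator for all $z\in\mathbb C\setminus\mathbb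 R$, and the Green matrices $G^z_{\mu,\lambda}(n,m)=\pi_n(z-H_{\mu,\lambda})^{-1}\pi_m^*$ satisfy, with the Hilbert-Schmidt norm $\|\cdot\|_2$, $$\mathbf E\bigl(\|G^z_{\mu,\lambda}(n,m)\|_2^s\bigr)\;\le\;C_2\,e^{-s\,C_3\,D\,|n-m|}$$ for all $n,m\in\mathbb Z^d$ and all $z=E+\imath\epsilon$ with $E\in I$ and $\epsilon\ne0$. Here $C_1,C_2,C_3$ may depend on $H_{\mu,0}$, the $W_j$ and the law of the $v_{j,l}$; $C_1$ and $C_3$ depend on $I$ only through the bound $K$, and $C_2$ depends on neither $\lambda$, $n$, $m$, $E$ nor $\epsilon$. -/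

import Mathlib

open MeasureTheory ProbabilityTheory Filter Topology
open scoped Matrix ComplexConjugate

noncomputable section

namespace BdG

/-- The lattice `ℤ^d`; its norm `‖n‖` is the sup norm. -/
abbrev Site (d : ℕ) : Type := Fin d → ℤ

/-- Index set of the fiber `ℂ^r ⊗ ℂ²`, decomposed into the particle and the hole component. -/
abbrev FiberIdx (r : ℕ) : Type := Fin r ⊕ Fin r

/-- The fiber `ℂ^{2r}`. -/
abbrev Fiber (r : ℕ) : Type := EuclideanSpace ℂ (FiberIdx r)

/-- `2r × 2r` complex matrices. -/
abbrev FiberMat (r : ℕ) : Type := Matrix (FiberIdx r) (FiberIdx r) ℂ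

/-- The particle-hole Hilbert space `ℓ²(ℤ^d) ⊗ ℂ^{2r}`, as the space `ℓ²(ℤ^d; ℂ^{2r})`. -/
abbrev Hil (d r : ℕ) : Type := lp (fun _ : Site d => Fiber r) 2

/-- The matrix `π_n A π_m^*` of a bounded operator `A`. -/
def block {d r : ℕ} (A : Hil d r →L[ℂ] Hil d r) (n m : Site d) : FiberMat r :=
  Matrix.of fun a b =>
    ((A (lp.single 2 m (EuclideanSpace.single b (1 : ℂ))) : Hil d r) : Site d → Fiber r) n a

/-- The Hilbert-Schmidt norm of a `2r × 2r` matrix. -/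
def hsNorm {r : ℕ} (A : FiberMat r) : ℝ := Real.sqrt (∑ a, ∑ b, ‖A a b‖ ^ 2)

/-- The finite set of all `j ∈ ℤ^d` with `|j| ≤ R`. -/
def box (d R : ℕ) : Finset (Site d) := Finset.Icc (fun _ => -(R : ℤ)) (fun _ => (R : ℤ))

/-- The fiber matrix of the even particle-hole symmetry. -/
def evenPHS (r : ℕ) : FiberMat r := Matrix.fromBlocks 0 1 1 0

/-- The fiber matrix of the odd particle-hole symmetry. -/
def oddPHS (r : ℕ) : FiberMat r := Matrix.fromBlocks 0 (-1) 1 0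

/-- `J^* \bar A J = - A`. -/
def HasPHS {r : ℕ} (J A : FiberMat r) : Prop := Jᴴ * A.map conj * J = -A

/-- The non-random data of a random BdG operator: the unperturbed operator `H_{μ,0}` and the
matrices `W_j`, `|j| ≤ R`. -/
structure Model (d r : ℕ) where
  /-- The unperturbed BdG operator `H_{μ,0}`. -/
  H₀ : Hil d r →L[ℂ] Hil d r
  selfAdjoint : IsSelfAdjoint H₀
  finiteRange : ∃ R₀ : ℕ, ∀ n m : Site d, (R₀ : ℝ) < ‖n - m‖ → block H₀ n m = 0
  periodic : ∃ p : ℕ, 0 < p ∧ ∀ k n m : Site d, block H₀ (n + p • k) (m + p • k) = block H₀ n m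
  /-- The range of the random hoppings. -/
  R : ℕ
  /-- The matrix coefficients of the random hoppings. -/
  W : Site d → FiberMat r
  W_neg : ∀ j ∈ box d R, W (-j) = (W j)ᴴ
  /-- Even or odd particle-hole symmetry of `H_{μ,0}` and of the random part. -/
  phs : ∃ J : FiberMat r, (J = evenPHS r ∨ J = oddPHS r) ∧
    (∀ n m : Site d, HasPHS J (block H₀ n m)) ∧ ∀ j ∈ box d R, HasPHS J (W j)

/-- Uniform `α`-Hölder continuity of a probability measure on the line. -/
def IsHolderMeasure (α : ℝ) (ν : Measure ℝ) : Prop :=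
  ∃ C : ℝ, ∀ a b : ℝ, a ≤ b → ν.real (Set.Icc a b) ≤ C * (b - a) ^ α

/-- `1 - ν([-a,a])` decays faster than any polynomial in `a`. -/
def HasFastTails (ν : Measure ℝ) : Prop :=
  ∀ k : ℕ, Tendsto (fun a : ℝ => a ^ k * (1 - ν.real (Set.Icc (-a) a))) atTop (𝓝 0)

/-- The hypothesis on the random hoppings `v j l = v_{j,l}`. Independence refers to families which
contain at most one of the two coinciding variables `v_{j,l}` and `v_{-j,l+j}`. -/
structure IsHopping {d : ℕ} {Ω : Type*} [MeasurableSpace Ω] (P : Measure Ω) (R : ℕ) (α : ℝ)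
    (ν : Site d → Measure ℝ) (v : Site d → Site d → Ω → ℝ) : Prop where
  measurable : ∀ j ∈ box d R, ∀ l, Measurable (v j l)
  symm : ∀ j ∈ box d R, ∀ l, v j l = v (-j) (l + j)
  indep : ∀ S : Set (Site d × Site d), (∀ p ∈ S, p.1 ∈ box d R) →
    (∀ p ∈ S, (-p.1, p.2 + p.1) ∈ S → p.1 = 0) →
    iIndepFun (fun (p : S) => v p.1.1 p.1.2) P
  law : ∀ j ∈ box d R, ∀ l, P.map (v j l) = ν j
  holder : ∀ j ∈ box d R, IsHolderMeasure α (ν j)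
  tails : ∀ j ∈ box d R, HasFastTails (ν j)

/-- For a realization `u j l` of the hoppings, `(V ψ)(n) = ∑_{|j| ≤ R} u_{j,n-j} W_j ψ(n-j)`, that is
`V = ∑_l ∑_{|j| ≤ R} u_{j,l} π_{l+j}^* W_j π_l`, acting on `ψ ∈ ℓ²` with values in all sequences. -/
def hopMap {d r : ℕ} (M : Model d r) (u : Site d → Site d → ℝ) :
    Hil d r →ₗ[ℂ] PreLp (fun _ : Site d => Fiber r) where
  toFun ψ := fun n => ∑ j ∈ box d M.R,
    (u j (n - j) : ℂ) • Matrix.toEuclideanLin (M.W j) ((ψ : Site d → Fiber r) (n - j))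
  map_add' ψ φ := by
    funext n
    refine Eq.trans ?_ Finset.sum_add_distrib
    refine Finset.sum_congr rfl fun j _ => ?_
    rw [← smul_add, ← map_add]
    rfl
  map_smul' c ψ := by
    funext n
    change _ = c • ∑ j ∈ box d M.R,
      (u j (n - j) : ℂ) • Matrix.toEuclideanLin (M.W j) ((ψ : Site d → Fiber r) (n - j))
    rw [Finset.smul_sum]
    refine Finset.sum_congr rfl fun j _ => ?_
    rw [smul_comm c, ← map_smul (Matrix.toEuclideanLin (M.W j)) c]
    rfl

/-- The operator `H_{μ,λ} = H_{μ,0} + λ V` for a realization `u` of the hoppings, on its maximal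
domain of all `ψ ∈ ℓ²` with `V ψ ∈ ℓ²` (the hoppings may be unbounded). -/
def hamiltonian {d r : ℕ} (M : Model d r) (u : Site d → Site d → ℝ) (lam : ℝ) :
    Hil d r →ₗ.[ℂ] Hil d r where
  domain := (lpSubmodule ℂ (fun _ : Site d => Fiber r) 2).comap (hopMap M u)
  toFun :=
    { toFun := fun ψ => M.H₀ ψ + (lam : ℂ) • (⟨hopMap M u ψ, ψ.2⟩ : Hil d r)
      map_add' := fun ψ φ => by
        have h : (⟨hopMap M u ((ψ + φ : _) : Hil d r), (ψ + φ).2⟩ : Hil d r) =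
            ⟨hopMap M u ψ, ψ.2⟩ + ⟨hopMap M u φ, φ.2⟩ :=
          Subtype.ext (map_add (hopMap M u) ψ.1 φ.1)
        rw [h, Submodule.coe_add, map_add, smul_add]
        abel
      map_smul' := fun c ψ => by
        have h : (⟨hopMap M u ((c • ψ : _) : Hil d r), (c • ψ).2⟩ : Hil d r) =
            c • ⟨hopMap M u ψ, ψ.2⟩ :=
          Subtype.ext (map_smul (hopMap M u) c ψ.1)
        rw [h, Submodule.coe_smul, map_smul, RingHom.id_apply, smul_add, smul_comm c] }

/-- `B` is the bounded operator `(z - A)^{-1}`. -/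
def IsResolvent {d r : ℕ} (A : Hil d r →ₗ.[ℂ] Hil d r) (z : ℂ) (B : Hil d r →L[ℂ] Hil d r) :
    Prop :=
  (∀ φ : Hil d r, ∃ h : B φ ∈ A.domain, z • B φ - A ⟨B φ, h⟩ = φ) ∧
    ∀ ψ : A.domain, B (z • (ψ : Hil d r) - A ψ) = ψ

open Classical in
/-- The Green matrix `π_n (z - A)^{-1} π_m^*` (set to zero where the resolvent does not exist). -/
def green {d r : ℕ} (A : Hil d r →ₗ.[ℂ] Hil d r) (z : ℂ) (n m : Site d) : FiberMat r :=
  if h : ∃ B : Hil d r →L[ℂ] Hil d r, IsResolvent A z B then block h.choose n m else 0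

/-- The real spectrum of a bounded operator (the whole spectrum if it is self-adjoint). -/
def realSpectrum {d r : ℕ} (A : Hil d r →L[ℂ] Hil d r) : Set ℝ :=
  {x : ℝ | (x : ℂ) ∈ spectrum ℂ A}

/-- The distance between two sets of real numbers. -/
def setDist (S T : Set ℝ) : ℝ := sInf (Set.image2 dist S T)

end BdG

end

/-!
# Fractional moment bounds for weakly disordered Bogoliubov-de Gennes operators

The Green function decays exponentially as long as the energy is outside of the spectrum of the
unperturbed operator `H₀` and the random part is small compared to the distance `D`. The hoppings
are unbounded, but they exceed the threshold `A = κ D / lam` only with a probability which is smaller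
than any power of `lam / D`. Accordingly, split the random part into the hoppings of absolute value
at most `A`, whose contribution has norm at most a fraction of `D`, and the remaining large ones,
`V = V_t + V_b`. The resolvent `G_t` of `H₀ + lam V_t` decays deterministically at a rate
proportional to `D`, by a Combes-Thomas estimate (`Model.exists_combesThomas`), and the resolvent
equation `G = G_t + lam G_t V_b G` expands `G` in the large hoppings.

In the fractional moment of this expansion each large hopping `v` multiplies a matrix element of `G`
which starts at the bond of `v`. As `v` enters the Hamiltonian through an operator of rank at most
`4 r`, such a matrix element is a rational function of `v` whose degree is bounded by `4 r`
(`exists_rational_of_finite_rank`). For a Hölder continuous distribution of `v` with fast tails, and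
for small `s`, the mean of `1_{|v| > A} |v|^s |f(v)|^s` is at most `C A^{-k}` times the mean of
`|f(v)|^s`, with any power `k` and uniformly over all rational functions `f` of bounded degree
(`exists_decoupling_const`): up to factors with finite moments, `|f|` and `1 / |f|` are both
comparable to constants inverse to each other. Thus the fractional moments
`τ(n) = E |G(n, m)|^s` satisfy a linear inequality with a small, exponentially decaying kernel, and
a weighted supremum bound closes it (`le_of_expansion`). The power `k = 2 d` compensates for the sum
of the kernel over the lattice, of order `D^{-2d}`, which leaves the condition
`lam ≤ C₁ D^{1 + 1/s}`; the result is `IsHopping.exists_moment_bound`.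

This closing argument needs moments known to be finite, and it is carried out for the Hamiltonians
`Model.finH` with random hoppings in a finite box only, uniformly in the box. Almost surely the
hoppings grow at most like `√|l|` (`IsHopping.ae_growth`). Then cutting off a solution of the
eigenvalue equation by a tent function over a box of side `L` costs a commutator of order
`√L / L` (`Model.exists_norm_le_of_local_eq`). Consequently, off the real axis there are no square
summable solutions, the finite-volume resolvents converge entry by entry, and the limit is
the resolvent of the Hamiltonian on its maximal domain (`Model.exists_isResolvent`). Fatou's lemma
carries the moment bounds over to the limit (`IsHopping.integral_green_le`).
-/

namespace BdG

open scoped ENNReal NNReal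

/-! ### Moments of Hölder continuous measures and of measures with fast tails -/

section

lemma IsHolderMeasure.exists_const {α : ℝ} {ν : Measure ℝ} (h : IsHolderMeasure α ν) :
    ∃ C : ℝ, 0 ≤ C ∧ ∀ a b : ℝ, a ≤ b → ν.real (Set.Icc a b) ≤ C * (b - a) ^ α := by
  obtain ⟨C, hC⟩ := h
  refine ⟨|C|, abs_nonneg _, fun a b hab => (hC a b hab).trans ?_⟩
  exact mul_le_mul_of_nonneg_right (le_abs_self C) (Real.rpow_nonneg (by linarith) _)

lemma IsHolderMeasure.nullSingletonClass {α : ℝ} (hα : 0 < α) {ν : Measure ℝ} [IsFiniteMeasure ν]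
    (h : IsHolderMeasure α ν) : NullSingletonClass ν := by
  obtain ⟨C, hC⟩ := h
  refine ⟨fun x => ?_⟩
  have := hC x x le_rfl
  rw [sub_self, Real.zero_rpow hα.ne', mul_zero, Set.Icc_self] at this
  exact (measureReal_eq_zero_iff).1 (le_antisymm this measureReal_nonneg)

/-- Uniform bound on the moments of order `-τ`, `τ < α`, of the distance to a complex point. The
ball of radius `1` around the point is split into dyadic shells. -/
lemma IsHolderMeasure.exists_lintegral_le {α : ℝ} {ν : Measure ℝ} [IsProbabilityMeasure ν]
    (h : IsHolderMeasure α ν) {τ : ℝ} (h0 : 0 ≤ τ) (hτ : τ < α) :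
    ∃ C : ℝ≥0, ∀ b : ℂ, ∫⁻ x, ENNReal.ofReal ((1 + ‖(x : ℂ) - b‖⁻¹) ^ τ) ∂ν ≤ C := by
  obtain ⟨C, hC0, hC⟩ := h.exists_const
  set c : ℕ → ℝ := fun n => ((2 : ℝ) ^ (n + 2)) ^ τ with hc
  set e : ℕ → ℝ := fun n => c n * (C * (2 * (1 / 2) ^ n) ^ α) with he
  have he0 : ∀ n, 0 ≤ e n := fun n => by positivity
  have hsum : Summable e := by
    have h1 : ∀ n : ℕ, e n = (4 : ℝ) ^ τ * C * 2 ^ α * ((2 : ℝ) ^ (τ - α)) ^ n := by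
      intro n
      simp only [he, hc]
      rw [one_div, inv_pow, Real.rpow_sub two_pos, div_pow, Real.rpow_pow_comm two_pos.le,
        Real.rpow_pow_comm two_pos.le, pow_add, Real.mul_rpow (by positivity) (by positivity),
        Real.mul_rpow (by norm_num) (by positivity), Real.inv_rpow (by positivity),
        div_eq_mul_inv]
      norm_num
      ring
    refine (summable_congr h1).2 ?_
    refine (summable_geometric_of_lt_one (by positivity) ?_).mul_left _
    exact Real.rpow_lt_one_of_one_lt_of_neg (by norm_num) (by linarith)
  refine ⟨Real.toNNReal (2 ^ τ + ∑' n, e n), fun b => ?_⟩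
  have hpt : ∀ x : ℝ, ENNReal.ofReal ((1 + ‖(x : ℂ) - b‖⁻¹) ^ τ) ≤
      ENNReal.ofReal (2 ^ τ) + ∑' n, (Set.Icc (b.re - (1 / 2) ^ n) (b.re + (1 / 2) ^ n)).indicator
        (fun _ => ENNReal.ofReal (c n)) x := by
    intro x
    set y := ‖(x : ℂ) - b‖ with hy
    rcases lt_or_ge 0 y with hy0 | hy0
    · rcases lt_or_ge y 1 with hy1 | hy1
      · obtain ⟨n, hn1, hn2⟩ := exists_nat_pow_near_of_lt_one hy0 hy1.le
          (by norm_num : (0 : ℝ) < 1 / 2) (by norm_num)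
        refine le_trans ?_ (le_trans (ENNReal.le_tsum n) le_add_self)
        have hmem : x ∈ Set.Icc (b.re - (1 / 2) ^ n) (b.re + (1 / 2) ^ n) := by
          have h2 : |x - b.re| ≤ y := by
            simpa using Complex.abs_re_le_norm ((x : ℂ) - b)
          have h3 := abs_le.1 (h2.trans hn2)
          constructor <;> linarith
        rw [Set.indicator_of_mem hmem]
        refine ENNReal.ofReal_le_ofReal (Real.rpow_le_rpow (by positivity) ?_ h0)
        have h4 : y⁻¹ ≤ 2 ^ (n + 1) := by
          rw [inv_le_comm₀ hy0 (by positivity), ← inv_pow]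
          simpa using hn1.le
        have h5 : (1 : ℝ) ≤ 2 ^ (n + 1) := one_le_pow₀ (by norm_num)
        rw [pow_succ _ (n + 1)]
        linarith
      · refine le_trans ?_ le_self_add
        refine ENNReal.ofReal_le_ofReal (Real.rpow_le_rpow (by positivity) ?_ h0)
        have := inv_le_one_of_one_le₀ hy1
        linarith
    · refine le_trans ?_ le_self_add
      refine ENNReal.ofReal_le_ofReal (Real.rpow_le_rpow (by positivity) ?_ h0)
      rw [le_antisymm hy0 (norm_nonneg _)]
      norm_num
  refine (lintegral_mono hpt).trans ?_
  rw [lintegral_add_left measurable_const, lintegral_tsum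
    (fun n => (measurable_const.indicator measurableSet_Icc).aemeasurable)]
  simp only [lintegral_const, measure_univ, mul_one,
    lintegral_indicator measurableSet_Icc, Measure.restrict_apply MeasurableSet.univ,
    Set.univ_inter]
  have h6 : ∀ n, ENNReal.ofReal (c n) * ν (Set.Icc (b.re - (1 / 2) ^ n) (b.re + (1 / 2) ^ n)) ≤
      ENNReal.ofReal (e n) := by
    intro n
    rw [he, ENNReal.ofReal_mul (by positivity)]
    gcongr
    have h7 := hC (b.re - (1 / 2) ^ n) (b.re + (1 / 2) ^ n)
      (by have : (0 : ℝ) ≤ (1 / 2) ^ n := by positivity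
          linarith)
    rw [show b.re + (1 / 2) ^ n - (b.re - (1 / 2) ^ n) = 2 * (1 / 2) ^ n by ring] at h7
    rw [← ofReal_measureReal]
    exact ENNReal.ofReal_le_ofReal h7
  calc _ ≤ ENNReal.ofReal (2 ^ τ) + ∑' n, ENNReal.ofReal (e n) := by
        gcongr with n
        exact h6 n
    _ = _ := by
        rw [← ENNReal.ofReal_tsum_of_nonneg he0 hsum, ← ENNReal.ofReal_add (by positivity)
          (tsum_nonneg he0)]
        rfl

/-- Tails decaying faster than any polynomial give finite moments of all orders. -/
lemma HasFastTails.exists_lintegral_le {ν : Measure ℝ} [IsProbabilityMeasure ν]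
    (h : HasFastTails ν) (k : ℕ) :
    ∃ C : ℝ≥0, ∫⁻ x, ENNReal.ofReal ((1 + |x|) ^ k) ∂ν ≤ C := by
  set t : ℕ → ℝ := fun m => 1 - ν.real (Set.Icc (-(m : ℝ)) m) with ht
  have ht0 : ∀ m, 0 ≤ t m := fun m => sub_nonneg.2 measureReal_le_one
  have htm : ∀ m : ℕ, ν {x | (m : ℝ) < |x|} = ENNReal.ofReal (t m) := by
    intro m
    have h1 : {x : ℝ | (m : ℝ) < |x|} = (Set.Icc (-(m : ℝ)) m)ᶜ := by
      ext x
      simp only [Set.mem_ofPred_eq, Set.mem_compl_iff, Set.mem_Icc, ← abs_le, not_le]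
    rw [h1]
    simp only [ht]
    rw [← probReal_compl_eq_one_sub measurableSet_Icc, ofReal_measureReal]
  have hsum : Summable fun m : ℕ => ((m : ℝ) + 2) ^ k * t m := by
    refine Summable.of_norm_bounded_eventually_nat
      (g := fun m : ℕ => 3 ^ k * (1 / (m : ℝ) ^ 2))
      ((Real.summable_one_div_nat_pow.2 (by norm_num)).mul_left _) ?_
    have h1 := ((h (k + 2)).comp tendsto_natCast_atTop_atTop).eventually
      (ge_mem_nhds (show (0 : ℝ) < 1 by norm_num))
    filter_upwards [h1, eventually_ge_atTop 1] with m hm hm1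
    have hm1' : (1 : ℝ) ≤ m := by exact_mod_cast hm1
    rw [Real.norm_of_nonneg (mul_nonneg (by positivity) (ht0 m))]
    have h2 : ((m : ℝ) + 2) ^ k ≤ (3 * m) ^ k := by gcongr; linarith
    have h3 : (m : ℝ) ^ (k + 2) * t m ≤ 1 := hm
    rw [mul_one_div, le_div_iff₀ (by positivity)]
    calc ((m : ℝ) + 2) ^ k * t m * m ^ 2 ≤ (3 * m) ^ k * t m * m ^ 2 := by
          have := ht0 m
          gcongr
      _ = 3 ^ k * (m ^ (k + 2) * t m) := by rw [mul_pow, pow_add]; ring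
      _ ≤ 3 ^ k * 1 := by gcongr
      _ = _ := mul_one _
  refine ⟨Real.toNNReal (1 + ∑' m : ℕ, ((m : ℝ) + 2) ^ k * t m), ?_⟩
  have hms : ∀ m : ℕ, MeasurableSet {x : ℝ | (m : ℝ) < |x|} := fun m =>
    measurableSet_lt measurable_const measurable_id.abs
  have hpt : ∀ x : ℝ, ENNReal.ofReal ((1 + |x|) ^ k) ≤
      1 + ∑' m : ℕ, {x : ℝ | (m : ℝ) < |x|}.indicator
        (fun _ => ENNReal.ofReal (((m : ℝ) + 2) ^ k)) x := by
    intro x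
    rcases Nat.eq_zero_or_pos ⌈|x|⌉₊ with hx | hx
    · have hx0 : |x| = 0 := le_antisymm (Nat.ceil_eq_zero.1 hx) (abs_nonneg x)
      refine le_trans ?_ le_self_add
      simp [hx0]
    · obtain ⟨m, hm⟩ := Nat.exists_eq_succ_of_ne_zero hx.ne'
      refine le_trans ?_ (le_trans (ENNReal.le_tsum m) le_add_self)
      have h1 : (m : ℝ) < |x| := Nat.lt_ceil.1 (by omega)
      have h2 : |x| ≤ m + 1 := by
        have := Nat.le_ceil |x|
        rw [hm] at this
        exact_mod_cast this
      rw [Set.indicator_of_mem (show x ∈ {x : ℝ | (m : ℝ) < |x|} from h1)]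
      refine ENNReal.ofReal_le_ofReal (pow_le_pow_left₀ (by positivity) (by linarith) _)
  refine (lintegral_mono hpt).trans ?_
  rw [lintegral_add_left measurable_const, lintegral_tsum
    (fun m => (measurable_const.indicator (hms m)).aemeasurable)]
  simp only [lintegral_const, measure_univ, mul_one, lintegral_indicator (hms _),
    Measure.restrict_apply MeasurableSet.univ, Set.univ_inter, htm]
  simp_rw [← ENNReal.ofReal_mul (show (0 : ℝ) ≤ ((_ : ℕ) + 2 : ℝ) ^ k by positivity)]
  rw [← ENNReal.ofReal_tsum_of_nonneg (fun m => mul_nonneg (by positivity) (ht0 m)) hsum,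
    ← ENNReal.ofReal_one, ← ENNReal.ofReal_add zero_le_one
      (tsum_nonneg fun m => mul_nonneg (by positivity) (ht0 m))]
  rfl

end

/-! ### Decoupling of one real variable from a rational function of it -/

section

open Polynomial

/-- The size of a complex polynomial, `|c| ∏ (1 + |b|)` over its roots `b`, where `c` is the leading
coefficient. -/
noncomputable def polySize (p : ℂ[X]) : ℝ := ‖p.leadingCoeff‖ * (p.roots.map fun b => 1 + ‖b‖).prod

/-- The product of `1 + 1 / |x - b|` over the roots `b` of a polynomial: up to powers of `1 + |x|`,
it bounds the size of the polynomial in terms of its value at `x`. At a root, where the value at `x`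
carries no information, the factor is `1` because `0⁻¹ = 0`. -/
noncomputable def polyRes (p : ℂ[X]) (x : ℝ) : ℝ := (p.roots.map fun b => 1 + ‖(x : ℂ) - b‖⁻¹).prod

lemma norm_eval_eq_prod (p : ℂ[X]) (x : ℂ) :
    ‖p.eval x‖ = ‖p.leadingCoeff‖ * (p.roots.map fun b => ‖x - b‖).prod := by
  conv_lhs => rw [(IsAlgClosed.splits p).eq_prod_roots]
  rw [eval_mul, eval_C, norm_mul, eval_multiset_prod, Multiset.map_map]
  congr 1
  rw [← coe_nnnorm, ← nnnormHom_apply, map_multiset_prod, Multiset.map_map,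
    NNReal.coe_multiset_prod, Multiset.map_map]
  congr 1
  refine Multiset.map_congr rfl fun b _ => ?_
  simp

lemma polySize_pos {p : ℂ[X]} (hp : p ≠ 0) : 0 < polySize p := by
  refine mul_pos (norm_pos_iff.2 (leadingCoeff_ne_zero.2 hp)) (Multiset.prod_pos ?_)
  simp only [Multiset.mem_map]
  rintro _ ⟨b, -, rfl⟩
  positivity

lemma one_le_polyRes (p : ℂ[X]) (x : ℝ) : 1 ≤ polyRes p x := by
  refine Multiset.one_le_prod ?_
  simp only [Multiset.mem_map]
  rintro _ ⟨b, -, rfl⟩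
  have := inv_nonneg.2 (norm_nonneg ((x : ℂ) - b))
  linarith

lemma norm_eval_le_polySize {N : ℕ} {p : ℂ[X]} (hN : p.natDegree ≤ N) (x : ℝ) :
    ‖p.eval (x : ℂ)‖ ≤ (1 + |x|) ^ N * polySize p := by
  have h1 : (p.roots.map fun b => ‖(x : ℂ) - b‖).prod ≤
      (p.roots.map fun b => (1 + |x|) * (1 + ‖b‖)).prod := by
    refine Multiset.prod_map_le_prod_map₀ _ _ (fun b _ => norm_nonneg _) fun b _ => ?_
    refine (norm_sub_le _ _).trans ?_
    rw [Complex.norm_real, Real.norm_eq_abs]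
    nlinarith [norm_nonneg b, abs_nonneg x]
  rw [Multiset.prod_map_mul, Multiset.map_const', Multiset.prod_replicate] at h1
  have h2 : (1 + |x|) ^ Multiset.card p.roots ≤ (1 + |x|) ^ N :=
    pow_le_pow_right₀ (by have := abs_nonneg x; linarith) ((card_roots' p).trans hN)
  have h3 : 0 ≤ (p.roots.map fun b => 1 + ‖b‖).prod := by
    refine Multiset.prod_nonneg ?_
    simp only [Multiset.mem_map]
    rintro _ ⟨b, -, rfl⟩
    positivity
  rw [norm_eval_eq_prod, polySize]
  calc _ ≤ ‖p.leadingCoeff‖ * ((1 + |x|) ^ N * (p.roots.map fun b => 1 + ‖b‖).prod) := by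
        gcongr
        exact h1.trans (by gcongr)
    _ = _ := by ring

lemma polySize_le_norm_eval {N : ℕ} {p : ℂ[X]} (hN : p.natDegree ≤ N) {x : ℝ}
    (hx : p.eval (x : ℂ) ≠ 0) :
    polySize p ≤ (1 + |x|) ^ N * polyRes p x * ‖p.eval (x : ℂ)‖ := by
  have h1 : (p.roots.map fun b => 1 + ‖b‖).prod ≤
      (p.roots.map fun b => (1 + |x|) * ((1 + ‖(x : ℂ) - b‖⁻¹) * ‖(x : ℂ) - b‖)).prod := by
    refine Multiset.prod_map_le_prod_map₀ _ _ (fun b _ => by positivity) fun b hb => ?_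
    have hb0 : 0 < ‖(x : ℂ) - b‖ := by
      rw [norm_pos_iff, sub_ne_zero]
      rintro rfl
      exact hx (isRoot_of_mem_roots hb)
    rw [add_mul _ _ ‖(x : ℂ) - b‖, inv_mul_cancel₀ hb0.ne', one_mul]
    have h2 : ‖b‖ ≤ ‖(x : ℂ) - b‖ + |x| := by
      have := norm_sub_norm_le b (x : ℂ)
      rw [Complex.norm_real, Real.norm_eq_abs, norm_sub_rev] at this
      linarith
    nlinarith [abs_nonneg x]
  rw [Multiset.prod_map_mul, Multiset.prod_map_mul, Multiset.map_const',
    Multiset.prod_replicate] at h1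
  have h2 : (1 + |x|) ^ Multiset.card p.roots ≤ (1 + |x|) ^ N :=
    pow_le_pow_right₀ (by have := abs_nonneg x; linarith) ((card_roots' p).trans hN)
  have h3 : 0 ≤ (p.roots.map fun b => ‖(x : ℂ) - b‖).prod := by
    refine Multiset.prod_nonneg ?_
    simp only [Multiset.mem_map]
    rintro _ ⟨b, -, rfl⟩
    positivity
  have h4 := one_le_polyRes p x
  rw [norm_eval_eq_prod, polySize]
  calc _ ≤ ‖p.leadingCoeff‖ * ((1 + |x|) ^ N *
        (polyRes p x * (p.roots.map fun b => ‖(x : ℂ) - b‖).prod)) := by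
        gcongr
        exact h1.trans (by unfold polyRes at *; gcongr)
    _ = _ := by ring

/-- Comparison of a quotient of two polynomials with the quotient of their sizes. -/
lemma div_rpow_le_polySize {N : ℕ} {p q : ℂ[X]} (hp : p.natDegree ≤ N) (hq : q.natDegree ≤ N)
    {s : ℝ} (hs0 : 0 < s) (hs1 : s ≤ 1) {x : ℝ} (hx : q.eval (x : ℂ) ≠ 0) :
    (‖p.eval (x : ℂ)‖ / ‖q.eval (x : ℂ)‖) ^ s ≤
      (polySize p / polySize q) ^ s * ((1 + |x|) ^ (2 * N) * polyRes q x ^ s) := by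
  have hq0 : q ≠ 0 := by rintro rfl; simp at hx
  have h1 := norm_eval_le_polySize hp x
  have h2 := polySize_le_norm_eval hq hx
  have h3 := polySize_pos hq0
  have h4 : 0 < ‖q.eval (x : ℂ)‖ := norm_pos_iff.2 hx
  have h5 := one_le_polyRes q x
  have hx1 : 1 ≤ 1 + |x| := by have := abs_nonneg x; linarith
  have h6 : 0 ≤ polySize p :=
    nonneg_of_mul_nonneg_right ((norm_nonneg _).trans h1) (by positivity)
  have h7 : ‖p.eval (x : ℂ)‖ / ‖q.eval (x : ℂ)‖ ≤
      polySize p / polySize q * ((1 + |x|) ^ (2 * N) * polyRes q x) := by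
    rw [div_le_iff₀ h4, div_mul_eq_mul_div, div_mul_eq_mul_div, le_div_iff₀ h3]
    calc _ ≤ ((1 + |x|) ^ N * polySize p) *
          ((1 + |x|) ^ N * polyRes q x * ‖q.eval (x : ℂ)‖) := by gcongr
      _ = _ := by rw [two_mul, pow_add]; ring
  calc _ ≤ (polySize p / polySize q * ((1 + |x|) ^ (2 * N) * polyRes q x)) ^ s := by gcongr
    _ = (polySize p / polySize q) ^ s * (((1 + |x|) ^ (2 * N)) ^ s * polyRes q x ^ s) := by
        rw [Real.mul_rpow (by positivity) (by positivity), Real.mul_rpow (by positivity)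
          (by positivity)]
    _ ≤ _ := by
        gcongr
        exact (Real.rpow_le_rpow_of_exponent_le (one_le_pow₀ hx1) hs1).trans_eq (Real.rpow_one _)

/-- A product of at most `N` factors is bounded by the `N`-th power of the largest factor. Hence
moments of order `N t` of the single factors control the moment of order `t` of the product. -/
lemma prod_rpow_le_one_add_sum {N : ℕ} {t : ℝ} (ht : 0 ≤ t) (m : Multiset ℂ) (g : ℂ → ℝ)
    (hg : ∀ b, 1 ≤ g b) (hm : Multiset.card m ≤ N) :
    (m.map g).prod ^ t ≤ 1 + (m.map fun b => g b ^ (N * t)).sum := by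
  have hnn : 0 ≤ (m.map fun b => g b ^ (N * t)).sum := by
    refine Multiset.sum_nonneg ?_
    simp only [Multiset.mem_map]
    rintro _ ⟨b, -, rfl⟩
    exact Real.rpow_nonneg (zero_le_one.trans (hg b)) _
  rcases eq_or_ne m 0 with rfl | hm0
  · simp
  obtain ⟨b, hb, hmax⟩ := Finset.exists_max_image m.toFinset g
    (by rwa [Finset.nonempty_iff_ne_empty, Ne, Multiset.toFinset_eq_empty])
  have h1 : (m.map g).prod ≤ g b ^ N := by
    have h2 : (m.map g).prod ≤ (m.map fun _ => g b).prod :=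
      Multiset.prod_map_le_prod_map₀ _ _ (fun c _ => zero_le_one.trans (hg c))
        fun c hc => hmax c (Multiset.mem_toFinset.2 hc)
    rw [Multiset.map_const', Multiset.prod_replicate] at h2
    exact h2.trans (pow_le_pow_right₀ (hg b) hm)
  have h3 : 0 ≤ (m.map g).prod := by
    refine Multiset.prod_nonneg ?_
    simp only [Multiset.mem_map]
    rintro _ ⟨b, -, rfl⟩
    exact zero_le_one.trans (hg b)
  have h4 : g b ^ (N * t) ≤ (m.map fun b => g b ^ (N * t)).sum := by
    refine Multiset.single_le_sum ?_ _ (Multiset.mem_map_of_mem _ (Multiset.mem_toFinset.1 hb))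
    simp only [Multiset.mem_map]
    rintro _ ⟨b, -, rfl⟩
    exact Real.rpow_nonneg (zero_le_one.trans (hg b)) _
  calc _ ≤ (g b ^ N) ^ t := Real.rpow_le_rpow h3 h1 ht
    _ = g b ^ (N * t) := by rw [← Real.rpow_natCast_mul (zero_le_one.trans (hg b))]
    _ ≤ _ := by linarith

lemma lintegral_ofReal_multiset_sum {ν : Measure ℝ} (m : Multiset ℂ) (g : ℂ → ℝ → ℝ)
    (hg0 : ∀ b x, 0 ≤ g b x) (hgm : ∀ b, Measurable (g b)) {C : ℝ≥0∞}
    (hC : ∀ b, ∫⁻ x, ENNReal.ofReal (g b x) ∂ν ≤ C) :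
    ∫⁻ x, ENNReal.ofReal (m.map fun b => g b x).sum ∂ν ≤ Multiset.card m * C := by
  induction m using Multiset.induction_on with
  | empty => simp
  | cons b m ih =>
    have h0 : ∀ x, 0 ≤ (m.map fun b => g b x).sum := fun x => by
      refine Multiset.sum_nonneg ?_
      simp only [Multiset.mem_map]
      rintro _ ⟨b, -, rfl⟩
      exact hg0 b x
    simp only [Multiset.map_cons, Multiset.sum_cons, Multiset.card_cons]
    simp_rw [ENNReal.ofReal_add (hg0 b _) (h0 _)]
    rw [lintegral_add_left (hgm b).ennreal_ofReal]
    push_cast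
    rw [add_mul, one_mul, add_comm (_ * C)]
    exact add_le_add (hC b) ih

lemma measurable_polyRes (p : ℂ[X]) : Measurable (polyRes p) := by
  unfold polyRes
  induction p.roots using Multiset.induction_on with
  | empty => simp
  | cons b m ih =>
    simp only [Multiset.map_cons, Multiset.prod_cons]
    fun_prop

/-- Uniform bound on small moments of `polyRes`, over all polynomials of bounded degree. -/
lemma exists_lintegral_polyRes_le {α : ℝ} {ν : Measure ℝ} [IsProbabilityMeasure ν]
    (h : IsHolderMeasure α ν) {N : ℕ} {t : ℝ} (ht : 0 ≤ t) (htα : N * t < α) :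
    ∃ C : ℝ≥0, ∀ p : ℂ[X], p.natDegree ≤ N →
      ∫⁻ x, ENNReal.ofReal (polyRes p x ^ t) ∂ν ≤ C := by
  obtain ⟨C, hC⟩ := h.exists_lintegral_le (by positivity : 0 ≤ N * t) htα
  refine ⟨1 + N * C, fun p hp => ?_⟩
  have hcard : Multiset.card p.roots ≤ N := (card_roots' p).trans hp
  have h1 : ∀ x : ℝ, ENNReal.ofReal (polyRes p x ^ t) ≤
      1 + ENNReal.ofReal (p.roots.map fun b => (1 + ‖(x : ℂ) - b‖⁻¹) ^ (N * t)).sum := by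
    intro x
    refine (ENNReal.ofReal_le_ofReal (prod_rpow_le_one_add_sum ht p.roots
      (fun b => 1 + ‖(x : ℂ) - b‖⁻¹) (fun b => ?_) hcard)).trans ?_
    · have := inv_nonneg.2 (norm_nonneg ((x : ℂ) - b))
      linarith
    · refine ENNReal.ofReal_add_le.trans ?_
      rw [ENNReal.ofReal_one]
  refine (lintegral_mono h1).trans ?_
  rw [lintegral_add_left measurable_const, lintegral_one, measure_univ]
  push_cast
  gcongr
  refine (lintegral_ofReal_multiset_sum p.roots
    (fun b x => (1 + ‖(x : ℂ) - b‖⁻¹) ^ (N * t)) (fun b x => by positivity)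
    (fun b => by fun_prop) hC).trans ?_
  gcongr

lemma ae_eval_ne_zero {ν : Measure ℝ} [NullSingletonClass ν] {p : ℂ[X]} (hp : p ≠ 0) :
    ∀ᵐ x ∂ν, p.eval ((x : ℝ) : ℂ) ≠ 0 := by
  rw [ae_iff]
  simp only [not_not]
  refine Set.Finite.measure_zero ?_ ν
  refine Set.Finite.preimage (Set.injOn_of_injective Complex.ofReal_injective)
    (s := {z : ℂ | p.eval z = 0}) ?_
  refine (p.roots.toFinset.finite_toSet).subset fun z hz => ?_
  simpa [hp] using! hz

/-- **Decoupling.** Inside the fractional moment of a rational function, the factor `|x|^s` on the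
event `|x| > A` may be replaced by a constant which is small for large `A`; the constant is uniform
over all rational functions of bounded degree. Up to factors with finite moments, such a function
`p / q` and its inverse are bounded by the ratio of the sizes of `p` and `q` and by the inverse of
this ratio. -/
theorem exists_decoupling_const {α : ℝ} (hα : 0 < α) {ν : Measure ℝ} [IsProbabilityMeasure ν]
    (hh : IsHolderMeasure α ν) (ht : HasFastTails ν) {N : ℕ} {s : ℝ} (hs0 : 0 < s) (hs1 : s ≤ 1)
    (hsα : N * (2 * s) < α) (k : ℕ) :
    ∃ C : ℝ, 0 < C ∧ ∀ f : ℝ → ℂ, (∃ p q : ℂ[X], p.natDegree ≤ N ∧ q.natDegree ≤ N ∧ q ≠ 0 ∧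
      ∀ x : ℝ, f x * q.eval (x : ℂ) = p.eval (x : ℂ)) → ∀ A : ℝ, 0 < A →
      ∫⁻ x, ENNReal.ofReal ((if A < |x| then |x| ^ s else 0) * ‖f x‖ ^ s) ∂ν ≤
        ENNReal.ofReal (C * (A ^ k)⁻¹) * ∫⁻ x, ENNReal.ofReal (‖f x‖ ^ s) ∂ν := by
  have := hh.nullSingletonClass hα
  obtain ⟨R, hR⟩ := exists_lintegral_polyRes_le hh (by positivity : 0 ≤ 2 * s) hsα
  have hmom : ∀ k : ℕ, ∃ C : ℝ, 0 < C ∧ ∀ q : ℂ[X], q.natDegree ≤ N →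
      ∫⁻ x, ENNReal.ofReal ((1 + |x|) ^ (2 * k) + polyRes q x ^ (2 * s)) ∂ν ≤
        ENNReal.ofReal C := by
    intro k
    obtain ⟨D, hD⟩ := ht.exists_lintegral_le (2 * k)
    refine ⟨D + R + 1, by positivity, fun q hq => ?_⟩
    have h0 : ∀ x : ℝ, 0 ≤ polyRes q x ^ (2 * s) := fun x =>
      Real.rpow_nonneg (zero_le_one.trans (one_le_polyRes q x)) _
    rw [lintegral_congr fun x => ENNReal.ofReal_add (by positivity) (h0 x),
      lintegral_add_left (by fun_prop)]
    refine (add_le_add hD (hR q hq)).trans ?_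
    rw [← ENNReal.ofReal_coe_nnreal, ← ENNReal.ofReal_coe_nnreal, ← ENNReal.ofReal_add
      D.coe_nonneg R.coe_nonneg]
    exact ENNReal.ofReal_le_ofReal (by linarith)
  -- the moments needed for the upper bound on `f`, with `k` powers of `|x| / A` and one more for
  -- the factor `|x| ^ s`, and for the upper bound on `f⁻¹`
  obtain ⟨C₁, hC₁, hU⟩ := hmom (k + 1 + 2 * N)
  obtain ⟨C₂, hC₂, hL⟩ := hmom (2 * N)
  refine ⟨C₁ * C₂, by positivity, ?_⟩
  rintro f ⟨p, q, hp, hq, hq0, hf⟩ A hA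
  have hqae := ae_eval_ne_zero (ν := ν) hq0
  have hfeq : ∀ x : ℝ, q.eval (x : ℂ) ≠ 0 → ‖f x‖ = ‖p.eval (x : ℂ)‖ / ‖q.eval (x : ℂ)‖ := by
    intro x hx
    rw [← hf x, norm_mul, mul_div_cancel_right₀ _ (norm_ne_zero_iff.2 hx)]
  rcases eq_or_ne p 0 with rfl | hp0
  · have h0 : ∫⁻ x, ENNReal.ofReal ((if A < |x| then |x| ^ s else 0) * ‖f x‖ ^ s) ∂ν = 0 := by
      refine (lintegral_congr_ae ?_).trans lintegral_zero
      filter_upwards [hqae] with x hx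
      rw [hfeq x hx]
      simp [Real.zero_rpow hs0.ne']
    rw [h0]
    exact zero_le
  have hpae := ae_eval_ne_zero (ν := ν) hp0
  have hSp := polySize_pos hp0
  have hSq := polySize_pos hq0
  set c : ℝ := (polySize p / polySize q) ^ s with hc
  have hc0 : 0 < c := by positivity
  have hci : (polySize q / polySize p) ^ s = c⁻¹ := by
    rw [hc, ← Real.inv_rpow (by positivity), inv_div]
  -- the upper bound on the left-hand side
  have hup : ∫⁻ x, ENNReal.ofReal ((if A < |x| then |x| ^ s else 0) * ‖f x‖ ^ s) ∂ν ≤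
      ENNReal.ofReal (c * (A ^ k)⁻¹ * C₁) := by
    rw [ENNReal.ofReal_mul (by positivity)]
    refine le_trans ?_ (mul_le_mul_right (hU q hq) _)
    rw [← lintegral_const_mul' _ _ ENNReal.ofReal_ne_top]
    refine lintegral_mono_ae ?_
    filter_upwards [hqae] with x hx
    rw [← ENNReal.ofReal_mul (by positivity)]
    refine ENNReal.ofReal_le_ofReal ?_
    have hZ := one_le_polyRes q x
    have hx1 : 1 ≤ 1 + |x| := by have := abs_nonneg x; linarith
    have h1 := div_rpow_le_polySize hp hq hs0 hs1 hx
    rw [← hfeq x hx, ← hc] at h1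
    have h2 : (if A < |x| then |x| ^ s else 0) ≤ (A ^ k)⁻¹ * (1 + |x|) ^ (k + 1) := by
      split_ifs with hAx
      · have h3 : |x| ^ s ≤ 1 + |x| :=
          (Real.rpow_le_rpow (abs_nonneg x) (by linarith) hs0.le).trans
            ((Real.rpow_le_rpow_of_exponent_le hx1 hs1).trans_eq (Real.rpow_one _))
        have h4 : A ^ k ≤ (1 + |x|) ^ k := pow_le_pow_left₀ hA.le (by linarith) _
        rw [inv_mul_eq_div, le_div_iff₀ (by positivity), pow_succ]
        calc _ ≤ (1 + |x|) * (1 + |x|) ^ k := by gcongr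
          _ = _ := mul_comm _ _
      · positivity
    calc _ ≤ ((A ^ k)⁻¹ * (1 + |x|) ^ (k + 1)) *
          (c * ((1 + |x|) ^ (2 * N) * polyRes q x ^ s)) := by
          gcongr
      _ = c * (A ^ k)⁻¹ * ((1 + |x|) ^ (k + 1 + 2 * N) * polyRes q x ^ s) := by
          rw [pow_add _ (k + 1)]; ring
      _ ≤ _ := by
          gcongr
          have e1 : (1 + |x|) ^ (2 * (k + 1 + 2 * N)) = ((1 + |x|) ^ (k + 1 + 2 * N)) ^ 2 := by
            rw [← pow_mul, mul_comm]
          have e2 : polyRes q x ^ (2 * s) = (polyRes q x ^ s) ^ 2 := by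
            rw [← Real.rpow_mul_natCast (by linarith), mul_comm]; norm_num
          rw [e1, e2]
          nlinarith [sq_nonneg ((1 + |x|) ^ (k + 1 + 2 * N) - polyRes q x ^ s),
            sq_nonneg ((1 + |x|) ^ (k + 1 + 2 * N)), sq_nonneg (polyRes q x ^ s)]
  -- the lower bound on the right-hand side, from `2 ≤ t + t⁻¹`
  have hlow : 1 ≤ ENNReal.ofReal (c⁻¹ * C₂) * ∫⁻ x, ENNReal.ofReal (‖f x‖ ^ s) ∂ν := by
    have h1 : (2 : ℝ≥0∞) ≤ ENNReal.ofReal (c⁻¹ * C₂) * ∫⁻ x, ENNReal.ofReal (‖f x‖ ^ s) ∂ν + 1 := by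
      calc (2 : ℝ≥0∞) = ∫⁻ _, ENNReal.ofReal 2 ∂ν := by simp
        _ ≤ ∫⁻ x, (ENNReal.ofReal (c⁻¹ * C₂) * ENNReal.ofReal (‖f x‖ ^ s) +
            ENNReal.ofReal C₂⁻¹ *
              ENNReal.ofReal ((1 + |x|) ^ (2 * (2 * N)) + polyRes p x ^ (2 * s))) ∂ν := by
            refine lintegral_mono_ae ?_
            filter_upwards [hqae, hpae] with x hx hx'
            have hZ := one_le_polyRes p x
            have h2 := div_rpow_le_polySize hq hp hs0 hs1 hx'
            have hg0 : 0 < ‖f x‖ ^ s := by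
              rw [hfeq x hx]
              have h3 := norm_pos_iff.2 hx
              have h4 := norm_pos_iff.2 hx'
              positivity
            have h3 : (‖q.eval (x : ℂ)‖ / ‖p.eval (x : ℂ)‖) ^ s = (‖f x‖ ^ s)⁻¹ := by
              rw [hfeq x hx, ← Real.inv_rpow (by positivity), inv_div]
            rw [h3, hci] at h2
            rw [← ENNReal.ofReal_mul (by positivity), ← ENNReal.ofReal_mul (by positivity),
              ← ENNReal.ofReal_add (by positivity) (by positivity)]
            refine ENNReal.ofReal_le_ofReal ?_
            have h5 : (1 + |x|) ^ (2 * N) * polyRes p x ^ s ≤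
                (1 + |x|) ^ (2 * (2 * N)) + polyRes p x ^ (2 * s) := by
              have e1 : (1 + |x|) ^ (2 * (2 * N)) = ((1 + |x|) ^ (2 * N)) ^ 2 := by
                rw [← pow_mul, mul_comm]
              have e2 : polyRes p x ^ (2 * s) = (polyRes p x ^ s) ^ 2 := by
                rw [← Real.rpow_mul_natCast (by linarith), mul_comm]; norm_num
              rw [e1, e2]
              nlinarith [sq_nonneg ((1 + |x|) ^ (2 * N) - polyRes p x ^ s),
                sq_nonneg ((1 + |x|) ^ (2 * N)), sq_nonneg (polyRes p x ^ s)]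
            have h6 : c * C₂⁻¹ * (‖f x‖ ^ s)⁻¹ ≤
                C₂⁻¹ * ((1 + |x|) ^ (2 * (2 * N)) + polyRes p x ^ (2 * s)) := by
              calc c * C₂⁻¹ * (‖f x‖ ^ s)⁻¹ ≤
                    c * C₂⁻¹ * (c⁻¹ * ((1 + |x|) ^ (2 * (2 * N)) + polyRes p x ^ (2 * s))) := by
                    gcongr
                    exact h2.trans (by gcongr)
                _ = _ := by field_simp
            have h7 : 2 ≤ c⁻¹ * C₂ * ‖f x‖ ^ s + c * C₂⁻¹ * (‖f x‖ ^ s)⁻¹ := by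
              set y := c⁻¹ * C₂ * ‖f x‖ ^ s with hy
              have hy0 : 0 < y := by positivity
              have h8 : c * C₂⁻¹ * (‖f x‖ ^ s)⁻¹ = y⁻¹ := by
                rw [hy, mul_inv, mul_inv, inv_inv]
              rw [h8]
              have h9 : y * y⁻¹ = 1 := mul_inv_cancel₀ hy0.ne'
              nlinarith [sq_nonneg (y - y⁻¹), inv_pos.2 hy0]
            linarith
        _ ≤ _ := by
            rw [lintegral_add_right _ (by have := measurable_polyRes p; fun_prop),
              lintegral_const_mul' _ _ ENNReal.ofReal_ne_top,
              lintegral_const_mul' _ _ ENNReal.ofReal_ne_top]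
            gcongr
            refine (mul_le_mul_right (hL p hp) _).trans ?_
            rw [← ENNReal.ofReal_mul (by positivity), inv_mul_cancel₀ hC₂.ne', ENNReal.ofReal_one]
    rw [← one_add_one_eq_two] at h1
    exact (ENNReal.add_le_add_iff_right ENNReal.one_ne_top).1 h1
  calc _ ≤ ENNReal.ofReal (c * (A ^ k)⁻¹ * C₁) := hup
    _ ≤ ENNReal.ofReal (c * (A ^ k)⁻¹ * C₁) *
        (ENNReal.ofReal (c⁻¹ * C₂) * ∫⁻ x, ENNReal.ofReal (‖f x‖ ^ s) ∂ν) :=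
        le_mul_of_one_le_right zero_le hlow
    _ = _ := by
        rw [← mul_assoc, ← ENNReal.ofReal_mul (by positivity)]
        congr 2
        field_simp

end

/-! ### Operators on the particle-hole Hilbert space -/

section

variable {d r : ℕ}

lemma mem_box {R : ℕ} {j : Site d} : j ∈ box d R ↔ ‖j‖ ≤ R := by
  rw [box, Finset.mem_Icc, pi_norm_le_iff_of_nonneg (Nat.cast_nonneg R), Pi.le_def, Pi.le_def,
    ← forall_and]
  refine forall_congr' fun i => ?_
  rw [Int.norm_eq_abs, ← Int.cast_abs, ← Int.cast_natCast (R := ℝ), Int.cast_le, abs_le]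

lemma neg_mem_box {R : ℕ} {j : Site d} (hj : j ∈ box d R) : -j ∈ box d R := by
  rw [mem_box] at hj ⊢
  rwa [norm_neg]

lemma zero_mem_box (R : ℕ) : (0 : Site d) ∈ box d R := by
  rw [mem_box, norm_zero]
  exact Nat.cast_nonneg R

lemma sum_norm_sq_le (ψ : Hil d r) (s : Finset (Site d)) : ∑ n ∈ s, ‖ψ n‖ ^ 2 ≤ ‖ψ‖ ^ 2 := by
  have h := lp.sum_rpow_le_norm_rpow (p := 2) (by norm_num) ψ s
  simpa using h

lemma norm_le_of_sum_norm_sq_le {ψ : Hil d r} {C : ℝ} (hC : 0 ≤ C)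
    (h : ∀ s : Finset (Site d), ∑ n ∈ s, ‖ψ n‖ ^ 2 ≤ C ^ 2) : ‖ψ‖ ≤ C := by
  refine lp.norm_le_of_forall_sum_le (p := 2) (by norm_num) hC fun s => ?_
  simpa using h s

lemma memlp_of_sum_norm_sq_le {f : Site d → Fiber r} {C : ℝ}
    (h : ∀ s : Finset (Site d), ∑ n ∈ s, ‖f n‖ ^ 2 ≤ C) : Memℓp f 2 := by
  refine memℓp_gen' (C := C) fun s => ?_
  simpa using h s

lemma norm_apply_le (ψ : Hil d r) (n : Site d) : ‖ψ n‖ ≤ ‖ψ‖ :=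
  lp.norm_apply_le_norm (by norm_num) ψ n

/-- A Schur-type bound for operators of finite range. -/
lemma opNorm_le_of_finite_range {X : Hil d r →L[ℂ] Hil d r} {c : ℝ} (hc : 0 ≤ c)
    (B : Finset (Site d)) (h : ∀ ψ n, ‖X ψ n‖ ≤ c * ∑ j ∈ B, ‖ψ (n - j)‖) :
    ‖X‖ ≤ c * B.card := by
  refine X.opNorm_le_bound (by positivity) fun ψ => ?_
  refine norm_le_of_sum_norm_sq_le (by positivity) fun s => ?_
  calc ∑ n ∈ s, ‖X ψ n‖ ^ 2 ≤ ∑ n ∈ s, c ^ 2 * (B.card * ∑ j ∈ B, ‖ψ (n - j)‖ ^ 2) := by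
        refine Finset.sum_le_sum fun n _ => ?_
        calc ‖X ψ n‖ ^ 2 ≤ (c * ∑ j ∈ B, ‖ψ (n - j)‖) ^ 2 := by gcongr; exact h ψ n
          _ = c ^ 2 * (∑ j ∈ B, ‖ψ (n - j)‖) ^ 2 := by ring
          _ ≤ _ := by gcongr; exact sq_sum_le_card_mul_sum_sq
    _ = c ^ 2 * B.card * ∑ j ∈ B, ∑ n ∈ s, ‖ψ (n - j)‖ ^ 2 := by
        rw [Finset.sum_comm, ← Finset.mul_sum, ← Finset.mul_sum, Finset.sum_comm]
        ring
    _ ≤ c ^ 2 * B.card * ∑ j ∈ B, ‖ψ‖ ^ 2 := by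
        gcongr with j
        have := sum_norm_sq_le ψ (s.map (Equiv.subRight j).toEmbedding)
        rwa [Finset.sum_map] at this
    _ = _ := by
        rw [Finset.sum_const, nsmul_eq_mul]
        ring

lemma hasSum_apply (A : Hil d r →L[ℂ] Hil d r) (ψ : Hil d r) (n : Site d) :
    HasSum (fun m => A (lp.single 2 m (ψ m)) n) (A ψ n) :=
  ((lp.hasSum_single (by norm_num) ψ).mapL A).mapL (lp.evalCLM ℂ (fun _ : Site d => Fiber r) 2 n)

/-- The matrix expansion of a bounded operator, for a row with finitely many entries. -/
lemma apply_eq_sum (A : Hil d r →L[ℂ] Hil d r) (ψ : Hil d r) (n : Site d) (s : Finset (Site d))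
    (h : ∀ m ∉ s, A (lp.single 2 m (ψ m)) n = 0) :
    A ψ n = ∑ m ∈ s, A (lp.single 2 m (ψ m)) n :=
  (hasSum_apply A ψ n).unique (hasSum_sum_of_ne_finset_zero h)

lemma single_eq_sum (m : Site d) (x : Fiber r) :
    (lp.single 2 m x : Hil d r) = ∑ b, x b • lp.single 2 m (EuclideanSpace.single b (1 : ℂ)) := by
  have h : x = ∑ b, x b • EuclideanSpace.single b (1 : ℂ) := by
    ext a
    simp [-Fintype.sum_sum_type, Pi.single_apply]
  conv_lhs => rw [h]
  rw [← lp.lsingle_apply (𝕜 := ℂ), map_sum]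
  simp

lemma apply_single_of_block_eq_zero {A : Hil d r →L[ℂ] Hil d r} {n m : Site d}
    (h : block A n m = 0) (x : Fiber r) : A (lp.single 2 m x) n = 0 := by
  have h1 : ∀ b, A (lp.single 2 m (EuclideanSpace.single b (1 : ℂ))) n = 0 := by
    intro b
    ext a
    exact congrFun (congrFun h a) b
  rw [single_eq_sum, map_sum, lp.coeFn_sum, Finset.sum_apply]
  refine Finset.sum_eq_zero fun b _ => ?_
  rw [map_smul, lp.coeFn_smul, Pi.smul_apply, h1, smul_zero]

/-- Multiplication by a bounded real function on the lattice. -/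
noncomputable def mulCLM (w : Site d → ℝ) (C : ℝ) (hw : ∀ n, |w n| ≤ C) :
    Hil d r →L[ℂ] Hil d r :=
  have key : ∀ (ψ : Hil d r) (s : Finset (Site d)),
      ∑ n ∈ s, ‖(w n : ℂ) • ψ n‖ ^ 2 ≤ (C * ‖ψ‖) ^ 2 := fun ψ s => by
    calc _ ≤ ∑ n ∈ s, C ^ 2 * ‖ψ n‖ ^ 2 := by
          refine Finset.sum_le_sum fun n _ => ?_
          rw [norm_smul, mul_pow, Complex.norm_real, Real.norm_eq_abs]
          gcongr
          exact hw n
      _ ≤ _ := by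
          rw [← Finset.mul_sum, mul_pow]
          gcongr
          exact sum_norm_sq_le ψ s
  LinearMap.mkContinuous
    { toFun := fun ψ => ⟨fun n => (w n : ℂ) • ψ n, memlp_of_sum_norm_sq_le (key ψ)⟩
      map_add' := fun ψ φ => by ext n : 2; exact smul_add _ _ _
      map_smul' := fun c ψ => by ext n : 2; exact smul_comm (w n : ℂ) c (ψ n) } C
    fun ψ => norm_le_of_sum_norm_sq_le
      (mul_nonneg ((abs_nonneg _).trans (hw 0)) (norm_nonneg _)) (key ψ)

@[simp]
lemma mulCLM_apply (w : Site d → ℝ) (C : ℝ) (hw : ∀ n, |w n| ≤ C) (ψ : Hil d r) (n : Site d) :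
    mulCLM w C hw ψ n = (w n : ℂ) • ψ n := rfl

section Resolvent

variable {A : Type*} [CStarAlgebra A]

/-- The norm of the resolvent of a self-adjoint element is at most the inverse distance to the
spectrum. -/
lemma isUnit_and_norm_inverse_le {a : A} (ha : IsSelfAdjoint a) {z : ℂ} {δ : ℝ} (hδ : 0 < δ)
    (h : ∀ x ∈ spectrum ℂ a, δ ≤ ‖z - x‖) :
    IsUnit (algebraMap ℂ A z - a) ∧ ‖Ring.inverse (algebraMap ℂ A z - a)‖ ≤ δ⁻¹ := by
  have hu : IsUnit (algebraMap ℂ A z - a) := by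
    rw [← spectrum.notMem_iff]
    intro hz
    have := h z hz
    rw [sub_self, norm_zero] at this
    linarith
  refine ⟨hu, ?_⟩
  obtain ⟨u, hu'⟩ := hu
  rw [← hu', Ring.inverse_unit]
  rcases subsingleton_or_nontrivial A with hA | hA
  · rw [Subsingleton.elim ((u⁻¹ : Aˣ) : A) 0, norm_zero]
    positivity
  have hn : IsStarNormal (u : A) := by
    rw [hu']
    refine ⟨?_⟩
    rw [star_sub, ha.star_eq, ← algebraMap_star_comm]
    exact (((Algebra.commute_algebraMap_left _ _).sub_left
      (Algebra.commute_algebraMap_right _ _)).sub_right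
      ((Algebra.commute_algebraMap_left _ _).sub_left (Commute.refl a)))
  have hn' : IsStarNormal ((u⁻¹ : Aˣ) : A) := IsStarNormal.val_inv
  -- the inverse is normal, so that its norm is attained on its spectrum
  obtain ⟨k, hk, hk'⟩ := spectrum.exists_nnnorm_eq_spectralRadius ((u⁻¹ : Aˣ) : A)
  rw [IsStarNormal.spectralRadius_eq_nnnorm, ENNReal.coe_inj] at hk'
  have hk0 : k ≠ 0 := by
    rintro rfl
    exact spectrum.zero_notMem ℂ (u⁻¹).isUnit hk
  have h1 : k⁻¹ ∈ spectrum ℂ (u : A) := by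
    have := (spectrum.inv_mem_iff (r := Units.mk0 k hk0) (a := u⁻¹)).1 hk
    simpa using this
  rw [hu', ← spectrum.singleton_sub_eq, Set.singleton_sub] at h1
  obtain ⟨x, hx, hxk⟩ := h1
  have h2 := h x hx
  have h3 : z - x = k⁻¹ := hxk
  rw [h3, norm_inv] at h2
  have h4 : ‖((u⁻¹ : Aˣ) : A)‖ = ‖k‖ := by
    rw [← coe_nnnorm, ← coe_nnnorm, hk']
  rw [h4]
  exact (le_inv_comm₀ hδ (norm_pos_iff.2 hk0)).1 h2

lemma isUnit_and_norm_inverse_le_im {a : A} (ha : IsSelfAdjoint a) {z : ℂ} (hz : z.im ≠ 0) :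
    IsUnit (algebraMap ℂ A z - a) ∧ ‖Ring.inverse (algebraMap ℂ A z - a)‖ ≤ |z.im|⁻¹ := by
  refine isUnit_and_norm_inverse_le ha (abs_pos.2 hz) fun x hx => ?_
  have := Complex.abs_im_le_norm (z - x)
  rwa [Complex.sub_im, ha.im_eq_zero_of_mem_spectrum hx, sub_zero] at this

end Resolvent

end

/-! ### Bonds and truncated Hamiltonians -/

section

variable {d r : ℕ}

/-- The bond `(j, l)` joins `l` to `l + j`; traversed backwards it is `(-j, l + j)`. -/
def flip (p : Site d × Site d) : Site d × Site d := (-p.1, p.2 + p.1)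

@[simp]
lemma flip_flip (p : Site d × Site d) : flip (flip p) = p := by
  simp [flip]

/-- The bonds of range `R` with both endpoints in the box `|l| ≤ L`. Two different sites at distance
at most `R` are joined by two bonds, one for each direction. -/
noncomputable def bonds (d R L : ℕ) : Finset (Site d × Site d) :=
  (box d R ×ˢ box d L).filter fun p => p.2 + p.1 ∈ box d L

lemma mem_bonds {R L : ℕ} {p : Site d × Site d} :
    p ∈ bonds d R L ↔ p.1 ∈ box d R ∧ p.2 ∈ box d L ∧ p.2 + p.1 ∈ box d L := by
  simp [bonds, and_assoc]

lemma flip_mem_bonds {R L : ℕ} {p : Site d × Site d} (hp : p ∈ bonds d R L) :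
    flip p ∈ bonds d R L := by
  rw [mem_bonds] at hp ⊢
  exact ⟨neg_mem_box hp.1, hp.2.2, by simpa [flip] using hp.2.1⟩

namespace Model

variable (M : Model d r)

/-- The hopping operator `π_{l+j}^* W_j π_l` of the bond `p = (j, l)`. -/
noncomputable def hop (p : Site d × Site d) : Hil d r →L[ℂ] Hil d r :=
  lp.singleContinuousLinearMap ℂ (fun _ : Site d => Fiber r) 2 (p.2 + p.1) ∘L
    Matrix.toEuclideanCLM (𝕜 := ℂ) (M.W p.1) ∘L lp.evalCLM ℂ (fun _ : Site d => Fiber r) 2 p.2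

lemma hop_apply (p : Site d × Site d) (ψ : Hil d r) :
    M.hop p ψ = lp.single 2 (p.2 + p.1) (Matrix.toEuclideanCLM (𝕜 := ℂ) (M.W p.1) (ψ p.2)) := rfl

lemma star_hop {p : Site d × Site d} (hp : p.1 ∈ box d M.R) : star (M.hop p) = M.hop (flip p) := by
  rw [ContinuousLinearMap.star_eq_adjoint]
  symm
  rw [ContinuousLinearMap.eq_adjoint_iff]
  intro ψ φ
  rw [hop_apply, hop_apply, lp.inner_single_left, lp.inner_single_right]
  simp only [flip, M.W_neg _ hp, add_neg_cancel_right]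
  rw [← Matrix.star_eq_conjTranspose, map_star, ContinuousLinearMap.star_eq_adjoint,
    ContinuousLinearMap.adjoint_inner_left]

/-- The random part restricted to a finite set of bonds. -/
noncomputable def finV (F : Finset (Site d × Site d)) (u : Site d → Site d → ℝ) :
    Hil d r →L[ℂ] Hil d r :=
  ∑ p ∈ F, (u p.1 p.2 : ℂ) • M.hop p

lemma isSelfAdjoint_finV {L : ℕ} {u : Site d → Site d → ℝ}
    (hu : ∀ p ∈ bonds d M.R L, u p.1 p.2 = u (flip p).1 (flip p).2) :
    IsSelfAdjoint (M.finV (bonds d M.R L) u) := by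
  rw [IsSelfAdjoint, finV, star_sum]
  refine Finset.sum_nbij' flip flip (fun p hp => flip_mem_bonds hp) (fun p hp => flip_mem_bonds hp)
    (fun p _ => flip_flip p) (fun p _ => flip_flip p) fun p hp => ?_
  rw [star_smul, M.star_hop (mem_bonds.1 hp).1, ← hu p hp]
  simp

/-- The finite-volume Hamiltonian: all of `H₀`, and the random part on finitely many bonds. -/
noncomputable def finH (F : Finset (Site d × Site d)) (lam : ℝ) (u : Site d → Site d → ℝ) :
    Hil d r →L[ℂ] Hil d r :=
  M.H₀ + (lam : ℂ) • M.finV F u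

lemma isSelfAdjoint_finH {L : ℕ} (lam : ℝ) {u : Site d → Site d → ℝ}
    (hu : ∀ p ∈ bonds d M.R L, u p.1 p.2 = u (flip p).1 (flip p).2) :
    IsSelfAdjoint (M.finH (bonds d M.R L) lam u) := by
  refine M.selfAdjoint.add ?_
  refine IsSelfAdjoint.smul ?_ (M.isSelfAdjoint_finV hu)
  exact Complex.conj_ofReal lam

/-- The resolvent of the finite-volume Hamiltonian (zero if it does not exist). -/
noncomputable def finG (F : Finset (Site d × Site d)) (lam : ℝ) (z : ℂ)
    (u : Site d → Site d → ℝ) : Hil d r →L[ℂ] Hil d r :=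
  Ring.inverse (algebraMap ℂ _ z - M.finH F lam u)

lemma hop_apply_apply (p : Site d × Site d) (ψ : Hil d r) (n : Site d) :
    M.hop p ψ n =
      if p.2 + p.1 = n then Matrix.toEuclideanCLM (𝕜 := ℂ) (M.W p.1) (ψ p.2) else 0 := by
  rw [hop_apply]
  split_ifs with h
  · rw [← h, lp.single_apply_self]
  · rw [lp.single_apply_ne _ _ _ (Ne.symm h)]

lemma finV_apply_eq_sum (F : Finset (Site d × Site d)) (u : Site d → Site d → ℝ) (ψ : Hil d r)
    (n : Site d) : M.finV F u ψ n = ∑ p ∈ F, (u p.1 p.2 : ℂ) • M.hop p ψ n := by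
  change lp.evalCLM ℂ (fun _ : Site d => Fiber r) 2 n (M.finV F u ψ) = _
  rw [finV, _root_.sum_apply, map_sum]
  rfl

lemma finV_apply (L : ℕ) (u : Site d → Site d → ℝ) (ψ : Hil d r) (n : Site d) :
    M.finV (bonds d M.R L) u ψ n = ∑ j ∈ box d M.R, if (j, n - j) ∈ bonds d M.R L then
      (u j (n - j) : ℂ) • Matrix.toEuclideanCLM (𝕜 := ℂ) (M.W j) (ψ (n - j)) else 0 := by
  rw [finV_apply_eq_sum, bonds, Finset.sum_filter, Finset.sum_product]
  refine Finset.sum_congr rfl fun j hj => ?_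
  simp only [Finset.mem_filter, Finset.mem_product, hj, true_and, sub_add_cancel, hop_apply_apply]
  by_cases hn : n - j ∈ box d L
  · rw [Finset.sum_eq_single_of_mem _ hn]
    · simp [hn]
    · intro l _ hl
      rw [if_neg (fun h : l + j = n => hl (eq_sub_of_add_eq h)), smul_zero, ite_self]
  · simp only [hn, false_and, if_false]
    refine Finset.sum_eq_zero fun l hl => ?_
    have hne : l + j ≠ n := by
      rintro rfl
      simp [hl] at hn
    rw [if_neg hne, smul_zero, ite_self]

/-- The unperturbed operator has finite range. The range `R'` may be enlarged, which allows for a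
common range of the unperturbed and the random part. -/
lemma exists_H₀_apply : ∃ R₀ : ℕ, ∀ R', R₀ ≤ R' → ∀ (ψ : Hil d r) (n : Site d),
    M.H₀ ψ n = ∑ j ∈ box d R', M.H₀ (lp.single 2 (n - j) (ψ (n - j))) n := by
  obtain ⟨R₀, hR₀⟩ := M.finiteRange
  refine ⟨R₀, fun R' hR' ψ n => ?_⟩
  rw [apply_eq_sum M.H₀ ψ n ((box d R').map (Equiv.subLeft n).toEmbedding), Finset.sum_map]
  · rfl
  · intro m hm
    refine apply_single_of_block_eq_zero (hR₀ n m ?_) _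
    by_contra hlt
    refine hm (Finset.mem_map.2 ⟨n - m, mem_box.2 ((not_lt.1 hlt).trans ?_), ?_⟩)
    · exact_mod_cast hR'
    · simp

end Model

end

/-! ### The Combes-Thomas estimate for small hoppings -/

section

variable {d r : ℕ}

lemma norm_le_of_sub_apply_eq {P X : Hil d r →L[ℂ] Hil d r} {D : ℝ} (hD : 0 < D) (hP : IsUnit P)
    (hP' : ‖Ring.inverse P‖ ≤ D⁻¹) (hX : ‖X‖ ≤ D / 2) {ψ χ : Hil d r} (h : P ψ - X ψ = χ) :
    ‖ψ‖ ≤ 2 / D * ‖χ‖ := by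
  have h1 : Ring.inverse P (P ψ) = ψ := by
    rw [← mul_apply_eq_comp, Ring.inverse_mul_cancel _ hP]
    rfl
  have h2 : ‖ψ‖ ≤ D⁻¹ * (‖χ‖ + D / 2 * ‖ψ‖) := by
    rw [sub_eq_iff_eq_add] at h
    calc ‖ψ‖ = ‖Ring.inverse P (χ + X ψ)‖ := by rw [← h, h1]
      _ ≤ ‖Ring.inverse P‖ * ‖χ + X ψ‖ := ContinuousLinearMap.le_opNorm _ _
      _ ≤ D⁻¹ * (‖χ‖ + ‖X‖ * ‖ψ‖) := by
          gcongr
          exact (norm_add_le _ _).trans (by gcongr; exact X.le_opNorm _)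
      _ ≤ _ := by gcongr
  have h3 : D⁻¹ * (‖χ‖ + D / 2 * ‖ψ‖) = D⁻¹ * ‖χ‖ + ‖ψ‖ / 2 := by field_simp
  rw [h3] at h2
  rw [div_eq_mul_inv]
  linarith

lemma isUnit_sub_of_norm_le {P X : Hil d r →L[ℂ] Hil d r} {D : ℝ} (hD : 0 < D) (hP : IsUnit P)
    (hP' : ‖Ring.inverse P‖ ≤ D⁻¹) (hX : ‖X‖ ≤ D / 2) : IsUnit (P - X) := by
  have h1 : ‖Ring.inverse P * X‖ < 1 := by
    refine (norm_mul_le _ _).trans_lt ?_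
    calc _ ≤ D⁻¹ * (D / 2) := by gcongr
      _ < 1 := by field_simp; norm_num
  have h2 : P - X = P * (1 - Ring.inverse P * X) := by
    rw [mul_sub, mul_one, ← mul_assoc, Ring.mul_inverse_cancel _ hP, one_mul]
  rw [h2]
  exact hP.mul (isUnit_one_sub_of_norm_lt_one h1)

/-- Multiplication by the exponential weight `exp (η φ)`, for a bounded function `φ ≥ 0`, and its
inverse. -/
lemma exists_weights {η ρ : ℝ} (hη : 0 ≤ η) (φ : Site d → ℝ) (h0 : ∀ n, 0 ≤ φ n)
    (hρ : ∀ n, φ n ≤ ρ) : ∃ Ep Em : Hil d r →L[ℂ] Hil d r,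
      (∀ ψ n, Ep ψ n = (Real.exp (η * φ n) : ℂ) • ψ n) ∧
      (∀ ψ n, Em ψ n = (Real.exp (-(η * φ n)) : ℂ) • ψ n) ∧ Ep * Em = 1 ∧ Em * Ep = 1 := by
  have h1 : ∀ n, |Real.exp (η * φ n)| ≤ Real.exp (η * ρ) := fun n => by
    rw [Real.abs_exp]
    have := hρ n
    gcongr
  have h2 : ∀ n, |Real.exp (-(η * φ n))| ≤ 1 := fun n => by
    rw [Real.abs_exp, Real.exp_le_one_iff]
    have := mul_nonneg hη (h0 n)
    linarith
  have h3 : ∀ n, (Real.exp (η * φ n) : ℂ) * (Real.exp (-(η * φ n)) : ℂ) = 1 := by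
    intro n
    rw [← Complex.ofReal_mul, ← Real.exp_add, add_neg_cancel, Real.exp_zero, Complex.ofReal_one]
  refine ⟨mulCLM _ _ h1, mulCLM _ _ h2, fun ψ n => rfl, fun ψ n => rfl, ?_, ?_⟩
  · ext ψ n : 3
    rw [mul_apply_eq_comp, mulCLM_apply, mulCLM_apply, smul_smul, h3, one_smul]
    rfl
  · ext ψ n : 3
    rw [mul_apply_eq_comp, mulCLM_apply, mulCLM_apply, smul_smul, mul_comm, h3, one_smul]
    rfl

namespace Model

variable (M : Model d r)

lemma norm_conj_H₀_sub_le {R' : ℕ}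
    (hR₀ : ∀ (ψ : Hil d r) (n : Site d),
      M.H₀ ψ n = ∑ j ∈ box d R', M.H₀ (lp.single 2 (n - j) (ψ (n - j))) n)
    {η : ℝ} (hηR : η * R' ≤ 1) (φ : Site d → ℝ)
    (hφ : ∀ n, ∀ j ∈ box d R', |η * (φ n - φ (n - j))| ≤ η * R')
    {Em : Hil d r →L[ℂ] Hil d r} (hEm : ∀ ψ n, Em ψ n = (Real.exp (-(η * φ n)) : ℂ) • ψ n)
    (ψ : Hil d r) (n : Site d) :
    ‖(Real.exp (η * φ n) : ℂ) • M.H₀ (Em ψ) n - M.H₀ ψ n‖ ≤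
      2 * (η * R') * ‖M.H₀‖ * ∑ j ∈ box d R', ‖ψ (n - j)‖ := by
  rw [hR₀ ψ n, hR₀ (Em ψ) n, Finset.smul_sum, ← Finset.sum_sub_distrib, Finset.mul_sum]
  refine norm_sum_le_of_le _ fun j hj => ?_
  have e3 : M.H₀ (lp.single 2 (n - j) (Em ψ (n - j))) n =
      (Real.exp (-(η * φ (n - j))) : ℂ) • M.H₀ (lp.single 2 (n - j) (ψ (n - j))) n := by
    rw [hEm, lp.single_smul, map_smul]
    rfl
  rw [e3, smul_smul, ← Complex.ofReal_mul, ← Real.exp_add]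
  nth_rewrite 2 [← one_smul ℂ (M.H₀ (lp.single 2 (n - j) (ψ (n - j))) n)]
  rw [← sub_smul, norm_smul, ← Complex.ofReal_one, ← Complex.ofReal_sub, Complex.norm_real,
    Real.norm_eq_abs, ← sub_eq_add_neg, ← mul_sub, mul_assoc _ ‖M.H₀‖]
  have e4 := hφ n j hj
  have e5 : ‖M.H₀ (lp.single 2 (n - j) (ψ (n - j))) n‖ ≤ ‖M.H₀‖ * ‖ψ (n - j)‖ := by
    refine (norm_apply_le _ _).trans ((M.H₀.le_opNorm _).trans ?_)
    rw [lp.norm_single (by norm_num)]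
  refine mul_le_mul ?_ e5 (norm_nonneg _) ?_
  · exact (Real.abs_exp_sub_one_le (e4.trans hηR)).trans (by gcongr)
  · linarith [(abs_nonneg _).trans e4]

lemma norm_conj_finV_le {R' L : ℕ} (hR' : M.R ≤ R') {η : ℝ} (hηR : η * R' ≤ 1) (φ : Site d → ℝ)
    (hφ : ∀ n, ∀ j ∈ box d R', |η * (φ n - φ (n - j))| ≤ η * R')
    {Em : Hil d r →L[ℂ] Hil d r} (hEm : ∀ ψ n, Em ψ n = (Real.exp (-(η * φ n)) : ℂ) • ψ n)
    {lam t : ℝ} (hlam : 0 < lam) (ht : 0 ≤ t) {u : Site d → Site d → ℝ}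
    (hu : ∀ p ∈ bonds d M.R L, lam * |u p.1 p.2| ≤ t) (ψ : Hil d r) (n : Site d) :
    ‖(Real.exp (η * φ n) : ℂ) • (lam : ℂ) • M.finV (bonds d M.R L) u (Em ψ) n‖ ≤
      3 * t * (∑ j ∈ box d M.R, ‖Matrix.toEuclideanCLM (𝕜 := ℂ) (M.W j)‖) *
        ∑ j ∈ box d R', ‖ψ (n - j)‖ := by
  rw [M.finV_apply, Finset.smul_sum, Finset.smul_sum, Finset.mul_sum (box d M.R), Finset.sum_mul]
  refine norm_sum_le_of_le _ fun j hj => ?_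
  have hjB : j ∈ box d R' := mem_box.2 ((mem_box.1 hj).trans (by exact_mod_cast hR'))
  have hle : ‖ψ (n - j)‖ ≤ ∑ j ∈ box d R', ‖ψ (n - j)‖ :=
    Finset.single_le_sum (f := fun j => ‖ψ (n - j)‖) (fun _ _ => norm_nonneg _) hjB
  split_ifs with hjF
  · have e7 : ‖(Real.exp (η * φ n) : ℂ) * ((lam : ℂ) * (u j (n - j) *
        (Real.exp (-(η * φ (n - j))) : ℂ)))‖ =
        Real.exp (η * (φ n - φ (n - j))) * (lam * |u j (n - j)|) := by
      rw [norm_mul, norm_mul, norm_mul, Complex.norm_real, Complex.norm_real,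
        Complex.norm_real, Complex.norm_real, Real.norm_eq_abs, Real.norm_eq_abs,
        Real.norm_eq_abs, Real.norm_eq_abs, Real.abs_exp, Real.abs_exp, abs_of_pos hlam,
        mul_sub, Real.exp_sub, Real.exp_neg]
      field_simp
    have e8 : Real.exp (η * (φ n - φ (n - j))) ≤ 3 := by
      have := (le_abs_self _).trans ((hφ n j hjB).trans hηR)
      exact (Real.exp_le_exp.2 this).trans (by linarith [Real.exp_one_lt_d9])
    rw [hEm, map_smul, smul_smul, smul_smul, smul_smul, norm_smul]
    rw [mul_assoc, mul_assoc, e7]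
    calc _ ≤ 3 * t * (‖Matrix.toEuclideanCLM (𝕜 := ℂ) (M.W j)‖ * ‖ψ (n - j)‖) := by
          refine mul_le_mul (mul_le_mul e8 (hu _ hjF) ?_ (by norm_num))
            (ContinuousLinearMap.le_opNorm _ _) (norm_nonneg _) (by positivity)
          exact mul_nonneg hlam.le (abs_nonneg _)
      _ ≤ _ := by
          rw [mul_assoc (3 * t)]
          gcongr
  · rw [smul_zero, smul_zero, norm_zero]
    positivity

lemma norm_conj_finH_sub_le {R' L : ℕ} (hR' : M.R ≤ R')
    (hR₀ : ∀ (ψ : Hil d r) (n : Site d),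
      M.H₀ ψ n = ∑ j ∈ box d R', M.H₀ (lp.single 2 (n - j) (ψ (n - j))) n)
    {η : ℝ} (hη : 0 ≤ η) (hηR : η * R' ≤ 1) (φ : Site d → ℝ)
    (hφ : ∀ n, ∀ j ∈ box d R', |η * (φ n - φ (n - j))| ≤ η * R')
    {Ep Em : Hil d r →L[ℂ] Hil d r} (hEp : ∀ ψ n, Ep ψ n = (Real.exp (η * φ n) : ℂ) • ψ n)
    (hEm : ∀ ψ n, Em ψ n = (Real.exp (-(η * φ n)) : ℂ) • ψ n)
    {lam t : ℝ} (hlam : 0 < lam) (ht : 0 ≤ t) {u : Site d → Site d → ℝ}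
    (hu : ∀ p ∈ bonds d M.R L, lam * |u p.1 p.2| ≤ t) :
    ‖Ep * M.finH (bonds d M.R L) lam u * Em - M.H₀‖ ≤
      (2 * (η * R') * ‖M.H₀‖ +
        3 * t * ∑ j ∈ box d M.R, ‖Matrix.toEuclideanCLM (𝕜 := ℂ) (M.W j)‖) *
        (box d R').card := by
  refine opNorm_le_of_finite_range (by positivity) _ fun ψ n => ?_
  have e1 : (Ep * M.finH (bonds d M.R L) lam u * Em - M.H₀) ψ n =
      ((Real.exp (η * φ n) : ℂ) • M.H₀ (Em ψ) n - M.H₀ ψ n) +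
        (Real.exp (η * φ n) : ℂ) • (lam : ℂ) • M.finV (bonds d M.R L) u (Em ψ) n := by
    change Ep (M.H₀ (Em ψ) + (lam : ℂ) • M.finV (bonds d M.R L) u (Em ψ)) n - M.H₀ ψ n = _
    rw [hEp, lp.coeFn_add, Pi.add_apply, smul_add, lp.coeFn_smul, Pi.smul_apply]
    abel
  rw [e1, add_mul]
  exact norm_add_le_of_le (M.norm_conj_H₀_sub_le hR₀ hηR φ hφ hEm ψ n)
    (M.norm_conj_finV_le hR' hηR φ hφ hEm hlam ht hu ψ n)

/-- **Combes-Thomas estimate.** A finite-volume Hamiltonian whose random part is small compared to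
the distance `D` of the spectral parameter to the spectrum of `H₀` has a resolvent which decays
exponentially, at a rate proportional to `D`. After conjugation with exponential weights it is a
perturbation of norm at most `D / 2` of `H₀`. -/
theorem exists_combesThomas {Dm : ℝ} (hDm : 0 < Dm) :
    ∃ c κ : ℝ, 0 < c ∧ 0 < κ ∧ c * Dm * M.R ≤ 1 ∧ ∀ D : ℝ, 0 < D → D ≤ Dm → ∀ z : ℂ,
      (∀ x ∈ spectrum ℂ M.H₀, D ≤ ‖z - x‖) → ∀ (L : ℕ) (lam : ℝ) (u : Site d → Site d → ℝ),
      0 < lam → (∀ p ∈ bonds d M.R L, lam * |u p.1 p.2| ≤ κ * D) →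
      IsUnit (algebraMap ℂ _ z - M.finH (bonds d M.R L) lam u) ∧
      ∀ (n m : Site d) (x : Fiber r), ‖M.finG (bonds d M.R L) lam z u (lp.single 2 m x) n‖ ≤
        2 / D * Real.exp (-(c * D * ‖n - m‖)) * ‖x‖ := by
  obtain ⟨R₀, hR₀⟩ := M.exists_H₀_apply
  obtain ⟨R', hR'0, hR'⟩ : ∃ R', R₀ ≤ R' ∧ M.R ≤ R' :=
    ⟨max R₀ M.R, le_max_left _ _, le_max_right _ _⟩
  obtain ⟨β, hβ⟩ : ∃ β : ℝ, β = (box d R').card := ⟨_, rfl⟩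
  have hβ1 : 1 ≤ β := by
    have : 0 < (box d R').card := Finset.card_pos.2 ⟨0, zero_mem_box R'⟩
    rw [hβ]
    exact_mod_cast this
  obtain ⟨h, hh⟩ : ∃ h : ℝ, h = ‖M.H₀‖ := ⟨_, rfl⟩
  obtain ⟨w, hw⟩ : ∃ w : ℝ, w = ∑ j ∈ box d M.R, ‖Matrix.toEuclideanCLM (𝕜 := ℂ) (M.W j)‖ :=
    ⟨_, rfl⟩
  have hh0 : 0 ≤ h := hh ▸ norm_nonneg _
  have hw0 : 0 ≤ w := hw ▸ Finset.sum_nonneg fun _ _ => norm_nonneg _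
  -- `c` makes the conjugation of `H₀`, and `κ` the random part, a perturbation of norm at most
  -- `D / 4`
  obtain ⟨c, hc⟩ : ∃ c : ℝ, c = ((R' + 1) * (Dm + 8 * β * (h + 1)))⁻¹ := ⟨_, rfl⟩
  obtain ⟨κ, hκ⟩ : ∃ κ : ℝ, κ = (12 * (w + 1) * β)⁻¹ := ⟨_, rfl⟩
  have hc0 : 0 < c := by rw [hc]; positivity
  have hκ0 : 0 < κ := by rw [hκ]; positivity
  have hc1 : c * ((R' + 1) * (Dm + 8 * β * (h + 1))) = 1 := by
    rw [hc]
    exact inv_mul_cancel₀ (by positivity)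
  have hκ1 : κ * (12 * (w + 1) * β) = 1 := by
    rw [hκ]
    exact inv_mul_cancel₀ (by positivity)
  have hcR : c * Dm * R' ≤ 1 := by
    calc c * Dm * R' = c * (R' * Dm) := by ring
      _ ≤ c * ((R' + 1) * (Dm + 8 * β * (h + 1))) := by
          gcongr
          · linarith
          · have : 0 ≤ 8 * β * (h + 1) := by positivity
            linarith
      _ = 1 := hc1
  refine ⟨c, κ, hc0, hκ0, ?_, fun D hD hDD z hz L lam u hlam hu => ?_⟩
  · refine le_trans ?_ hcR
    gcongr
  obtain ⟨η, hη⟩ : ∃ η : ℝ, η = c * D := ⟨_, rfl⟩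
  have hη0 : 0 < η := by rw [hη]; positivity
  have hηR : η * R' ≤ 1 := by
    refine le_trans ?_ hcR
    rw [hη]
    gcongr
  have main : ∀ (m : Site d) (ρ : ℝ), 0 ≤ ρ → ∃ Ep Em : Hil d r →L[ℂ] Hil d r,
      (∀ ψ n, Ep ψ n = (Real.exp (η * min ‖n - m‖ ρ) : ℂ) • ψ n) ∧ Ep * Em = 1 ∧ Em * Ep = 1 ∧
      ‖Ep * M.finH (bonds d M.R L) lam u * Em - M.H₀‖ ≤ D / 2 := by
    intro m ρ hρ
    have hφ : ∀ n, ∀ j ∈ box d R', |η * (min ‖n - m‖ ρ - min ‖n - j - m‖ ρ)| ≤ η * R' := by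
      intro n j hj
      rw [abs_mul, abs_of_pos hη0]
      gcongr
      refine (abs_min_sub_min_le_max _ _ _ _).trans ?_
      rw [sub_self, abs_zero, max_eq_left (abs_nonneg _)]
      refine (abs_norm_sub_norm_le _ _).trans ?_
      rw [sub_sub_sub_cancel_right, sub_sub_cancel]
      exact mem_box.1 hj
    obtain ⟨Ep, Em, hEp, hEm, hpm, hmp⟩ := exists_weights (r := r) hη0.le
      (fun n : Site d => min ‖n - m‖ ρ) (fun n => le_min (norm_nonneg _) hρ)
      (fun n => min_le_right _ _)
    refine ⟨Ep, Em, hEp, hpm, hmp, ?_⟩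
    refine (M.norm_conj_finH_sub_le hR' (hR₀ R' hR'0) hη0.le hηR (fun n => min ‖n - m‖ ρ) hφ hEp hEm
      hlam (by positivity) hu).trans ?_
    rw [← hβ, ← hh, ← hw]
    have h1 : 2 * (η * R') * h * β ≤ D / 4 := by
      have : 8 * (c * R' * h * β) ≤ 1 := by
        calc 8 * (c * R' * h * β) = c * (R' * (8 * β * h)) := by ring
          _ ≤ c * ((R' + 1) * (Dm + 8 * β * (h + 1))) := by
              gcongr
              · linarith
              · nlinarith
          _ = 1 := hc1
      calc _ = 8 * (c * R' * h * β) * (D / 4) := by rw [hη]; ring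
        _ ≤ 1 * (D / 4) := by gcongr
        _ = _ := one_mul _
    have h2 : 3 * (κ * D) * w * β ≤ D / 4 := by
      have : 12 * (κ * w * β) ≤ 1 := by
        rw [← hκ1]
        have : 0 ≤ κ * β := by positivity
        nlinarith
      calc _ = 12 * (κ * w * β) * (D / 4) := by ring
        _ ≤ 1 * (D / 4) := by gcongr
        _ = _ := one_mul _
    rw [add_mul]
    linarith
  obtain ⟨hU₀, hN₀⟩ := isUnit_and_norm_inverse_le M.selfAdjoint hD hz
  have hconj : ∀ Ep Em : Hil d r →L[ℂ] Hil d r, Em * Ep = 1 →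
      algebraMap ℂ _ z - M.finH (bonds d M.R L) lam u = Em * (algebraMap ℂ _ z - M.H₀ -
        (Ep * M.finH (bonds d M.R L) lam u * Em - M.H₀)) * Ep := by
    intro Ep Em hmp
    rw [sub_sub_sub_cancel_right, mul_sub, sub_mul, ← Algebra.commutes z Em, mul_assoc, hmp,
      mul_one, ← mul_assoc, ← mul_assoc, hmp, one_mul, mul_assoc, hmp, mul_one]
  have hunit : IsUnit (algebraMap ℂ _ z - M.finH (bonds d M.R L) lam u) := by
    obtain ⟨Ep, Em, -, hpm, hmp, hX⟩ := main 0 0 le_rfl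
    have hEp : IsUnit Ep := ⟨⟨Ep, Em, hpm, hmp⟩, rfl⟩
    have hEm : IsUnit Em := ⟨⟨Em, Ep, hmp, hpm⟩, rfl⟩
    rw [hconj Ep Em hmp]
    exact (hEm.mul (isUnit_sub_of_norm_le hD hU₀ hN₀ hX)).mul hEp
  refine ⟨hunit, fun n m x => ?_⟩
  -- the weight is cut off at the distance of `n` and `m`, which makes it bounded
  obtain ⟨Ep, Em, hEp, hpm, hmp, hX⟩ := main m ‖n - m‖ (norm_nonneg _)
  set ψ := M.finG (bonds d M.R L) lam z u (lp.single 2 m x) with hψ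
  have h1 : (algebraMap ℂ _ z - M.finH (bonds d M.R L) lam u) ψ = lp.single 2 m x := by
    rw [hψ, finG, ← mul_apply_eq_comp, Ring.mul_inverse_cancel _ hunit]
    rfl
  have h2 : (algebraMap ℂ _ z - M.H₀) (Ep ψ) -
      (Ep * M.finH (bonds d M.R L) lam u * Em - M.H₀) (Ep ψ) = lp.single 2 m x := by
    have e2 : Ep (lp.single 2 m x) = lp.single 2 m x := by
      ext k : 2
      rw [hEp]
      by_cases hk : k = m
      · subst hk
        simp
      · rw [lp.single_apply_ne _ _ _ hk, smul_zero]
    have e3 : ∀ S : Hil d r →L[ℂ] Hil d r, Ep ((Em * S * Ep) ψ) = S (Ep ψ) := by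
      intro S
      change (Ep * Em) (S (Ep ψ)) = _
      rw [hpm]
      rfl
    rw [← e2, ← h1, hconj Ep Em hmp, e3]
    rfl
  have h3 := norm_le_of_sub_apply_eq hD hU₀ hN₀ hX h2
  rw [lp.norm_single (by norm_num)] at h3
  have h4 := (norm_apply_le (Ep ψ) n).trans h3
  rw [hEp, min_self, norm_smul, Complex.norm_real, Real.norm_eq_abs, Real.abs_exp] at h4
  rw [← hη, Real.exp_neg, mul_right_comm, ← div_eq_mul_inv, le_div_iff₀ (Real.exp_pos _), mul_comm]
  exact h4

end Model

end

/-! ### Finite rank perturbations depending on a real parameter -/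

section

open Polynomial

variable {ι : Type*} [Fintype ι] [DecidableEq ι]

lemma eval_det_X_smul_add (A B : Matrix ι ι ℂ) (x : ℂ) :
    ((X : ℂ[X]) • A.map C + B.map C).det.eval x = (x • A + B).det := by
  rw [← coe_evalRingHom, RingHom.map_det]
  congr 1
  ext i j
  simp
  ring

variable {E : Type*} [NormedAddCommGroup E] [NormedSpace ℂ E]

/-- Along a perturbation of finite rank, the matrix elements of the resolvent which belong to the
range of the perturbation are rational functions of the coupling, with degrees bounded by the rank:
this is Cramer's rule for the compressed resolvent equation. -/
theorem exists_rational_of_finite_rank {A B : E →L[ℂ] E} (f : ι → E →L[ℂ] ℂ) (e : ι → E)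
    (hB : ∀ φ, B φ = ∑ i, f i φ • e i) (hA : ∀ x : ℝ, IsUnit (A - (x : ℂ) • B)) (g : E) (i : ι) :
    ∃ p q : ℂ[X], p.natDegree ≤ Fintype.card ι ∧ q.natDegree ≤ Fintype.card ι ∧ q ≠ 0 ∧
      ∀ x : ℝ, f i (Ring.inverse (A - (x : ℂ) • B) g) * q.eval (x : ℂ) = p.eval (x : ℂ) := by
  have hA0 : IsUnit A := by simpa using hA 0
  set T : Matrix ι ι ℂ := Matrix.of fun i k => f i (Ring.inverse A (e k)) with hT
  set c : ι → ℂ := fun i => f i (Ring.inverse A g) with hc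
  refine ⟨((X : ℂ[X]) • ((-T).updateCol i 0).map C + ((1 : Matrix ι ι ℂ).updateCol i c).map C).det,
    ((X : ℂ[X]) • (-T).map C + (1 : Matrix ι ι ℂ).map C).det,
    natDegree_det_X_add_C_le _ _, natDegree_det_X_add_C_le _ _, ?_, fun x => ?_⟩
  · intro h
    have := eval_det_X_smul_add (-T) 1 0
    rw [h] at this
    simp at this
  · rw [eval_det_X_smul_add, eval_det_X_smul_add]
    set φ := Ring.inverse (A - (x : ℂ) • B) g with hφ
    set y : ι → ℂ := fun i => f i φ with hy
    have h1 : A φ - (x : ℂ) • B φ = g := by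
      change (A - (x : ℂ) • B) φ = g
      rw [hφ, ← mul_apply_eq_comp, Ring.mul_inverse_cancel _ (hA x)]
      rfl
    have h2 : φ = Ring.inverse A g + (x : ℂ) • ∑ k, y k • Ring.inverse A (e k) := by
      have h3 : Ring.inverse A (A φ) = φ := by
        rw [← mul_apply_eq_comp, Ring.inverse_mul_cancel _ hA0]
        rfl
      rw [sub_eq_iff_eq_add] at h1
      rw [← h3, h1, map_add, map_smul, hB, map_sum]
      simp only [map_smul]
      rfl
    -- the components of the solution satisfy the linear system `(1 - x T) y = c`
    have h4 : ((x : ℂ) • -T + 1).mulVec y = c := by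
      ext k
      have h5 := congrArg (f k) h2
      rw [map_add, map_smul, map_sum] at h5
      simp only [map_smul, smul_eq_mul] at h5
      rw [Matrix.add_mulVec, Matrix.one_mulVec, Matrix.smul_mulVec, Matrix.neg_mulVec]
      simp only [Pi.add_apply, Pi.smul_apply, Pi.neg_apply, smul_eq_mul, Matrix.mulVec, dotProduct,
        hT, Matrix.of_apply, hc]
      change _ + f k φ = _
      rw [h5, mul_neg, add_comm, add_assoc, ← sub_eq_add_neg, ← mul_sub, ← Finset.sum_sub_distrib]
      simp [mul_comm]
    have h6 := Matrix.cramer_eq_adjugate_mulVec ((x : ℂ) • -T + 1) c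
    conv_rhs at h6 => rw [← h4]
    rw [Matrix.mulVec_mulVec, Matrix.adjugate_mul, Matrix.smul_mulVec, Matrix.one_mulVec] at h6
    have h7 := congrFun h6 i
    rw [Matrix.cramer_apply, Pi.smul_apply, smul_eq_mul] at h7
    change y i * _ = _
    rw [mul_comm, ← h7]
    congr 1
    ext k l
    by_cases hl : l = i
    · subst hl
      simp
    · simp [Matrix.updateCol_ne hl]

end

/-! ### Measurability of Green functions -/

section

variable {d r : ℕ}

/-- The component of a state at the site `n` and the fiber index `a`. -/
noncomputable def coord (n : Site d) (a : FiberIdx r) : Hil d r →L[ℂ] ℂ :=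
  (EuclideanSpace.proj a : Fiber r →L[ℂ] ℂ) ∘L lp.evalCLM ℂ (fun _ : Site d => Fiber r) 2 n

@[simp]
lemma coord_apply (n : Site d) (a : FiberIdx r) (ψ : Hil d r) : coord n a ψ = ψ n a := rfl

/-- The basis state at the site `m` and the fiber index `b`. -/
noncomputable def basisState (m : Site d) (b : FiberIdx r) : Hil d r :=
  lp.single 2 m (EuclideanSpace.single b 1)

lemma norm_basisState (m : Site d) (b : FiberIdx r) : ‖basisState m b‖ = 1 := by
  rw [basisState, lp.norm_single (by norm_num), PiLp.norm_single, norm_one]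

namespace Model

variable (M : Model d r)

/-- The hopping operator of a bond has finite rank. -/
lemma hop_eq_sum (p : Site d × Site d) (φ : Hil d r) :
    M.hop p φ = ∑ b, coord p.2 b φ • M.hop p (basisState p.2 b) := by
  have h : M.hop p φ = M.hop p (lp.single 2 p.2 (φ p.2)) := by
    rw [hop_apply, hop_apply, lp.single_apply_self]
  rw [h, single_eq_sum, map_sum]
  simp only [map_smul]
  rfl

lemma finV_congr {F : Finset (Site d × Site d)} {u u' : Site d → Site d → ℝ}
    (h : ∀ p ∈ F, u p.1 p.2 = u' p.1 p.2) : M.finV F u = M.finV F u' :=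
  Finset.sum_congr rfl fun p hp => by rw [h p hp]

lemma finG_congr {F : Finset (Site d × Site d)} (lam : ℝ) (z : ℂ) {u u' : Site d → Site d → ℝ}
    (h : ∀ p ∈ F, u p.1 p.2 = u' p.1 p.2) : M.finG F lam z u = M.finG F lam z u' := by
  rw [finG, finG, finH, finH, M.finV_congr h]

/-- The couplings of the bonds in the box are symmetric under reversal of the bonds. -/
def IsSymm (L : ℕ) (u : Site d → Site d → ℝ) : Prop :=
  ∀ p ∈ bonds d M.R L, u p.1 p.2 = u (flip p).1 (flip p).2

variable {M}

lemma IsSymm.isUnit {L : ℕ} {u : Site d → Site d → ℝ} (hu : M.IsSymm L u) (lam : ℝ) {z : ℂ}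
    (hz : z.im ≠ 0) : IsUnit (algebraMap ℂ _ z - M.finH (bonds d M.R L) lam u) :=
  (isUnit_and_norm_inverse_le_im (M.isSelfAdjoint_finH lam hu) hz).1

lemma IsSymm.norm_finG_le {L : ℕ} {u : Site d → Site d → ℝ} (hu : M.IsSymm L u) (lam : ℝ) {z : ℂ}
    (hz : z.im ≠ 0) : ‖M.finG (bonds d M.R L) lam z u‖ ≤ |z.im|⁻¹ :=
  (isUnit_and_norm_inverse_le_im (M.isSelfAdjoint_finH lam hu) hz).2

lemma IsSymm.norm_finG_apply_le {L : ℕ} {u : Site d → Site d → ℝ} (hu : M.IsSymm L u) (lam : ℝ)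
    {z : ℂ} (hz : z.im ≠ 0) (m : Site d) (b : FiberIdx r) (n : Site d) (a : FiberIdx r) :
    ‖M.finG (bonds d M.R L) lam z u (basisState m b) n a‖ ≤ |z.im|⁻¹ := by
  refine (PiLp.norm_apply_le _ a).trans ((norm_apply_le _ n).trans ?_)
  refine (ContinuousLinearMap.le_opNorm _ _).trans ?_
  rw [norm_basisState, mul_one]
  exact hu.norm_finG_le lam hz

variable (M)

/-- Symmetrized couplings have a self-adjoint Hamiltonian, so that the resolvent is defined and
continuous on the whole space of couplings. -/
lemma continuous_finG_symmetrize (L : ℕ) (lam : ℝ) {z : ℂ} (hz : z.im ≠ 0) :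
    Continuous fun y : Site d × Site d → ℝ => M.finG (bonds d M.R L) lam z
      fun j l => (y (j, l) + y (flip (j, l))) / 2 := by
  rw [continuous_iff_continuousAt]
  intro y
  have hs : M.IsSymm L fun j l => (y (j, l) + y (flip (j, l))) / 2 := by
    intro p _
    change (y p + y (flip p)) / 2 = (y (flip p) + y (flip (flip p))) / 2
    rw [flip_flip, add_comm]
  obtain ⟨U, hU⟩ := hs.isUnit lam hz
  have h1 := NormedRing.inverse_continuousAt U
  rw [hU] at h1
  refine ContinuousAt.comp (g := Ring.inverse) (f := fun y : Site d × Site d → ℝ =>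
    algebraMap ℂ (Hil d r →L[ℂ] Hil d r) z - M.finH (bonds d M.R L) lam
      fun j l => (y (j, l) + y (flip (j, l))) / 2) h1 ?_
  unfold finH finV
  fun_prop

/-- Green functions depend measurably on the couplings. -/
lemma measurable_finG_apply {Ω : Type*} [MeasurableSpace Ω] {L : ℕ} (lam : ℝ) {z : ℂ}
    (hz : z.im ≠ 0) {w : Ω → Site d → Site d → ℝ}
    (hw : ∀ p ∈ bonds d M.R L, Measurable fun ω => w ω p.1 p.2) (hs : ∀ ω, M.IsSymm L (w ω))
    (ψ : Hil d r) (n : Site d) (a : FiberIdx r) :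
    Measurable fun ω => M.finG (bonds d M.R L) lam z (w ω) ψ n a := by
  classical
  obtain ⟨k, hk⟩ : ∃ k : Ω → Site d × Site d → ℝ,
      k = fun ω p => if p ∈ bonds d M.R L then w ω p.1 p.2 else 0 := ⟨_, rfl⟩
  have h1 : ∀ ω, M.finG (bonds d M.R L) lam z (w ω) = M.finG (bonds d M.R L) lam z fun j l =>
      (k ω (j, l) + k ω (flip (j, l))) / 2 := by
    intro ω
    refine M.finG_congr lam z fun p hp => ?_
    rw [hk]
    simp only [Prod.mk.eta, if_pos hp, if_pos (flip_mem_bonds hp), ← hs ω p hp]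
    ring
  have h2 : Measurable fun y : Site d × Site d → ℝ => coord n a (M.finG (bonds d M.R L) lam z
      (fun j l => (y (j, l) + y (flip (j, l))) / 2) ψ) :=
    ((coord n a).continuous.comp ((M.continuous_finG_symmetrize L lam hz).clm_apply
      continuous_const)).measurable
  have h3 : Measurable k := by
    rw [hk]
    refine measurable_pi_lambda _ fun p => ?_
    split_ifs with hp
    · exact hw p hp
    · exact measurable_const
  simp_rw [h1]
  exact h2.comp h3

end Model

/-- An estimate between integrals over one of two independent random variables may be integrated
over the other one. -/
lemma lintegral_le_of_indepFun {Ω β : Type*} [MeasurableSpace Ω] [MeasurableSpace β]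
    {P : Measure Ω} [IsFiniteMeasure P] {X : Ω → ℝ} {Y : Ω → β} (hX : Measurable X)
    (hY : Measurable Y) (hXY : IndepFun X Y P) {f g : ℝ × β → ℝ≥0∞} (hf : Measurable f)
    (hg : Measurable g) {c : ℝ≥0∞} (hc : c ≠ ∞)
    (h : ∀ y, ∫⁻ x, f (x, y) ∂(P.map X) ≤ c * ∫⁻ x, g (x, y) ∂(P.map X)) :
    ∫⁻ ω, f (X ω, Y ω) ∂P ≤ c * ∫⁻ ω, g (X ω, Y ω) ∂P := by
  have hm := (indepFun_iff_map_prod_eq_prod_map_map hX.aemeasurable hY.aemeasurable).1 hXY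
  have key : ∀ k : ℝ × β → ℝ≥0∞, Measurable k →
      ∫⁻ ω, k (X ω, Y ω) ∂P = ∫⁻ y, ∫⁻ x, k (x, y) ∂(P.map X) ∂(P.map Y) := by
    intro k hk
    rw [← lintegral_prod_symm _ hk.aemeasurable, ← hm, lintegral_map hk (hX.prodMk hY)]
  rw [key f hf, key g hg, ← lintegral_const_mul' _ _ hc]
  exact lintegral_mono h

end

/-! ### Decoupling in the random operator -/

section

variable {d r : ℕ}

namespace Model

variable (M : Model d r)

/-- The couplings `u`, with the value at the bond `p`, in both directions, replaced by `x`. -/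
def updateBond (p : Site d × Site d) (u : Site d → Site d → ℝ) (x : ℝ) : Site d → Site d → ℝ :=
  fun j l => if (j, l) = p ∨ (j, l) = flip p then x else u j l

lemma flip_eq_iff {p q : Site d × Site d} : flip q = p ↔ q = flip p :=
  ⟨fun h => by rw [← h, flip_flip], fun h => by rw [h, flip_flip]⟩

lemma IsSymm.updateBond {L : ℕ} {u : Site d → Site d → ℝ} (hu : M.IsSymm L u)
    (p : Site d × Site d) (x : ℝ) : M.IsSymm L (updateBond p u x) := by
  intro q hq
  have h : (flip q = p ∨ flip q = flip p) ↔ (q = p ∨ q = flip p) := by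
    rw [flip_eq_iff, flip_eq_iff, flip_flip, or_comm]
  simp only [Model.updateBond, Prod.mk.eta, h, hu q hq]

/-- As a function of the coupling of a single bond, a Green function ending at this bond is
rational; its degree is at most twice the dimension of the fiber. -/
lemma exists_rational_finG {L : ℕ} {u : Site d → Site d → ℝ} (hu : M.IsSymm L u) (lam : ℝ) {z : ℂ}
    (hz : z.im ≠ 0) {p : Site d × Site d} (hp : p ∈ bonds d M.R L) (ψ : Hil d r) (c : FiberIdx r) :
    ∃ P Q : Polynomial ℂ, P.natDegree ≤ 4 * r ∧ Q.natDegree ≤ 4 * r ∧ Q ≠ 0 ∧ ∀ x : ℝ,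
      M.finG (bonds d M.R L) lam z (updateBond p u x) ψ p.2 c * Q.eval (x : ℂ) =
        P.eval (x : ℂ) := by
  classical
  set F := bonds d M.R L with hF
  set B : Hil d r →L[ℂ] Hil d r := (lam : ℂ) • ∑ q ∈ {p, flip p}, M.hop q with hB
  set A : Hil d r →L[ℂ] Hil d r := algebraMap ℂ _ z - M.finH F lam (updateBond p u 0) with hA
  have hsub : ({p, flip p} : Finset (Site d × Site d)) = F.filter fun q => q = p ∨ q = flip p := by
    ext q
    simp only [Finset.mem_insert, Finset.mem_singleton, Finset.mem_filter]
    refine ⟨fun h => ⟨?_, h⟩, fun h => h.2⟩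
    rcases h with rfl | rfl
    · exact hp
    · exact flip_mem_bonds hp
  have hV : ∀ x : ℝ, M.finV F (updateBond p u x) =
      M.finV F (updateBond p u 0) + (x : ℂ) • ∑ q ∈ {p, flip p}, M.hop q := by
    intro x
    rw [hsub, Finset.sum_filter, Finset.smul_sum, finV, finV, ← Finset.sum_add_distrib]
    refine Finset.sum_congr rfl fun q _ => ?_
    simp only [Model.updateBond, Prod.mk.eta]
    split_ifs <;> simp
  have hAx : ∀ x : ℝ, A - (x : ℂ) • B =
      algebraMap ℂ _ z - M.finH F lam (updateBond p u x) := by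
    intro x
    rw [hA, hB, finH, finH, hV x, smul_add, smul_comm (x : ℂ)]
    abel
  set f : FiberIdx r ⊕ FiberIdx r → Hil d r →L[ℂ] ℂ :=
    Sum.elim (fun b => coord p.2 b) (fun b => coord (flip p).2 b) with hf
  -- an on-site term is its own reverse and must not be counted twice
  set e : FiberIdx r ⊕ FiberIdx r → Hil d r :=
    Sum.elim (fun b => (lam : ℂ) • M.hop p (basisState p.2 b))
      (fun b => if p = flip p then 0 else
        (lam : ℂ) • M.hop (flip p) (basisState (flip p).2 b)) with he
  have hBe : ∀ φ, B φ = ∑ i, f i φ • e i := by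
    intro φ
    rw [Fintype.sum_sum_type]
    simp only [hf, he, Sum.elim_inl, Sum.elim_inr]
    rw [hB, _root_.smul_apply, _root_.sum_apply]
    by_cases h : p = flip p
    · simp only [← h, if_true, smul_zero, Finset.sum_const_zero, add_zero, Finset.insert_eq_of_mem,
        Finset.mem_singleton, Finset.sum_singleton]
      rw [M.hop_eq_sum, Finset.smul_sum]
      exact Finset.sum_congr rfl fun b _ => smul_comm _ _ _
    · simp only [h, if_false]
      rw [Finset.sum_pair h, M.hop_eq_sum p φ, M.hop_eq_sum (flip p) φ, smul_add, Finset.smul_sum,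
        Finset.smul_sum]
      congr 1 <;> exact Finset.sum_congr rfl fun b _ => smul_comm _ _ _
  obtain ⟨P, Q, hP, hQ, hQ0, h⟩ := exists_rational_of_finite_rank f e hBe
    (fun x => by
      rw [hAx]
      exact (hu.updateBond M p x).isUnit lam hz) ψ (Sum.inl c)
  have hcard : Fintype.card (FiberIdx r ⊕ FiberIdx r) = 4 * r := by
    simp only [Fintype.card_sum, Fintype.card_fin]
    ring
  rw [hcard] at hP hQ
  refine ⟨P, Q, hP, hQ, hQ0, fun x => ?_⟩
  have := h x
  rw [hAx] at this
  exact this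

end Model

lemma IsHopping.isSymm {M : Model d r} {Ω : Type*} [MeasurableSpace Ω] {P : Measure Ω} {α : ℝ}
    {ν : Site d → Measure ℝ} {v : Site d → Site d → Ω → ℝ} (hv : IsHopping P M.R α ν v) (L : ℕ)
    (ω : Ω) : M.IsSymm L fun j l => v j l ω := by
  intro p hp
  exact congrFun (hv.symm p.1 (mem_bonds.1 hp).1 p.2) ω

/-- The coupling of one bond is independent of a family of symmetric couplings which agree with the
given ones on all other bonds. The map `ρ` sends a bond and its reverse to the same index. -/
lemma IsHopping.exists_indep {R : ℕ} {Ω : Type*} [MeasurableSpace Ω] {P : Measure Ω} {α : ℝ}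
    {ν : Site d → Measure ℝ} {v : Site d → Site d → Ω → ℝ} (hv : IsHopping P R α ν v) (L : ℕ)
    {p : Site d × Site d} (hp : p ∈ bonds d R L) :
    ∃ (Y : Ω → Site d × Site d → ℝ) (ρ : Site d × Site d → Site d × Site d),
      Measurable Y ∧ IndepFun (v p.1 p.2) Y P ∧ (∀ q, ρ (flip q) = ρ q) ∧
      ∀ ω, ∀ q ∈ bonds d R L,
        v q.1 q.2 ω = if q = p ∨ q = flip p then v p.1 p.2 ω else Y ω (ρ q) := by
  classical
  -- `S` contains one bond of each pair `q, flip q`, the smaller one in an enumeration of all bonds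
  -- except that `p` is chosen from its own pair
  obtain ⟨enc, henc⟩ := exists_injective_nat (Site d × Site d)
  set S : Finset (Site d × Site d) := insert p ((bonds d R L).filter fun q =>
    q ≠ p ∧ q ≠ flip p ∧ enc q ≤ enc (flip q)) with hS
  have hSb : ∀ q ∈ S, q ∈ bonds d R L := by
    intro q hq
    rcases Finset.mem_insert.1 hq with rfl | hq
    · exact hp
    · exact (Finset.mem_filter.1 hq).1
  have hfix : ∀ q : Site d × Site d, flip q = q → q.1 = 0 := by
    intro q hq
    have h1 : -q.1 = q.1 := congrArg Prod.fst hq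
    funext i
    have h2 := congrFun h1 i
    simp only [Pi.neg_apply, Pi.zero_apply] at h2 ⊢
    omega
  have hind := hv.indep (S : Set (Site d × Site d)) (fun q hq => (mem_bonds.1 (hSb q hq)).1) (by
    intro q hq hq'
    change flip q ∈ S at hq'
    refine hfix q ?_
    rcases Finset.mem_insert.1 hq with rfl | hq
    · rcases Finset.mem_insert.1 hq' with h | h
      · exact h
      · exact absurd rfl (Finset.mem_filter.1 h).2.2.1
    · rcases Finset.mem_insert.1 hq' with h | h
      · exact absurd (Model.flip_eq_iff.1 h) (Finset.mem_filter.1 hq).2.2.1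
      · refine henc (le_antisymm ?_ (Finset.mem_filter.1 hq).2.2.2)
        have := (Finset.mem_filter.1 h).2.2.2
        rwa [flip_flip] at this)
  set i₀ : (S : Set (Site d × Site d)) := ⟨p, Finset.mem_insert_self _ _⟩ with hi₀
  have hmeas : ∀ q : (S : Set (Site d × Site d)), Measurable (v q.1.1 q.1.2) := fun q =>
    hv.measurable _ (mem_bonds.1 (hSb _ q.2)).1 _
  have hind2 := hind.indepFun_finset {i₀} (Finset.univ.erase i₀) (by simp) hmeas
  set Φ : (↥(Finset.univ.erase i₀) → ℝ) →
      Site d × Site d → ℝ := fun t q => if h : q ∈ S ∧ q ≠ p then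
        t ⟨⟨q, h.1⟩, Finset.mem_erase.2 ⟨fun hq => h.2 (congrArg Subtype.val hq),
          Finset.mem_univ _⟩⟩ else 0 with hΦ
  have hΦm : Measurable Φ := by
    refine measurable_pi_lambda _ fun q => ?_
    simp only [hΦ]
    split_ifs
    · exact measurable_pi_apply _
    · exact measurable_const
  refine ⟨fun ω => Φ fun i => v i.1.1.1 i.1.1.2 ω,
    fun q => if enc q ≤ enc (flip q) then q else flip q, ?_, ?_, ?_, ?_⟩
  · exact hΦm.comp (measurable_pi_lambda _ fun i => hmeas _)
  · have h0 : Measurable fun t : ↥({i₀} : Finset (S : Set (Site d × Site d))) → ℝ =>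
        t ⟨i₀, Finset.mem_singleton_self _⟩ := measurable_pi_apply _
    exact hind2.comp h0 hΦm
  · intro q
    simp only [flip_flip]
    split_ifs with h1 h2 h2
    · exact henc (le_antisymm h1 h2)
    · rfl
    · rfl
    · omega
  · intro ω q hq
    have hsym : v (flip q).1 (flip q).2 = v q.1 q.2 := (hv.symm q.1 (mem_bonds.1 hq).1 q.2).symm
    split_ifs with h
    · rcases h with rfl | h
      · rfl
      · rw [← hsym, Model.flip_eq_iff.2 h]
    · rw [not_or] at h
      simp only [hΦ]
      split_ifs with h1 h2 h2
      · rfl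
      · exact absurd ⟨Finset.mem_insert_of_mem (Finset.mem_filter.2 ⟨hq, h.1, h.2, h1⟩), h.1⟩ h2
      · exact congrFun hsym.symm ω
      · refine absurd ⟨Finset.mem_insert_of_mem (Finset.mem_filter.2 ⟨flip_mem_bonds hq,
          ?_, ?_, ?_⟩), ?_⟩ h2
        · exact fun hh => h.2 (Model.flip_eq_iff.1 hh)
        · exact fun hh => h.1 (by rw [← flip_flip q, hh, flip_flip])
        · rw [flip_flip]
          omega
        · exact fun hh => h.2 (Model.flip_eq_iff.1 hh)

/-- Decoupling for Green functions: on the event that the coupling of a bond exceeds `A`, this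
coupling may be replaced by a small constant in fractional moments of the Green functions ending at
the bond. -/
theorem IsHopping.exists_decoupling {M : Model d r} {Ω : Type*} [MeasurableSpace Ω] {P : Measure Ω}
    [IsProbabilityMeasure P] {α : ℝ} (hα : 0 < α) {ν : Site d → Measure ℝ}
    {v : Site d → Site d → Ω → ℝ} (hv : IsHopping P M.R α ν v) {s : ℝ} (hs0 : 0 < s) (hs1 : s ≤ 1)
    (hsα : ((4 * r : ℕ) : ℝ) * (2 * s) < α) (k : ℕ) :
    ∃ C : ℝ, 0 < C ∧ ∀ (L : ℕ) (lam : ℝ) (z : ℂ), z.im ≠ 0 → ∀ p ∈ bonds d M.R L,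
      ∀ (ψ : Hil d r) (c : FiberIdx r) (A : ℝ), 0 < A →
      ∫⁻ ω, ENNReal.ofReal ((if A < |v p.1 p.2 ω| then |v p.1 p.2 ω| ^ s else 0) *
        ‖M.finG (bonds d M.R L) lam z (fun j l => v j l ω) ψ p.2 c‖ ^ s) ∂P ≤
      ENNReal.ofReal (C * (A ^ k)⁻¹) * ∫⁻ ω, ENNReal.ofReal
        (‖M.finG (bonds d M.R L) lam z (fun j l => v j l ω) ψ p.2 c‖ ^ s) ∂P := by
  classical
  have hν : ∀ j ∈ box d M.R, IsProbabilityMeasure (ν j) := fun j hj => by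
    rw [← hv.law j hj 0]
    exact Measure.isProbabilityMeasure_map (hv.measurable j hj 0).aemeasurable
  have hC : ∀ j : Site d, ∃ C : ℝ, 0 < C ∧ (j ∈ box d M.R → ∀ f : ℝ → ℂ,
      (∃ p q : Polynomial ℂ, p.natDegree ≤ 4 * r ∧ q.natDegree ≤ 4 * r ∧ q ≠ 0 ∧
        ∀ x : ℝ, f x * q.eval (x : ℂ) = p.eval (x : ℂ)) → ∀ A : ℝ, 0 < A →
      ∫⁻ x, ENNReal.ofReal ((if A < |x| then |x| ^ s else 0) * ‖f x‖ ^ s) ∂(ν j) ≤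
        ENNReal.ofReal (C * (A ^ k)⁻¹) * ∫⁻ x, ENNReal.ofReal (‖f x‖ ^ s) ∂(ν j)) := by
    intro j
    by_cases hj : j ∈ box d M.R
    · have := hν j hj
      obtain ⟨C, hC0, hC⟩ := exists_decoupling_const hα (hv.holder j hj) (hv.tails j hj) hs0 hs1
        hsα k
      exact ⟨C, hC0, fun _ => hC⟩
    · exact ⟨1, one_pos, fun h => absurd h hj⟩
  choose C hC0 hC using hC
  refine ⟨∑ j ∈ box d M.R, C j, Finset.sum_pos (fun j _ => hC0 j) ⟨0, zero_mem_box _⟩, ?_⟩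
  intro L lam z hz p hp ψ c A hA
  obtain ⟨Y, ρ, hYm, hind, hρ, hY⟩ := hv.exists_indep L hp
  have hpR := (mem_bonds.1 hp).1
  set U : ℝ × (Site d × Site d → ℝ) → Site d → Site d → ℝ := fun w =>
    Model.updateBond p (fun j l => w.2 (ρ (j, l))) w.1 with hU
  have hsymm0 : ∀ y : Site d × Site d → ℝ, M.IsSymm L fun j l => y (ρ (j, l)) := by
    intro y q _
    exact congrArg y (hρ q).symm
  have hsymm : ∀ w, M.IsSymm L (U w) := fun w => (hsymm0 w.2).updateBond M p w.1
  have hUm : ∀ q : Site d × Site d, Measurable fun w => U w q.1 q.2 := by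
    intro q
    simp only [hU, Model.updateBond]
    split_ifs
    · exact measurable_fst
    · exact (measurable_pi_apply _).comp measurable_snd
  have hGm := M.measurable_finG_apply lam hz (fun q _ => hUm q) hsymm ψ p.2 c
  have hGeq : ∀ ω, M.finG (bonds d M.R L) lam z (fun j l => v j l ω) =
      M.finG (bonds d M.R L) lam z (U (v p.1 p.2 ω, Y ω)) := by
    intro ω
    refine M.finG_congr lam z fun q hq => ?_
    exact hY ω q hq
  simp_rw [hGeq]
  refine lintegral_le_of_indepFun (hv.measurable _ hpR _) hYm hind
    (f := fun w => ENNReal.ofReal ((if A < |w.1| then |w.1| ^ s else 0) *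
      ‖M.finG (bonds d M.R L) lam z (U w) ψ p.2 c‖ ^ s))
    (g := fun w => ENNReal.ofReal (‖M.finG (bonds d M.R L) lam z (U w) ψ p.2 c‖ ^ s))
    ?_ ?_ ENNReal.ofReal_ne_top ?_
  · refine ((Measurable.ite (measurableSet_lt measurable_const measurable_fst.abs)
      (by fun_prop) measurable_const).mul (hGm.norm.pow_const s)).ennreal_ofReal
  · exact (hGm.norm.pow_const s).ennreal_ofReal
  · intro y
    rw [hv.law _ hpR]
    refine (hC p.1 hpR (fun x => M.finG (bonds d M.R L) lam z (U (x, y)) ψ p.2 c)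
      (M.exists_rational_finG (hsymm0 y) lam hz hp ψ c) A hA).trans ?_
    gcongr
    exact Finset.single_le_sum (f := C) (fun j _ => (hC0 j).le) hpR

end

/-! ### Lattice sums and the resolvent expansion in the large hoppings -/

section

variable {d r : ℕ}

lemma exists_sum_int_le :
    ∃ C : ℝ, 0 < C ∧ ∀ s : Finset ℤ, ∑ k ∈ s, ((1 + |(k : ℝ)|) ^ 2)⁻¹ ≤ C := by
  have h : Summable fun k : ℤ => ((1 + |(k : ℝ)|) ^ 2)⁻¹ := by
    refine Summable.of_norm_bounded_eventually (g := fun k : ℤ => 1 / (k : ℝ) ^ 2)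
      (Real.summable_one_div_int_pow.2 (by norm_num)) ?_
    filter_upwards [(Set.finite_singleton (0 : ℤ)).compl_mem_cofinite] with k hk
    have hk0 : (k : ℝ) ≠ 0 := by exact_mod_cast hk
    have := abs_pos.2 hk0
    rw [Real.norm_of_nonneg (by positivity), one_div, ← sq_abs (k : ℝ)]
    gcongr
    linarith
  refine ⟨∑' k : ℤ, ((1 + |(k : ℝ)|) ^ 2)⁻¹ + 1, ?_, fun s => ?_⟩
  · have : 0 ≤ ∑' k : ℤ, ((1 + |(k : ℝ)|) ^ 2)⁻¹ := tsum_nonneg fun k => by positivity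
    linarith
  · have := h.sum_le_tsum s fun k _ => by positivity
    linarith

lemma exists_sum_site_le (d : ℕ) : ∃ C : ℝ, 0 < C ∧ ∀ s : Finset (Site d),
    ∑ l ∈ s, ((1 + ‖l‖) ^ (2 * d))⁻¹ ≤ C := by
  classical
  obtain ⟨C, hC0, hC⟩ := exists_sum_int_le
  refine ⟨C ^ d, by positivity, fun s => ?_⟩
  have h1 : ∀ l : Site d, ((1 + ‖l‖) ^ (2 * d))⁻¹ ≤ ∏ i, ((1 + |(l i : ℝ)|) ^ 2)⁻¹ := by
    intro l
    rw [Finset.prod_inv_distrib]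
    refine inv_anti₀ (Finset.prod_pos fun i _ => by positivity) ?_
    calc ∏ i, (1 + |(l i : ℝ)|) ^ 2 ≤ ∏ _i : Fin d, (1 + ‖l‖) ^ 2 := by
          refine Finset.prod_le_prod (fun i _ => by positivity) fun i _ => ?_
          have := norm_le_pi_norm l i
          rw [Int.norm_eq_abs] at this
          gcongr
      _ = _ := by rw [Finset.prod_const, Finset.card_univ, Fintype.card_fin, ← pow_mul]
  let t : Fin d → Finset ℤ := fun i => s.image fun l => l i
  calc ∑ l ∈ s, ((1 + ‖l‖) ^ (2 * d))⁻¹ ≤ ∑ l ∈ s, ∏ i, ((1 + |(l i : ℝ)|) ^ 2)⁻¹ :=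
        Finset.sum_le_sum fun l _ => h1 l
    _ ≤ ∑ l ∈ Fintype.piFinset t, ∏ i, ((1 + |(l i : ℝ)|) ^ 2)⁻¹ := by
        refine Finset.sum_le_sum_of_subset_of_nonneg (fun l hl => ?_) fun l _ _ =>
          Finset.prod_nonneg fun i _ => by positivity
        exact Fintype.mem_piFinset.2 fun i => Finset.mem_image_of_mem _ hl
    _ = ∏ i, ∑ k ∈ t i, ((1 + |(k : ℝ)|) ^ 2)⁻¹ :=
        (Finset.prod_univ_sum _ fun _ k => ((1 + |((k : ℤ) : ℝ)|) ^ 2)⁻¹).symm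
    _ ≤ ∏ _i : Fin d, C := Finset.prod_le_prod
        (fun i _ => Finset.sum_nonneg fun k _ => by positivity) fun i _ => hC _
    _ = C ^ d := by rw [Finset.prod_const, Finset.card_univ, Fintype.card_fin]

lemma summable_site (d : ℕ) : Summable fun l : Site d => ((1 + ‖l‖) ^ (2 * d))⁻¹ := by
  obtain ⟨C, -, hC⟩ := exists_sum_site_le d
  exact summable_of_sum_le (fun l => by positivity) hC

/-- Lattice sums of exponentials grow at most polynomially in the inverse decay rate. The optimal
power is `d`, but any power will do, as the tails of the hoppings compensate for it. -/
lemma exists_sum_exp_le (d : ℕ) (X : ℝ) : ∃ C : ℝ, 0 < C ∧ ∀ x : ℝ, 0 < x → x ≤ X →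
    ∀ (n : Site d) (s : Finset (Site d)),
      ∑ l ∈ s, Real.exp (-(x * ‖n - l‖)) ≤ C * (x ^ (2 * d))⁻¹ := by
  obtain ⟨C, hC0, hC⟩ := exists_sum_site_le d
  refine ⟨Real.exp X * (2 * d).factorial * C, by positivity, fun x hx hxX n s => ?_⟩
  have h1 : ∀ y : ℝ, 0 ≤ y → Real.exp (-(x * y)) ≤
      Real.exp X * (2 * d).factorial * (x ^ (2 * d))⁻¹ * ((1 + y) ^ (2 * d))⁻¹ := by
    intro y hy
    have h2 := Real.pow_div_factorial_le_exp (x * (1 + y)) (by positivity) (2 * d)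
    have h3 : Real.exp (-(x * y)) = Real.exp x * (Real.exp (x * (1 + y)))⁻¹ := by
      rw [← Real.exp_neg, ← Real.exp_add]
      congr 1
      ring
    rw [h3, mul_assoc, mul_assoc, ← mul_inv, ← mul_pow, ← div_eq_mul_inv (Nat.cast _)]
    gcongr
    rw [← inv_div]
    exact inv_anti₀ (by positivity) h2
  calc _ ≤ ∑ l ∈ s, Real.exp X * (2 * d).factorial * (x ^ (2 * d))⁻¹ *
          ((1 + ‖n - l‖) ^ (2 * d))⁻¹ := Finset.sum_le_sum fun l _ => h1 _ (norm_nonneg _)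
    _ = Real.exp X * (2 * d).factorial * (x ^ (2 * d))⁻¹ *
          ∑ l ∈ s.map (Equiv.subLeft n).toEmbedding, ((1 + ‖l‖) ^ (2 * d))⁻¹ := by
        rw [Finset.sum_map, Finset.mul_sum]
        rfl
    _ ≤ Real.exp X * (2 * d).factorial * (x ^ (2 * d))⁻¹ * C := by gcongr; exact hC _
    _ = _ := by ring

lemma norm_sum_rpow_le {ι : Type*} {s : ℝ} (hs0 : 0 < s) (hs1 : s ≤ 1) (t : Finset ι) (f : ι → ℂ) :
    ‖∑ i ∈ t, f i‖ ^ s ≤ ∑ i ∈ t, ‖f i‖ ^ s := by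
  classical
  induction t using Finset.induction_on with
  | empty => simp [Real.zero_rpow hs0.ne']
  | insert i t hi ih =>
    rw [Finset.sum_insert hi, Finset.sum_insert hi]
    calc _ ≤ (‖f i‖ + ‖∑ i ∈ t, f i‖) ^ s := by gcongr; exact norm_add_le _ _
      _ ≤ ‖f i‖ ^ s + ‖∑ i ∈ t, f i‖ ^ s :=
          Real.rpow_add_le_add_rpow (norm_nonneg _) (norm_nonneg _) hs0.le hs1
      _ ≤ _ := by gcongr

/-- Choice of the disorder threshold: a power `q` of the ratio `lam / D` compensates for the factor
`D⁻¹ ^ q` which comes from a sum over the lattice. -/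
lemma exists_coupling_bound {s : ℝ} (hs0 : 0 < s) (hs1 : s ≤ 1) {Dm : ℝ} (hDm : 0 < Dm) (q : ℕ)
    {Z : ℝ} (hZ : 0 ≤ Z) : ∃ C₁ : ℝ, 0 < C₁ ∧ ∀ D lam : ℝ, 0 < D → D ≤ Dm → 0 < lam →
      lam ≤ C₁ * D ^ (1 + 1 / s) → Z * ((lam / D) ^ s * (lam / D / D) ^ q) ≤ 1 / 2 := by
  set Z' : ℝ := Z * (Dm * (Dm ^ (1 / s - 1)) ^ q) with hZ'
  have hZ'0 : 0 ≤ Z' := by positivity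
  set C₁ : ℝ := min 1 ((2 * (Z' + 1))⁻¹ ^ (1 / s)) with hC₁
  have hC₁0 : 0 < C₁ := lt_min one_pos (by positivity)
  refine ⟨C₁, hC₁0, fun D lam hD hDD hlam hle => ?_⟩
  have h1 : lam / D ≤ C₁ * D ^ (1 / s) := by
    rw [div_le_iff₀ hD]
    refine hle.trans_eq ?_
    rw [Real.rpow_add hD, Real.rpow_one]
    ring
  have h2 : lam / D / D ≤ Dm ^ (1 / s - 1) := by
    calc lam / D / D ≤ C₁ * D ^ (1 / s) / D := by gcongr
      _ = C₁ * D ^ (1 / s - 1) := by rw [Real.rpow_sub_one hD.ne', mul_div_assoc]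
      _ ≤ 1 * Dm ^ (1 / s - 1) := by
          gcongr
          · exact min_le_left _ _
          · rw [sub_nonneg, le_div_iff₀ hs0, one_mul]
            exact hs1
      _ = _ := one_mul _
  have h3 : (lam / D) ^ s ≤ (2 * (Z' + 1))⁻¹ * Dm := by
    calc (lam / D) ^ s ≤ (C₁ * D ^ (1 / s)) ^ s := by gcongr
      _ = C₁ ^ s * D := by
          rw [Real.mul_rpow hC₁0.le (by positivity), one_div, Real.rpow_inv_rpow hD.le hs0.ne']
      _ ≤ ((2 * (Z' + 1))⁻¹ ^ (1 / s)) ^ s * Dm := by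
          gcongr
          exact min_le_right _ _
      _ = _ := by rw [one_div, Real.rpow_inv_rpow (by positivity) hs0.ne']
  calc Z * ((lam / D) ^ s * (lam / D / D) ^ q) ≤
        Z * ((2 * (Z' + 1))⁻¹ * Dm * (Dm ^ (1 / s - 1)) ^ q) := by gcongr
    _ = Z' * (2 * (Z' + 1))⁻¹ := by rw [hZ']; ring
    _ ≤ 1 / 2 := by
        rw [← div_eq_mul_inv, div_le_div_iff₀ (by positivity) two_pos]
        linarith

namespace Model

variable (M : Model d r)

/-- The couplings of absolute value at most `A`. -/
noncomputable def smallPart (A : ℝ) (u : Site d → Site d → ℝ) : Site d → Site d → ℝ :=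
  fun j l => if A < |u j l| then 0 else u j l

/-- The couplings of absolute value larger than `A`. -/
noncomputable def largePart (A : ℝ) (u : Site d → Site d → ℝ) : Site d → Site d → ℝ :=
  fun j l => if A < |u j l| then u j l else 0

/-- The resolvent equation for the removal of the large couplings. -/
lemma finG_eq_add {F : Finset (Site d × Site d)} {lam : ℝ} {z : ℂ} {u : Site d → Site d → ℝ} (A : ℝ)
    (hu : IsUnit (algebraMap ℂ _ z - M.finH F lam u))
    (hu' : IsUnit (algebraMap ℂ _ z - M.finH F lam (smallPart A u))) (φ : Hil d r) :
    M.finG F lam z u φ = M.finG F lam z (smallPart A u) φ + M.finG F lam z (smallPart A u)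
      ((lam : ℂ) • M.finV F (largePart A u) (M.finG F lam z u φ)) := by
  set ψ := M.finG F lam z u φ with hψ
  have h1 : M.finV F u = M.finV F (smallPart A u) + M.finV F (largePart A u) := by
    rw [finV, finV, finV, ← Finset.sum_add_distrib]
    refine Finset.sum_congr rfl fun p _ => ?_
    simp only [smallPart, largePart]
    split_ifs <;> simp
  have h2 : (algebraMap ℂ _ z - M.finH F lam u) ψ = φ := by
    rw [hψ, finG, ← mul_apply_eq_comp, Ring.mul_inverse_cancel _ hu]
    rfl
  have h3 : (algebraMap ℂ _ z - M.finH F lam (smallPart A u)) ψ =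
      φ + (lam : ℂ) • M.finV F (largePart A u) ψ := by
    rw [← h2, finH, finH, h1]
    simp only [_root_.sub_apply, _root_.add_apply, _root_.smul_apply, smul_add]
    abel
  rw [← map_add, ← h3, finG, ← mul_apply_eq_comp, Ring.inverse_mul_cancel _ hu']
  rfl

lemma norm_hop_basisState_le {p : Site d × Site d} (b : FiberIdx r) :
    ∃ x : Fiber r, M.hop p (basisState p.2 b) = lp.single 2 (p.2 + p.1) x ∧
      ‖x‖ ≤ ‖Matrix.toEuclideanCLM (𝕜 := ℂ) (M.W p.1)‖ := by
  refine ⟨_, M.hop_apply p _, ?_⟩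
  refine (ContinuousLinearMap.le_opNorm _ _).trans ?_
  rw [basisState, lp.single_apply_self, PiLp.norm_single, norm_one, mul_one]

/-- The resolvent expansion in the large couplings, in fractional powers. -/
lemma norm_finG_rpow_le {L : ℕ} {lam : ℝ} (hlam : 0 < lam) {z : ℂ} {u : Site d → Site d → ℝ} {A : ℝ}
    (hu : IsUnit (algebraMap ℂ _ z - M.finH (bonds d M.R L) lam u))
    (hu' : IsUnit (algebraMap ℂ _ z - M.finH (bonds d M.R L) lam (smallPart A u)))
    {g η : ℝ} (hg : 0 ≤ g) (hη : 0 ≤ η) (hηR : η * M.R ≤ 1)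
    (hG : ∀ (n m : Site d) (x : Fiber r),
      ‖M.finG (bonds d M.R L) lam z (smallPart A u) (lp.single 2 m x) n‖ ≤
        g * Real.exp (-(η * ‖n - m‖)) * ‖x‖)
    {w : ℝ} (hw : ∀ j ∈ box d M.R, ‖Matrix.toEuclideanCLM (𝕜 := ℂ) (M.W j)‖ ≤ w)
    {s : ℝ} (hs0 : 0 < s) (hs1 : s ≤ 1) (m : Site d) (b : FiberIdx r) (n : Site d)
    (a : FiberIdx r) :
    ‖M.finG (bonds d M.R L) lam z u (basisState m b) n a‖ ^ s ≤
      g ^ s * Real.exp (-(s * η * ‖n - m‖)) + ∑ p ∈ bonds d M.R L, ∑ c,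
        (lam * (3 * g * w)) ^ s * Real.exp (-(s * η * ‖n - p.2‖)) *
          ((if A < |u p.1 p.2| then |u p.1 p.2| ^ s else 0) *
            ‖M.finG (bonds d M.R L) lam z u (basisState m b) p.2 c‖ ^ s) := by
  set F := bonds d M.R L with hF
  set Gt := M.finG F lam z (smallPart A u) with hGt
  set ψ := M.finG F lam z u (basisState m b) with hψ
  have hexp : ∀ y : ℝ, Real.exp (-(η * y)) ^ s = Real.exp (-(s * η * y)) := by
    intro y
    rw [← Real.exp_mul]
    congr 1
    ring
  have h1 : ψ n a = coord n a (Gt (basisState m b)) +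
      ∑ p ∈ F, ∑ c, ((lam * largePart A u p.1 p.2 : ℝ) : ℂ) *
      (ψ p.2 c * coord n a (Gt (M.hop p (basisState p.2 c)))) := by
    have h2 := congrArg (coord n a) (M.finG_eq_add A hu hu' (basisState m b))
    rw [← hψ, ← hGt, map_add] at h2
    rw [← coord_apply, h2, finV, _root_.sum_apply, Finset.smul_sum, map_sum, map_sum]
    congr 1
    refine Finset.sum_congr rfl fun p _ => ?_
    rw [_root_.smul_apply, smul_smul, map_smul, map_smul, M.hop_eq_sum p ψ, map_sum, map_sum,
      Finset.smul_sum]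
    refine Finset.sum_congr rfl fun c _ => ?_
    rw [map_smul, map_smul, smul_eq_mul, smul_eq_mul, coord_apply, Complex.ofReal_mul]
  rw [h1]
  refine (Real.rpow_le_rpow (norm_nonneg _) (norm_add_le _ _) hs0.le).trans ?_
  refine (Real.rpow_add_le_add_rpow (norm_nonneg _) (norm_nonneg _) hs0.le hs1).trans ?_
  refine add_le_add ?_ ?_
  · rw [← hexp, ← Real.mul_rpow hg (Real.exp_pos _).le]
    refine Real.rpow_le_rpow (norm_nonneg _) ?_ hs0.le
    refine (PiLp.norm_apply_le _ a).trans ((hG n m _).trans_eq ?_)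
    rw [PiLp.norm_single, norm_one, mul_one]
  · refine (norm_sum_rpow_le hs0 hs1 _ _).trans (Finset.sum_le_sum fun p hp => ?_)
    refine (norm_sum_rpow_le hs0 hs1 _ _).trans (Finset.sum_le_sum fun c _ => ?_)
    have hpR := (mem_bonds.1 hp).1
    have hw0 : 0 ≤ w := (norm_nonneg _).trans (hw _ hpR)
    have h3 : ‖coord n a (Gt (M.hop p (basisState p.2 c)))‖ ≤
        3 * g * w * Real.exp (-(η * ‖n - p.2‖)) := by
      obtain ⟨x, hx, hxw⟩ := M.norm_hop_basisState_le (p := p) c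
      rw [hx]
      refine (PiLp.norm_apply_le _ a).trans ((hG n _ x).trans ?_)
      -- `e ≤ 3` accounts for the distance of the two ends of the bond
      have h4 : Real.exp (-(η * ‖n - (p.2 + p.1)‖)) ≤ 3 * Real.exp (-(η * ‖n - p.2‖)) := by
        have h5 : ‖n - p.2‖ ≤ ‖n - (p.2 + p.1)‖ + M.R := by
          have h6 : n - p.2 = (n - (p.2 + p.1)) + p.1 := by abel
          rw [h6]
          exact (norm_add_le _ _).trans (by gcongr; exact mem_box.1 hpR)
        calc _ ≤ Real.exp (1 + -(η * ‖n - p.2‖)) := by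
              refine Real.exp_le_exp.2 ?_
              nlinarith
          _ = Real.exp 1 * Real.exp (-(η * ‖n - p.2‖)) := Real.exp_add _ _
          _ ≤ _ := by
              gcongr
              linarith [Real.exp_one_lt_d9]
      calc _ ≤ g * (3 * Real.exp (-(η * ‖n - p.2‖))) * w := by
            gcongr
            exact hxw.trans (hw _ hpR)
        _ = _ := by ring
    have h7 : |largePart A u p.1 p.2| ^ s = if A < |u p.1 p.2| then |u p.1 p.2| ^ s else 0 := by
      rw [largePart]
      split_ifs
      · rfl
      · rw [abs_zero, Real.zero_rpow hs0.ne']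
    rw [norm_mul, norm_mul, Complex.norm_real, Real.norm_eq_abs, abs_mul, abs_of_pos hlam, ← h7,
      ← hexp]
    calc _ ≤ (lam * |largePart A u p.1 p.2| *
          (‖ψ p.2 c‖ * (3 * g * w * Real.exp (-(η * ‖n - p.2‖))))) ^ s := by
          gcongr
      _ = (lam * (3 * g * w) * Real.exp (-(η * ‖n - p.2‖)) *
          (|largePart A u p.1 p.2| * ‖ψ p.2 c‖)) ^ s := by
          congr 1
          ring
      _ = _ := by
          rw [Real.mul_rpow (by positivity) (by positivity),
            Real.mul_rpow (by positivity) (Real.exp_pos _).le,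
            Real.mul_rpow (abs_nonneg _) (norm_nonneg _)]

end Model

end

/-! ### Fractional moments for truncated Hamiltonians -/

section

variable {d r : ℕ}

/-- A bound by half of a finite supremum can be absorbed, provided that the supremum is known to be
finite. -/
lemma le_two_mul_of_le_add_half_sup {ι : Type*} (Λ : Finset ι) (f : ι → ℝ≥0∞) {A : ℝ≥0∞}
    (hf : ∀ i ∈ Λ, f i ≠ ∞) (h : ∀ i, f i ≤ A + ENNReal.ofReal (1 / 2) * Λ.sup f) (i : ι) :
    f i ≤ 2 * A := by
  set T := Λ.sup f with hT
  have hT' : T ≠ ∞ := by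
    refine ((Finset.sup_lt_iff ENNReal.zero_lt_top).2 fun i hi => ?_).ne
    exact lt_top_iff_ne_top.2 (hf i hi)
  have h1 : ENNReal.ofReal (1 / 2) * T + ENNReal.ofReal (1 / 2) * T = T := by
    rw [← add_mul, ← ENNReal.ofReal_add (by norm_num) (by norm_num)]
    norm_num
  have h2 : T ≤ A + ENNReal.ofReal (1 / 2) * T := Finset.sup_le fun i _ => h i
  have h3 : ENNReal.ofReal (1 / 2) * T ≤ A := by
    rw [← ENNReal.add_le_add_iff_right (ENNReal.mul_ne_top ENNReal.ofReal_ne_top hT'), h1]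
    exact h2
  rw [two_mul]
  exact (h i).trans (by gcongr)

namespace Model

variable (M : Model d r)

lemma sum_bonds_le (L : ℕ) {f : Site d → ℝ} (hf : ∀ l, 0 ≤ f l) :
    ∑ p ∈ bonds d M.R L, ∑ _c : FiberIdx r, f p.2 ≤
      2 * r * (box d M.R).card * ∑ l ∈ box d L, f l := by
  have h1 : ∑ p ∈ bonds d M.R L, f p.2 ≤ (box d M.R).card * ∑ l ∈ box d L, f l := by
    calc _ ≤ ∑ p ∈ box d M.R ×ˢ box d L, f p.2 :=
          Finset.sum_le_sum_of_subset_of_nonneg (Finset.filter_subset _ _) fun p _ _ => hf _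
      _ = _ := by rw [Finset.sum_product]; simp only [Finset.sum_const, nsmul_eq_mul]
  have h2 : (Fintype.card (FiberIdx r) : ℝ) = 2 * r := by
    rw [Fintype.card_sum, Fintype.card_fin]
    push_cast
    ring
  simp only [Finset.sum_const, Finset.card_univ, nsmul_eq_mul]
  rw [← Finset.mul_sum, h2, mul_assoc (2 * (r : ℝ))]
  gcongr

end Model

/-- The integrated resolvent expansion, after decoupling. -/
lemma IsHopping.lintegral_finG_le {M : Model d r} {Ω : Type*} [MeasurableSpace Ω] {P : Measure Ω}
    [IsProbabilityMeasure P] {α : ℝ} {ν : Site d → Measure ℝ} {v : Site d → Site d → Ω → ℝ}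
    (hv : IsHopping P M.R α ν v) {L : ℕ} {lam : ℝ} (hlam : 0 < lam) {z : ℂ} (hz : z.im ≠ 0) {A : ℝ}
    (hu' : ∀ ω, IsUnit (algebraMap ℂ _ z -
      M.finH (bonds d M.R L) lam (Model.smallPart A fun j l => v j l ω)))
    {g η : ℝ} (hg : 0 ≤ g) (hη : 0 ≤ η) (hηR : η * M.R ≤ 1)
    (hG : ∀ ω, ∀ (n m : Site d) (x : Fiber r),
      ‖M.finG (bonds d M.R L) lam z (Model.smallPart A fun j l => v j l ω) (lp.single 2 m x) n‖ ≤
        g * Real.exp (-(η * ‖n - m‖)) * ‖x‖)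
    {w : ℝ} (hw0 : 0 ≤ w) (hw : ∀ j ∈ box d M.R, ‖Matrix.toEuclideanCLM (𝕜 := ℂ) (M.W j)‖ ≤ w)
    {s : ℝ} (hs0 : 0 < s) (hs1 : s ≤ 1) (m : Site d) (b : FiberIdx r) {κ : ℝ}
    (hdec : ∀ p ∈ bonds d M.R L, ∀ c : FiberIdx r,
      ∫⁻ ω, ENNReal.ofReal ((if A < |v p.1 p.2 ω| then |v p.1 p.2 ω| ^ s else 0) *
        ‖M.finG (bonds d M.R L) lam z (fun j l => v j l ω) (basisState m b) p.2 c‖ ^ s) ∂P ≤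
      ENNReal.ofReal κ * ∫⁻ ω, ENNReal.ofReal
        (‖M.finG (bonds d M.R L) lam z (fun j l => v j l ω) (basisState m b) p.2 c‖ ^ s) ∂P)
    (n : Site d) (a : FiberIdx r) :
    ∫⁻ ω, ENNReal.ofReal
        (‖M.finG (bonds d M.R L) lam z (fun j l => v j l ω) (basisState m b) n a‖ ^ s) ∂P ≤
      ENNReal.ofReal (g ^ s * Real.exp (-(s * η * ‖n - m‖))) +
        ∑ p ∈ bonds d M.R L, ∑ c,
          ENNReal.ofReal ((lam * (3 * g * w)) ^ s * κ * Real.exp (-(s * η * ‖n - p.2‖))) *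
          ∫⁻ ω, ENNReal.ofReal
            (‖M.finG (bonds d M.R L) lam z (fun j l => v j l ω) (basisState m b) p.2 c‖ ^ s) ∂P := by
  have hmeas : ∀ (n : Site d) (a : FiberIdx r), Measurable fun ω =>
      M.finG (bonds d M.R L) lam z (fun j l => v j l ω) (basisState m b) n a := fun n a =>
    M.measurable_finG_apply lam hz (fun p hp => hv.measurable _ (mem_bonds.1 hp).1 _)
      (fun ω => hv.isSymm L ω) _ n a
  have hmeas' : ∀ p ∈ bonds d M.R L, ∀ c : FiberIdx r, Measurable fun ω =>
      ENNReal.ofReal ((if A < |v p.1 p.2 ω| then |v p.1 p.2 ω| ^ s else 0) *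
        ‖M.finG (bonds d M.R L) lam z (fun j l => v j l ω) (basisState m b) p.2 c‖ ^ s) := by
    intro p hp c
    have h1 := hv.measurable p.1 (mem_bonds.1 hp).1 p.2
    exact ((Measurable.ite (measurableSet_lt measurable_const h1.abs)
      (h1.abs.pow_const s) measurable_const).mul ((hmeas p.2 c).norm.pow_const s)).ennreal_ofReal
  calc _ ≤ ∫⁻ ω, (ENNReal.ofReal (g ^ s * Real.exp (-(s * η * ‖n - m‖))) +
        ∑ p ∈ bonds d M.R L, ∑ c,
          ENNReal.ofReal ((lam * (3 * g * w)) ^ s * Real.exp (-(s * η * ‖n - p.2‖))) *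
          ENNReal.ofReal ((if A < |v p.1 p.2 ω| then |v p.1 p.2 ω| ^ s else 0) *
            ‖M.finG (bonds d M.R L) lam z (fun j l => v j l ω) (basisState m b) p.2 c‖ ^ s)) ∂P := by
        refine lintegral_mono fun ω => ?_
        refine (ENNReal.ofReal_le_ofReal (M.norm_finG_rpow_le hlam ((hv.isSymm L ω).isUnit lam hz)
          (hu' ω) hg hη hηR (hG ω) hw hs0 hs1 m b n a)).trans ?_
        have h0 : ∀ (p : Site d × Site d) (c : FiberIdx r),
            0 ≤ (lam * (3 * g * w)) ^ s * Real.exp (-(s * η * ‖n - p.2‖)) *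
            ((if A < |v p.1 p.2 ω| then |v p.1 p.2 ω| ^ s else 0) *
            ‖M.finG (bonds d M.R L) lam z (fun j l => v j l ω) (basisState m b) p.2 c‖ ^ s) := by
          intro p c
          have : 0 ≤ (if A < |v p.1 p.2 ω| then |v p.1 p.2 ω| ^ s else 0) := by
            split_ifs <;> positivity
          positivity
        rw [ENNReal.ofReal_add (by positivity) (Finset.sum_nonneg fun p _ =>
            Finset.sum_nonneg fun c _ => h0 p c),
          ENNReal.ofReal_sum_of_nonneg fun p _ => Finset.sum_nonneg fun c _ => h0 p c]
        gcongr with p hp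
        rw [ENNReal.ofReal_sum_of_nonneg fun c _ => h0 p c]
        gcongr with c
        rw [ENNReal.ofReal_mul (by positivity)]
    _ = ENNReal.ofReal (g ^ s * Real.exp (-(s * η * ‖n - m‖))) +
        ∑ p ∈ bonds d M.R L, ∑ c,
          ENNReal.ofReal ((lam * (3 * g * w)) ^ s * Real.exp (-(s * η * ‖n - p.2‖))) *
          ∫⁻ ω, ENNReal.ofReal ((if A < |v p.1 p.2 ω| then |v p.1 p.2 ω| ^ s else 0) *
            ‖M.finG (bonds d M.R L) lam z (fun j l => v j l ω) (basisState m b) p.2 c‖ ^ s) ∂P := by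
        rw [lintegral_add_left measurable_const, lintegral_const, measure_univ, mul_one,
          lintegral_finsetSum _ fun p hp => Finset.measurable_sum _ fun c _ =>
            (hmeas' p hp c).const_mul _]
        congr 1
        refine Finset.sum_congr rfl fun p hp => ?_
        rw [lintegral_finsetSum _ fun c _ => (hmeas' p hp c).const_mul _]
        exact Finset.sum_congr rfl fun c _ => lintegral_const_mul' _ _ ENNReal.ofReal_ne_top
    _ ≤ _ := by
        refine add_le_add le_rfl (Finset.sum_le_sum fun p hp => Finset.sum_le_sum fun c _ => ?_)
        refine (mul_le_mul_right (hdec p hp c) _).trans_eq ?_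
        rw [← mul_assoc, ← ENNReal.ofReal_mul (by positivity)]
        congr 2
        ring

/-- The closing of the resolvent expansion: the expansion kernel decays at twice the rate at which
the solution is to decay, so it remains summable, with sum at most `1 / 2`, in the weighted
supremum norm. -/
lemma le_of_expansion (M : Model d r) (L : ℕ) {y g K S : ℝ} (hy : 0 ≤ y) (hg : 0 ≤ g) (hK : 0 ≤ K)
    (hS : ∀ n : Site d, ∑ l ∈ box d L, Real.exp (-(y * ‖n - l‖)) ≤ S)
    (hKS : K * (2 * r * (box d M.R).card * S) ≤ 1 / 2) (m : Site d)
    (τ : Site d × FiberIdx r → ℝ≥0∞) (hτ : ∀ i, τ i ≠ ∞)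
    (h : ∀ n a, τ (n, a) ≤ ENNReal.ofReal (g * Real.exp (-(2 * y * ‖n - m‖))) +
      ∑ p ∈ bonds d M.R L, ∑ c, ENNReal.ofReal (K * Real.exp (-(2 * y * ‖n - p.2‖))) * τ (p.2, c))
    (n : Site d) (a : FiberIdx r) :
    τ (n, a) ≤ ENNReal.ofReal (2 * g * Real.exp (-(y * ‖n - m‖))) := by
  set f : Site d × FiberIdx r → ℝ≥0∞ := fun i =>
    τ i * ENNReal.ofReal (Real.exp (y * ‖i.1 - m‖)) with hf
  set Λ : Finset (Site d × FiberIdx r) := box d L ×ˢ Finset.univ with hΛ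
  have hsum : ∀ n : Site d, ∑ p ∈ bonds d M.R L, ∑ _c' : FiberIdx r,
      ENNReal.ofReal (K * Real.exp (-(y * ‖n - p.2‖))) ≤ ENNReal.ofReal (1 / 2) := by
    intro n
    have h0 : ∀ l : Site d, 0 ≤ K * Real.exp (-(y * ‖n - l‖)) := fun l => by positivity
    rw [Finset.sum_congr rfl fun p _ => (ENNReal.ofReal_sum_of_nonneg (s := Finset.univ)
      fun (_ : FiberIdx r) _ => h0 p.2).symm,
      ← ENNReal.ofReal_sum_of_nonneg fun p _ => Finset.sum_nonneg fun _ _ => h0 p.2]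
    refine ENNReal.ofReal_le_ofReal ((M.sum_bonds_le L h0).trans (le_trans ?_ hKS))
    rw [← Finset.mul_sum]
    calc _ = K * (2 * r * (box d M.R).card *
          ∑ l ∈ box d L, Real.exp (-(y * ‖n - l‖))) := by ring
      _ ≤ _ := by
          gcongr
          exact hS n
  have hmain : ∀ i, f i ≤ ENNReal.ofReal g + ENNReal.ofReal (1 / 2) * Λ.sup f := by
    rintro ⟨n, a⟩
    calc f (n, a) ≤ (ENNReal.ofReal (g * Real.exp (-(2 * y * ‖n - m‖))) +
          ∑ p ∈ bonds d M.R L, ∑ c', ENNReal.ofReal (K * Real.exp (-(2 * y * ‖n - p.2‖))) *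
            τ (p.2, c')) * ENNReal.ofReal (Real.exp (y * ‖n - m‖)) := mul_le_mul_left (h n a) _
      _ ≤ ENNReal.ofReal g + ∑ p ∈ bonds d M.R L, ∑ _c' : FiberIdx r,
            ENNReal.ofReal (K * Real.exp (-(y * ‖n - p.2‖))) * Λ.sup f := by
          rw [add_mul, Finset.sum_mul]
          refine add_le_add ?_ (Finset.sum_le_sum fun p hp => ?_)
          · rw [← ENNReal.ofReal_mul (by positivity), mul_assoc, ← Real.exp_add]
            refine ENNReal.ofReal_le_ofReal (mul_le_of_le_one_right (by positivity) ?_)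
            rw [Real.exp_le_one_iff]
            have := mul_nonneg hy (norm_nonneg (n - m))
            linarith
          · rw [Finset.sum_mul]
            refine Finset.sum_le_sum fun c' _ => ?_
            have h2 : f (p.2, c') ≤ Λ.sup f := Finset.le_sup (f := f) (Finset.mem_product.2
              ⟨(mem_bonds.1 hp).2.1, Finset.mem_univ _⟩)
            calc _ = ENNReal.ofReal (K * Real.exp (-(2 * y * ‖n - p.2‖)) *
                    Real.exp (y * ‖n - m‖)) * τ (p.2, c') := by
                  rw [ENNReal.ofReal_mul (q := Real.exp (y * ‖n - m‖)) (by positivity)]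
                  ring
              _ ≤ ENNReal.ofReal (K * Real.exp (-(y * ‖n - p.2‖)) *
                    Real.exp (y * ‖p.2 - m‖)) * τ (p.2, c') := by
                  refine mul_le_mul_left (ENNReal.ofReal_le_ofReal ?_) _
                  rw [mul_assoc K, mul_assoc K, ← Real.exp_add, ← Real.exp_add]
                  refine mul_le_mul_of_nonneg_left (Real.exp_le_exp.2 ?_) hK
                  have h3 : ‖n - m‖ ≤ ‖n - p.2‖ + ‖p.2 - m‖ :=
                    norm_sub_le_norm_sub_add_norm_sub _ _ _
                  nlinarith
              _ = ENNReal.ofReal (K * Real.exp (-(y * ‖n - p.2‖))) * f (p.2, c') := by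
                  rw [ENNReal.ofReal_mul (by positivity), hf]
                  ring
              _ ≤ _ := by gcongr
      _ ≤ _ := by
          simp only [← Finset.sum_mul]
          gcongr
          exact hsum n
  have hfin := le_two_mul_of_le_add_half_sup Λ f
    (fun i _ => ENNReal.mul_ne_top (hτ i) ENNReal.ofReal_ne_top) hmain (n, a)
  have hexp : Real.exp (y * ‖n - m‖) * Real.exp (-(y * ‖n - m‖)) = 1 := by
    rw [← Real.exp_add, add_neg_cancel, Real.exp_zero]
  calc τ (n, a) = f (n, a) * ENNReal.ofReal (Real.exp (-(y * ‖n - m‖))) := by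
        rw [hf]
        simp only
        rw [mul_assoc, ← ENNReal.ofReal_mul (Real.exp_pos _).le, hexp, ENNReal.ofReal_one, mul_one]
    _ ≤ 2 * ENNReal.ofReal g * ENNReal.ofReal (Real.exp (-(y * ‖n - m‖))) := by gcongr
    _ = _ := by
        rw [← ENNReal.ofReal_ofNat 2, ← ENNReal.ofReal_mul (by norm_num),
          ← ENNReal.ofReal_mul (by positivity)]

/-- **Fractional moment bound** in finite volume, uniformly in the volume. The spectral parameter
need only be away from the spectrum of the unperturbed operator. The decoupling is applied with the
power `2 d` of the threshold `A`, which is proportional to `D / lam`, in order to beat the lattice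
sum of order `D ^ (-2 d)`. -/
theorem IsHopping.exists_moment_bound {M : Model d r} {Ω : Type*} [MeasurableSpace Ω]
    {P : Measure Ω} [IsProbabilityMeasure P] {α : ℝ} (hα : 0 < α) {ν : Site d → Measure ℝ}
    {v : Site d → Site d → Ω → ℝ} (hv : IsHopping P M.R α ν v) {Dm : ℝ} (hDm : 0 < Dm) :
    ∃ C₃ : ℝ, 0 < C₃ ∧ ∀ s : ℝ, 0 < s → s ≤ 1 → ((4 * r : ℕ) : ℝ) * (2 * s) < α →
      ∃ C₁ : ℝ, 0 < C₁ ∧ ∀ D lam : ℝ, 0 < D → D ≤ Dm → 0 < lam → lam ≤ C₁ * D ^ (1 + 1 / s) →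
      ∀ z : ℂ, (∀ x ∈ spectrum ℂ M.H₀, D ≤ ‖z - x‖) → z.im ≠ 0 →
      ∀ (L : ℕ) (n m : Site d) (a b : FiberIdx r), ∫⁻ ω, ENNReal.ofReal
        (‖M.finG (bonds d M.R L) lam z (fun j l => v j l ω) (basisState m b) n a‖ ^ s) ∂P ≤
      ENNReal.ofReal (2 * (2 / D) ^ s * Real.exp (-(s * C₃ * D * ‖n - m‖))) := by
  obtain ⟨c, κ, hc0, hκ0, hcR, hCT⟩ := M.exists_combesThomas hDm
  refine ⟨c / 2, by positivity, fun s hs0 hs1 hsα => ?_⟩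
  obtain ⟨Cd, hCd0, hCd⟩ := hv.exists_decoupling hα hs0 hs1 hsα (2 * d)
  obtain ⟨Cq, hCq0, hCq⟩ := exists_sum_exp_le d (c / 2 * Dm)
  set w : ℝ := ∑ j ∈ box d M.R, ‖Matrix.toEuclideanCLM (𝕜 := ℂ) (M.W j)‖ with hw
  have hw0 : 0 ≤ w := Finset.sum_nonneg fun _ _ => norm_nonneg _
  have hwj : ∀ j ∈ box d M.R, ‖Matrix.toEuclideanCLM (𝕜 := ℂ) (M.W j)‖ ≤ w := fun j hj =>
    Finset.single_le_sum (f := fun j => ‖Matrix.toEuclideanCLM (𝕜 := ℂ) (M.W j)‖)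
      (fun _ _ => norm_nonneg _) hj
  obtain ⟨Z, hZ⟩ : ∃ Z : ℝ, Z = (6 * w) ^ s * Cd * (κ ^ (2 * d))⁻¹ * ((s * c / 2) ^ (2 * d))⁻¹ *
      (2 * r * (box d M.R).card) * Cq := ⟨_, rfl⟩
  have hZ0 : 0 ≤ Z := by rw [hZ]; positivity
  obtain ⟨C₁, hC₁0, hC₁⟩ := exists_coupling_bound hs0 hs1 hDm (2 * d) hZ0
  refine ⟨C₁, hC₁0, fun D lam hD hDD hlam hle z hzD hz L n m a b => ?_⟩
  have hsmall := hC₁ D lam hD hDD hlam hle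
  -- couplings up to `A` are harmless by the Combes-Thomas estimate
  obtain ⟨A, hA⟩ : ∃ A : ℝ, A = κ * D / lam := ⟨_, rfl⟩
  have hA0 : 0 < A := by rw [hA]; positivity
  have hut : ∀ ω, ∀ p ∈ bonds d M.R L,
      lam * |Model.smallPart A (fun j l => v j l ω) p.1 p.2| ≤ κ * D := by
    intro ω p _
    simp only [Model.smallPart]
    split_ifs with h
    · rw [abs_zero, mul_zero]
      positivity
    · rw [not_lt, hA, le_div_iff₀ hlam] at h
      linarith
  obtain ⟨y, hy⟩ : ∃ y : ℝ, y = s * c * D / 2 := ⟨_, rfl⟩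
  have hy0 : 0 < y := by rw [hy]; positivity
  have hyX : y ≤ c / 2 * Dm := by
    rw [hy]
    calc s * c * D / 2 = s * (c / 2 * D) := by ring
      _ ≤ 1 * (c / 2 * Dm) := by gcongr
      _ = _ := one_mul _
  set τ : Site d × FiberIdx r → ℝ≥0∞ := fun i => ∫⁻ ω, ENNReal.ofReal
    (‖M.finG (bonds d M.R L) lam z (fun j l => v j l ω) (basisState m b) i.1 i.2‖ ^ s) ∂P with hτ
  have hτtop : ∀ i, τ i ≠ ∞ := by
    intro i
    refine ne_top_of_le_ne_top (b := ENNReal.ofReal ((|z.im|⁻¹) ^ s)) ENNReal.ofReal_ne_top ?_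
    calc τ i ≤ ∫⁻ _, ENNReal.ofReal ((|z.im|⁻¹) ^ s) ∂P := by
          refine lintegral_mono fun ω => ENNReal.ofReal_le_ofReal ?_
          exact Real.rpow_le_rpow (norm_nonneg _)
            ((hv.isSymm L ω).norm_finG_apply_le lam hz m b i.1 i.2) hs0.le
      _ = _ := by rw [lintegral_const, measure_univ, mul_one]
  obtain ⟨Kc, hKc⟩ : ∃ Kc : ℝ,
      Kc = (lam * (3 * (2 / D) * w)) ^ s * (Cd * (A ^ (2 * d))⁻¹) := ⟨_, rfl⟩
  have hKc0 : 0 ≤ Kc := by rw [hKc]; positivity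
  have hhalf : Kc * (2 * r * (box d M.R).card * (Cq * (y ^ (2 * d))⁻¹)) ≤ 1 / 2 := by
    refine le_trans (le_of_eq ?_) hsmall
    have e1 : (lam * (3 * (2 / D) * w)) ^ s = (6 * w) ^ s * (lam / D) ^ s := by
      rw [← Real.mul_rpow (by positivity) (by positivity)]
      congr 1
      ring
    have e2 : (A ^ (2 * d))⁻¹ * (y ^ (2 * d))⁻¹ =
        (κ ^ (2 * d))⁻¹ * ((s * c / 2) ^ (2 * d))⁻¹ * (lam / D / D) ^ (2 * d) := by
      rw [← mul_inv, ← mul_inv, ← mul_pow, ← mul_pow, ← inv_pow, ← inv_pow, ← mul_pow, hA, hy]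
      congr 1
      field_simp
    rw [hKc, hZ, e1]
    linear_combination (6 * w) ^ s * (lam / D) ^ s * Cd * (2 * r * (box d M.R).card) * Cq * e2
  have hyn : s * (c / 2) * D = y := by rw [hy]; ring
  rw [hyn]
  refine le_of_expansion M L hy0.le (by positivity) hKc0 (fun n => hCq y hy0 hyX n _) hhalf m τ
    hτtop (fun n a => ?_) n a
  have h1 := hv.lintegral_finG_le hlam hz (A := A) (g := 2 / D) (η := c * D) (w := w)
    (κ := Cd * (A ^ (2 * d))⁻¹)
    (fun ω => (hCT D hD hDD z hzD L lam _ hlam (hut ω)).1) (by positivity) (by positivity)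
    (le_trans (by gcongr) hcR) (fun ω => (hCT D hD hDD z hzD L lam _ hlam (hut ω)).2) hw0 hwj
    hs0 hs1 m b (fun p hp c' => hCd L lam z hz p hp _ c' A hA0) n a
  rw [← hKc, show s * (c * D) = 2 * y by rw [hy]; ring] at h1
  exact h1

end

/-! ### Solutions of the eigenvalue equation in large boxes -/

section

variable {d r : ℕ}

/-- The tent function `1 - |n| / L` over the box `|n| ≤ L`. -/
noncomputable def tent (L : ℕ) (n : Site d) : ℝ := max 0 (1 - ‖n‖ / L)

lemma tent_nonneg (L : ℕ) (n : Site d) : 0 ≤ tent L n := le_max_left _ _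

lemma abs_tent_le (L : ℕ) (n : Site d) : |tent L n| ≤ 1 := by
  rw [abs_of_nonneg (tent_nonneg L n)]
  exact max_le zero_le_one (sub_le_self _ (by positivity))

lemma tent_eq_zero {L : ℕ} (hL : 0 < L) {n : Site d} (hn : n ∉ box d L) : tent L n = 0 := by
  rw [mem_box, not_le] at hn
  refine max_eq_left ?_
  rw [sub_nonpos, one_le_div (by positivity)]
  exact hn.le

lemma half_le_tent {L : ℕ} (hL : 0 < L) {n : Site d} (hn : 2 * ‖n‖ ≤ L) : 1 / 2 ≤ tent L n := by
  refine le_trans ?_ (le_max_right _ _)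
  have h : ‖n‖ / L ≤ 1 / 2 := by
    rw [div_le_iff₀ (by positivity)]
    linarith
  linarith

lemma abs_tent_sub_le (L : ℕ) (n j : Site d) : |tent L n - tent L (n - j)| ≤ ‖j‖ / L := by
  rw [tent, tent, max_comm, max_comm (0 : ℝ)]
  refine (abs_max_sub_max_le_abs _ _ _).trans ?_
  · have h : 1 - ‖n‖ / L - (1 - ‖n - j‖ / L) = (‖n - j‖ - ‖n‖) / L := by ring
    rw [h, abs_div, Nat.abs_cast]
    gcongr
    refine (abs_norm_sub_norm_le _ _).trans ?_
    rw [sub_sub_cancel_left, norm_neg]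

namespace Model

variable (M : Model d r)

lemma finV_apply_eq_hopMap {L N : ℕ} (hN : L + M.R ≤ N) (u : Site d → Site d → ℝ) (ψ : Hil d r)
    {n : Site d} (hn : n ∈ box d L) : M.finV (bonds d M.R N) u ψ n = hopMap M u ψ n := by
  rw [finV_apply]
  refine Finset.sum_congr rfl fun j hj => ?_
  rw [if_pos]
  · rfl
  · rw [mem_bonds, sub_add_cancel]
    rw [mem_box] at hn hj
    have hN' : (L : ℝ) + M.R ≤ N := by exact_mod_cast hN
    have h := norm_sub_le n j
    refine ⟨mem_box.2 hj, mem_box.2 (by linarith), mem_box.2 ?_⟩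
    have : (0 : ℝ) ≤ M.R := by positivity
    linarith

lemma finH_apply_eq {L N : ℕ} (hN : L + M.R ≤ N) (lam : ℝ) (u : Site d → Site d → ℝ) (ψ : Hil d r)
    {n : Site d} (hn : n ∈ box d L) :
    M.finH (bonds d M.R N) lam u ψ n = M.H₀ ψ n + (lam : ℂ) • hopMap M u ψ n := by
  rw [← M.finV_apply_eq_hopMap hN u ψ hn]
  rfl

/-- The commutator of the finite-volume Hamiltonian with a slowly varying function `χ` is small; it
grows linearly in the bound `U` on the hoppings. The constants do not depend on the volume. -/
lemma exists_norm_commutator_le (u : Site d → Site d → ℝ) (lam : ℝ) :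
    ∃ (R' : ℕ) (w : ℝ), 0 ≤ w ∧ M.R ≤ R' ∧ ∀ (N : ℕ) (U : ℝ), 0 ≤ U →
      (∀ j ∈ box d M.R, ∀ l ∈ box d N, |u j l| ≤ U) →
      ∀ (χ : Site d → ℝ) (C δ : ℝ) (hχ : ∀ n, |χ n| ≤ C), 0 ≤ δ →
      (∀ n, ∀ j ∈ box d R', |χ n - χ (n - j)| ≤ δ) →
      ‖mulCLM χ C hχ * M.finH (bonds d M.R N) lam u - M.finH (bonds d M.R N) lam u * mulCLM χ C hχ‖
        ≤ δ * w * (1 + U) := by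
  obtain ⟨R₀, hR₀⟩ := M.exists_H₀_apply
  obtain ⟨ω, hω⟩ : ∃ ω : ℝ, ω = ∑ j ∈ box d M.R, ‖Matrix.toEuclideanCLM (𝕜 := ℂ) (M.W j)‖ :=
    ⟨_, rfl⟩
  have hω0 : 0 ≤ ω := hω ▸ Finset.sum_nonneg fun _ _ => norm_nonneg _
  obtain ⟨R', hR'⟩ : ∃ R', R' = max R₀ M.R := ⟨_, rfl⟩
  refine ⟨R', (‖M.H₀‖ + |lam| * ω) * (box d R').card, by positivity, hR' ▸ le_max_right _ _,
    fun N U hU hu χ C δ hχ hδ hδχ => ?_⟩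
  have key : ∀ (ψ : Hil d r) (n : Site d),
      ‖(mulCLM χ C hχ * M.finH (bonds d M.R N) lam u -
        M.finH (bonds d M.R N) lam u * mulCLM χ C hχ : Hil d r →L[ℂ] Hil d r) ψ n‖ ≤
        (δ * (‖M.H₀‖ + |lam| * ω) * (1 + U)) * ∑ j ∈ box d R', ‖ψ (n - j)‖ := by
    intro ψ n
    have e : (mulCLM χ C hχ * M.finH (bonds d M.R N) lam u -
        M.finH (bonds d M.R N) lam u * mulCLM χ C hχ : Hil d r →L[ℂ] Hil d r) ψ n =
        ((χ n : ℂ) • M.H₀ ψ n - M.H₀ (mulCLM χ C hχ ψ) n) +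
        (lam : ℂ) • ((χ n : ℂ) • M.finV (bonds d M.R N) u ψ n -
          M.finV (bonds d M.R N) u (mulCLM χ C hχ ψ) n) := by
      change (χ n : ℂ) • (M.H₀ ψ n + (lam : ℂ) • M.finV (bonds d M.R N) u ψ n) -
        (M.H₀ (mulCLM χ C hχ ψ) n +
          (lam : ℂ) • M.finV (bonds d M.R N) u (mulCLM χ C hχ ψ) n) = _
      rw [smul_add, smul_sub, smul_comm (lam : ℂ)]
      abel
    have b1 : ‖(χ n : ℂ) • M.H₀ ψ n - M.H₀ (mulCLM χ C hχ ψ) n‖ ≤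
        δ * ‖M.H₀‖ * ∑ j ∈ box d R', ‖ψ (n - j)‖ := by
      rw [hR₀ R' (hR' ▸ le_max_left _ _) ψ, hR₀ R' (hR' ▸ le_max_left _ _), Finset.smul_sum,
        ← Finset.sum_sub_distrib, Finset.mul_sum]
      refine norm_sum_le_of_le _ fun j hj => ?_
      rw [mulCLM_apply, lp.single_smul, map_smul]
      change ‖(χ n : ℂ) • M.H₀ (lp.single 2 (n - j) (ψ (n - j))) n -
        (χ (n - j) : ℂ) • M.H₀ (lp.single 2 (n - j) (ψ (n - j))) n‖ ≤ _
      rw [← sub_smul, norm_smul, ← Complex.ofReal_sub, Complex.norm_real, Real.norm_eq_abs,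
        mul_assoc]
      refine mul_le_mul (hδχ n j hj) ?_ (norm_nonneg _) hδ
      refine (norm_apply_le _ _).trans ((M.H₀.le_opNorm _).trans_eq ?_)
      rw [lp.norm_single (by norm_num)]
    have b2 : ‖(χ n : ℂ) • M.finV (bonds d M.R N) u ψ n -
          M.finV (bonds d M.R N) u (mulCLM χ C hχ ψ) n‖ ≤
        δ * (U * ω) * ∑ j ∈ box d R', ‖ψ (n - j)‖ := by
      have hsub : box d M.R ⊆ box d R' := fun j hj => by
        rw [mem_box] at hj ⊢
        refine hj.trans ?_
        rw [hR']
        exact_mod_cast le_max_right _ _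
      refine le_trans ?_ (mul_le_mul_of_nonneg_left
        (Finset.sum_le_sum_of_subset_of_nonneg hsub fun _ _ _ => norm_nonneg _) (by positivity))
      rw [finV_apply, finV_apply, Finset.smul_sum, ← Finset.sum_sub_distrib, Finset.mul_sum]
      refine norm_sum_le_of_le _ fun j hj => ?_
      split_ifs with h
      · rw [mulCLM_apply, map_smul, smul_comm (χ n : ℂ), ← smul_sub, ← sub_smul, norm_smul,
          norm_smul, ← Complex.ofReal_sub, Complex.norm_real, Complex.norm_real, Real.norm_eq_abs,
          Real.norm_eq_abs]
        have h1 := hu j hj (n - j) (mem_bonds.1 h).2.1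
        have h2 := hδχ n j (hsub hj)
        have h3 : ‖Matrix.toEuclideanCLM (𝕜 := ℂ) (M.W j) (ψ (n - j))‖ ≤ ω * ‖ψ (n - j)‖ := by
          refine (ContinuousLinearMap.le_opNorm _ _).trans ?_
          refine mul_le_mul_of_nonneg_right ?_ (norm_nonneg _)
          rw [hω]
          exact Finset.single_le_sum (f := fun j => ‖Matrix.toEuclideanCLM (𝕜 := ℂ) (M.W j)‖)
            (fun _ _ => norm_nonneg _) hj
        calc _ ≤ U * (δ * (ω * ‖ψ (n - j)‖)) := by
              refine mul_le_mul h1 ?_ (by positivity) hU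
              exact mul_le_mul h2 h3 (norm_nonneg _) hδ
          _ = _ := by ring
      · rw [smul_zero, sub_zero, norm_zero]
        positivity
    rw [e]
    have hS : 0 ≤ ∑ j ∈ box d R', ‖ψ (n - j)‖ := Finset.sum_nonneg fun _ _ => norm_nonneg _
    calc _ ≤ δ * ‖M.H₀‖ * ∑ j ∈ box d R', ‖ψ (n - j)‖ +
          |lam| * (δ * (U * ω) * ∑ j ∈ box d R', ‖ψ (n - j)‖) := by
          refine (norm_add_le _ _).trans (add_le_add b1 ?_)
          rw [norm_smul, Complex.norm_real, Real.norm_eq_abs]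
          exact mul_le_mul_of_nonneg_left b2 (abs_nonneg _)
      _ = (δ * (‖M.H₀‖ + |lam| * ω * U)) * ∑ j ∈ box d R', ‖ψ (n - j)‖ := by ring
      _ ≤ _ := by
          refine mul_le_mul_of_nonneg_right ?_ hS
          rw [mul_assoc δ]
          refine mul_le_mul_of_nonneg_left ?_ hδ
          have h1 : 0 ≤ |lam| * ω := by positivity
          have h2 : 0 ≤ ‖M.H₀‖ * U := by positivity
          nlinarith
  refine (opNorm_le_of_finite_range (by positivity) _ key).trans_eq ?_
  ring

/-- A solution of `z ψ = H ψ` in the box `|n| ≤ L` is small well inside of the box, because the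
hoppings grow slower than `L`: with the tent function `χ` over the box, `χ ψ` is the resolvent of a
finite-volume Hamiltonian applied to the small vector `[χ, H] ψ`. -/
theorem exists_norm_le_of_local_eq {u : Site d → Site d → ℝ}
    (hu : ∀ j ∈ box d M.R, ∀ l, u j l = u (-j) (l + j)) {C : ℝ}
    (hC : ∀ j ∈ box d M.R, ∀ l, |u j l| ≤ C * √(1 + ‖l‖)) (lam : ℝ) :
    ∃ e : ℝ, ∀ (z : ℂ), z.im ≠ 0 → ∀ (L : ℕ), 0 < L → ∀ ψ : Hil d r,
      (∀ n ∈ box d L, z • ψ n = M.H₀ ψ n + (lam : ℂ) • hopMap M u ψ n) →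
      ∀ n, 2 * ‖n‖ ≤ L → ‖ψ n‖ ≤ |z.im|⁻¹ * (e / √L) * ‖ψ‖ := by
  obtain ⟨R', w, hw, hR', hcomm⟩ := M.exists_norm_commutator_le u lam
  have hC0 : 0 ≤ C := by
    have := (abs_nonneg _).trans (hC 0 (zero_mem_box _) 0)
    simpa using this
  refine ⟨2 * (R' * w * (1 + C * √(2 + R'))), fun z hz L hL ψ hψ n hn => ?_⟩
  have hL1 : (1 : ℝ) ≤ L := by exact_mod_cast hL
  obtain ⟨N, hN⟩ : ∃ N, N = L + R' := ⟨_, rfl⟩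
  obtain ⟨H, hH⟩ : ∃ H, H = M.finH (bonds d M.R N) lam u := ⟨_, rfl⟩
  obtain ⟨X, hX⟩ : ∃ X : Hil d r →L[ℂ] Hil d r, X = mulCLM (tent L) 1 (abs_tent_le L) * H -
    H * mulCLM (tent L) 1 (abs_tent_le L) := ⟨_, rfl⟩
  have hXn : ‖X‖ ≤ (R' / L) * w * (1 + C * √(1 + N)) := by
    rw [hX, hH]
    refine hcomm N _ (by positivity) (fun j hj l hl => (hC j hj l).trans ?_) _ _ _ _
      (by positivity) fun n j hj => (abs_tent_sub_le L n j).trans ?_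
    · have := mem_box.1 hl
      gcongr
    · have := mem_box.1 hj
      gcongr
  have hsa : IsSelfAdjoint H := by
    rw [hH]
    exact M.isSelfAdjoint_finH lam fun p hp => hu p.1 (mem_bonds.1 hp).1 p.2
  obtain ⟨hU, hG⟩ := isUnit_and_norm_inverse_le_im hsa hz
  -- `(z - H) (χ ψ) = [χ, H] ψ`
  have heq : (algebraMap ℂ (Hil d r →L[ℂ] Hil d r) z - H) (mulCLM (tent L) 1 (abs_tent_le L) ψ) =
      X ψ := by
    have h1 : mulCLM (tent L) 1 (abs_tent_le L) (H ψ) =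
        z • mulCLM (tent L) 1 (abs_tent_le L) ψ := by
      refine lp.ext (funext fun n => ?_)
      change (tent L n : ℂ) • H ψ n = z • ((tent L n : ℂ) • ψ n)
      by_cases hnL : n ∈ box d L
      · rw [hH, M.finH_apply_eq (by omega) lam u ψ hnL, ← hψ n hnL, smul_comm]
      · rw [tent_eq_zero hL hnL]
        simp
    rw [hX]
    change z • mulCLM (tent L) 1 (abs_tent_le L) ψ - H (mulCLM (tent L) 1 (abs_tent_le L) ψ) =
      mulCLM (tent L) 1 (abs_tent_le L) (H ψ) - H (mulCLM (tent L) 1 (abs_tent_le L) ψ)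
    rw [h1]
  have hχ : ‖mulCLM (tent L) 1 (abs_tent_le L) ψ‖ ≤ |z.im|⁻¹ * (‖X‖ * ‖ψ‖) := by
    have h1 : mulCLM (tent L) 1 (abs_tent_le L) ψ =
        Ring.inverse (algebraMap ℂ (Hil d r →L[ℂ] Hil d r) z - H) (X ψ) := by
      rw [← heq, ← mul_apply_eq_comp, Ring.inverse_mul_cancel _ hU]
      rfl
    rw [h1]
    refine (ContinuousLinearMap.le_opNorm _ _).trans ?_
    exact mul_le_mul hG (X.le_opNorm ψ) (norm_nonneg _) (by positivity)
  have hψn : ‖ψ n‖ ≤ 2 * ‖mulCLM (tent L) 1 (abs_tent_le L) ψ‖ := by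
    have h1 := norm_apply_le (mulCLM (tent L) 1 (abs_tent_le L) ψ) n
    rw [mulCLM_apply, norm_smul, Complex.norm_real, Real.norm_eq_abs,
      abs_of_nonneg (tent_nonneg L n)] at h1
    have h2 := mul_le_mul_of_nonneg_right (half_le_tent hL hn) (norm_nonneg (ψ n))
    linarith
  have hε : (R' / L : ℝ) * w * (1 + C * √(1 + N)) ≤ R' * w * (1 + C * √(2 + R')) / √L := by
    have hsL : 1 ≤ √(L : ℝ) := Real.one_le_sqrt.2 hL1
    have h1 : √(1 + N : ℝ) ≤ √(2 + R') * √L := by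
      rw [← Real.sqrt_mul (by positivity)]
      refine Real.sqrt_le_sqrt ?_
      rw [hN]
      push_cast
      nlinarith [(Nat.cast_nonneg R' : (0 : ℝ) ≤ R')]
    have h2 : 1 + C * √(1 + N : ℝ) ≤ (1 + C * √(2 + R')) * √L := by
      have := mul_le_mul_of_nonneg_left h1 hC0
      nlinarith
    have h3 : (L : ℝ) = √L * √L := (Real.mul_self_sqrt (by positivity)).symm
    calc _ ≤ (R' / L : ℝ) * w * ((1 + C * √(2 + R')) * √L) := by gcongr
      _ = R' * w * (1 + C * √(2 + R')) * (√L / L) := by ring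
      _ = _ := by rw [Real.sqrt_div_self', mul_one_div]
  calc ‖ψ n‖ ≤ 2 * (|z.im|⁻¹ * (‖X‖ * ‖ψ‖)) := hψn.trans (by gcongr)
    _ ≤ 2 * (|z.im|⁻¹ * (R' * w * (1 + C * √(2 + R')) / √L * ‖ψ‖)) := by
        have := hXn.trans hε
        gcongr
    _ = _ := by ring

end Model

end

/-! ### Resolvents on the maximal domain -/

section

variable {d r : ℕ}

lemma IsResolvent.unique {A : Hil d r →ₗ.[ℂ] Hil d r} {z : ℂ} {B B' : Hil d r →L[ℂ] Hil d r}
    (h : IsResolvent A z B) (h' : IsResolvent A z B') : B = B' := by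
  ext1 φ
  obtain ⟨hd, he⟩ := h'.1 φ
  have h1 := h.2 ⟨B' φ, hd⟩
  rwa [he] at h1

lemma green_eq_block {A : Hil d r →ₗ.[ℂ] Hil d r} {z : ℂ} {B : Hil d r →L[ℂ] Hil d r}
    (h : IsResolvent A z B) (n m : Site d) : green A z n m = block B n m := by
  have h1 : ∃ B : Hil d r →L[ℂ] Hil d r, IsResolvent A z B := ⟨B, h⟩
  rw [green, dif_pos h1, h1.choose_spec.unique h]

lemma tendsto_div_sqrt (a e b : ℝ) : Tendsto (fun L : ℕ => a * (e / √L) * b) atTop (𝓝 0) := by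
  have h : Tendsto (fun L : ℕ => e / √(L : ℝ)) atTop (𝓝 0) :=
    (Real.tendsto_sqrt_atTop.comp tendsto_natCast_atTop_atTop).const_div_atTop e
  simpa using (h.const_mul a).mul_const b

namespace Model

variable (M : Model d r)

/-- Both sides of the eigenvalue equation are local, hence continuous for pointwise convergence. -/
lemma tendsto_local_apply (u : Site d → Site d → ℝ) (lam : ℝ) {F : ℕ → Hil d r} {f : Hil d r}
    (h : ∀ n, Tendsto (fun N => F N n) atTop (𝓝 (f n))) (n : Site d) :
    Tendsto (fun N => M.H₀ (F N) n + (lam : ℂ) • hopMap M u (F N) n) atTop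
      (𝓝 (M.H₀ f n + (lam : ℂ) • hopMap M u f n)) := by
  obtain ⟨R₀, hR₀⟩ := M.exists_H₀_apply
  refine Tendsto.add ?_ (Tendsto.const_smul ?_ _)
  · rw [hR₀ R₀ le_rfl f n]
    refine Tendsto.congr (fun N => (hR₀ R₀ le_rfl (F N) n).symm) ?_
    refine tendsto_finsetSum _ fun j _ => ?_
    exact (((lp.evalCLM ℂ (fun _ : Site d => Fiber r) 2 n ∘L M.H₀ ∘L
      lp.singleContinuousLinearMap ℂ (fun _ : Site d => Fiber r) 2 (n - j)).continuous.tendsto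
      _).comp (h (n - j)))
  · refine tendsto_finsetSum _ fun j _ => Tendsto.const_smul ?_ _
    exact ((Matrix.toEuclideanCLM (𝕜 := ℂ) (M.W j)).continuous.tendsto _).comp (h (n - j))

/-- The finite-volume resolvents solve the resolvent equation of the full Hamiltonian inside of the
volume. -/
lemma finG_local_eq {u : Site d → Site d → ℝ} (hu : ∀ j ∈ box d M.R, ∀ l, u j l = u (-j) (l + j))
    (lam : ℝ) {z : ℂ} (hz : z.im ≠ 0) {L N : ℕ} (hN : L + M.R ≤ N) (φ : Hil d r) {n : Site d}
    (hn : n ∈ box d L) :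
    z • M.finG (bonds d M.R N) lam z u φ n = M.H₀ (M.finG (bonds d M.R N) lam z u φ) n +
      (lam : ℂ) • hopMap M u (M.finG (bonds d M.R N) lam z u φ) n + φ n := by
  have hsa := M.isSelfAdjoint_finH lam (L := N) (u := u)
    fun p hp => hu p.1 (mem_bonds.1 hp).1 p.2
  have hU := (isUnit_and_norm_inverse_le_im hsa hz).1
  rw [← M.finH_apply_eq hN lam u _ hn]
  have h1 : (algebraMap ℂ (Hil d r →L[ℂ] Hil d r) z - M.finH (bonds d M.R N) lam u)
      (M.finG (bonds d M.R N) lam z u φ) = φ := by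
    rw [← mul_apply_eq_comp, finG, Ring.mul_inverse_cancel _ hU]
    rfl
  have h2 : z • M.finG (bonds d M.R N) lam z u φ -
      M.finH (bonds d M.R N) lam u (M.finG (bonds d M.R N) lam z u φ) = φ := h1
  have h3 := congrArg (fun ψ : Hil d r => ψ n) h2
  exact sub_eq_iff_eq_add'.1 h3

lemma norm_finG_le_inv_im {u : Site d → Site d → ℝ}
    (hu : ∀ j ∈ box d M.R, ∀ l, u j l = u (-j) (l + j)) (lam : ℝ) {z : ℂ} (hz : z.im ≠ 0) (N : ℕ)
    (φ : Hil d r) : ‖M.finG (bonds d M.R N) lam z u φ‖ ≤ |z.im|⁻¹ * ‖φ‖ := by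
  have hsa := M.isSelfAdjoint_finH lam (L := N) (u := u)
    fun p hp => hu p.1 (mem_bonds.1 hp).1 p.2
  exact (ContinuousLinearMap.le_opNorm _ _).trans
    (mul_le_mul_of_nonneg_right (isUnit_and_norm_inverse_le_im hsa hz).2 (norm_nonneg _))

/-- There are no square summable solutions of `z ψ = H ψ` off the real axis. -/
lemma eq_zero_of_local_eq {u : Site d → Site d → ℝ}
    (hu : ∀ j ∈ box d M.R, ∀ l, u j l = u (-j) (l + j)) {C : ℝ}
    (hC : ∀ j ∈ box d M.R, ∀ l, |u j l| ≤ C * √(1 + ‖l‖)) (lam : ℝ) {z : ℂ} (hz : z.im ≠ 0)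
    {ψ : Hil d r} (hψ : ∀ n, z • ψ n = M.H₀ ψ n + (lam : ℂ) • hopMap M u ψ n) : ψ = 0 := by
  obtain ⟨e, he⟩ := M.exists_norm_le_of_local_eq hu hC lam
  refine lp.ext (funext fun n => ?_)
  refine norm_le_zero_iff.1 (ge_of_tendsto (tendsto_div_sqrt |z.im|⁻¹ e ‖ψ‖) ?_)
  filter_upwards [eventually_gt_atTop 0,
    tendsto_natCast_atTop_atTop.eventually_ge_atTop (2 * ‖n‖)] with L hL hn
  exact he z hz L hL ψ (fun n _ => hψ n) n hn

lemma exists_tendsto_finG {u : Site d → Site d → ℝ}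
    (hu : ∀ j ∈ box d M.R, ∀ l, u j l = u (-j) (l + j)) {C : ℝ}
    (hC : ∀ j ∈ box d M.R, ∀ l, |u j l| ≤ C * √(1 + ‖l‖)) (lam : ℝ) {z : ℂ} (hz : z.im ≠ 0)
    (φ : Hil d r) (n : Site d) :
    ∃ x, Tendsto (fun N => M.finG (bonds d M.R N) lam z u φ n) atTop (𝓝 x) := by
  obtain ⟨e, he⟩ := M.exists_norm_le_of_local_eq hu hC lam
  refine cauchySeq_tendsto_of_complete (Metric.cauchySeq_iff.2 fun ε hε => ?_)
  -- differences of two approximations solve the homogeneous equation in a large box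
  have hlim := tendsto_div_sqrt |z.im|⁻¹ |e| (|z.im|⁻¹ * ‖φ‖ + |z.im|⁻¹ * ‖φ‖)
  obtain ⟨L, hL, hn, hε'⟩ := ((eventually_gt_atTop 0).and
    ((tendsto_natCast_atTop_atTop.eventually_ge_atTop (2 * ‖n‖)).and
      (hlim.eventually_lt_const hε))).exists
  refine ⟨L + M.R, fun N hN N' hN' => ?_⟩
  rw [dist_eq_norm]
  have h1 := he z hz L hL (M.finG (bonds d M.R N) lam z u φ - M.finG (bonds d M.R N') lam z u φ)
    (fun n hn => ?_) n hn
  · refine lt_of_le_of_lt (h1.trans ?_) hε'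
    refine mul_le_mul ?_ ((norm_sub_le _ _).trans (add_le_add (M.norm_finG_le_inv_im hu lam hz N φ)
      (M.norm_finG_le_inv_im hu lam hz N' φ))) (norm_nonneg _) (by positivity)
    gcongr
    exact le_abs_self e
  · rw [map_sub, map_sub]
    change z • (M.finG (bonds d M.R N) lam z u φ n - M.finG (bonds d M.R N') lam z u φ n) =
      (M.H₀ (M.finG (bonds d M.R N) lam z u φ) n - M.H₀ (M.finG (bonds d M.R N') lam z u φ) n) +
      (lam : ℂ) • (hopMap M u (M.finG (bonds d M.R N) lam z u φ) n -
        hopMap M u (M.finG (bonds d M.R N') lam z u φ) n)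
    rw [smul_sub, M.finG_local_eq hu lam hz hN φ hn, M.finG_local_eq hu lam hz hN' φ hn, smul_sub]
    abel

/-- For hoppings growing at most like `√|l|` the Hamiltonian on its maximal domain has resolvents
off the real axis, and they are the limits of the resolvents of the finite-volume Hamiltonians. The
coupling constant must not vanish: for `lam = 0` the range of the resolvent of `H₀` need not be
contained in the domain of `V`. -/
theorem exists_isResolvent {u : Site d → Site d → ℝ}
    (hu : ∀ j ∈ box d M.R, ∀ l, u j l = u (-j) (l + j)) {C : ℝ}
    (hC : ∀ j ∈ box d M.R, ∀ l, |u j l| ≤ C * √(1 + ‖l‖)) {lam : ℝ} (hlam : lam ≠ 0) {z : ℂ}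
    (hz : z.im ≠ 0) :
    ∃ B : Hil d r →L[ℂ] Hil d r, IsResolvent (hamiltonian M u lam) z B ∧
      ∀ φ n, Tendsto (fun N => M.finG (bonds d M.R N) lam z u φ n) atTop (𝓝 (B φ n)) := by
  choose f hf using M.exists_tendsto_finG hu hC lam hz
  have hpi : ∀ φ, Tendsto (id fun N => ⇑(M.finG (bonds d M.R N) lam z u φ)) atTop (𝓝 (f φ)) :=
    fun φ => tendsto_pi_nhds.2 fun n => hf φ n
  have hmem : ∀ φ, Memℓp (f φ) 2 := fun φ => by
    refine lp.memℓp_of_tendsto (F := fun N => M.finG (bonds d M.R N) lam z u φ) ?_ (hpi φ)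
    refine isBounded_iff_forall_norm_le.2 ⟨|z.im|⁻¹ * ‖φ‖, ?_⟩
    rintro _ ⟨N, rfl⟩
    exact M.norm_finG_le_inv_im hu lam hz N φ
  obtain ⟨B, hB⟩ : ∃ B : Hil d r →L[ℂ] Hil d r, ∀ φ n, B φ n = f φ n := by
    refine ⟨LinearMap.mkContinuous
      { toFun := fun φ => (⟨f φ, hmem φ⟩ : Hil d r)
        map_add' := fun φ ψ => ?_
        map_smul' := fun c φ => ?_ } |z.im|⁻¹ fun φ => ?_, fun φ n => rfl⟩
    · refine lp.ext (funext fun n => tendsto_nhds_unique (hf (φ + ψ) n) ?_)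
      simp_rw [map_add]
      exact (hf φ n).add (hf ψ n)
    · refine lp.ext (funext fun n => tendsto_nhds_unique (hf (c • φ) n) ?_)
      simp_rw [map_smul]
      exact (hf φ n).const_smul c
    · exact lp.norm_le_of_tendsto (F := fun N => M.finG (bonds d M.R N) lam z u φ)
        (Eventually.of_forall fun N => M.norm_finG_le_inv_im hu lam hz N φ) (hpi φ)
  have hlim : ∀ φ n, Tendsto (fun N => M.finG (bonds d M.R N) lam z u φ n) atTop (𝓝 (B φ n)) :=
    fun φ n => hB φ n ▸ hf φ n
  have heq : ∀ φ n, z • B φ n = M.H₀ (B φ) n + (lam : ℂ) • hopMap M u (B φ) n + φ n := by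
    intro φ n
    refine tendsto_nhds_unique ((hlim φ n).const_smul z)
      (((M.tendsto_local_apply u lam (hlim φ) n).add_const (φ n)).congr' ?_)
    obtain ⟨L, hL⟩ := exists_nat_ge ‖n‖
    filter_upwards [eventually_ge_atTop (L + M.R)] with N hN
    exact (M.finG_local_eq hu lam hz hN φ (mem_box.2 hL)).symm
  have hlam' : (lam : ℂ) ≠ 0 := by exact_mod_cast hlam
  -- `V (B φ) = lam⁻¹ (z B φ - H₀ B φ - φ)` is square summable
  have hdom : ∀ φ, B φ ∈ (hamiltonian M u lam).domain := by
    intro φ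
    have h1 : hopMap M u (B φ) = (((lam : ℂ)⁻¹ • (z • B φ - M.H₀ (B φ) - φ) : Hil d r) :
        PreLp fun _ : Site d => Fiber r) := by
      funext n
      change _ = (lam : ℂ)⁻¹ • (z • B φ n - M.H₀ (B φ) n - φ n)
      rw [heq, add_assoc, add_sub_cancel_left, add_sub_cancel_right, smul_smul,
        inv_mul_cancel₀ hlam', one_smul]
    change hopMap M u (B φ) ∈ lpSubmodule ℂ (fun _ : Site d => Fiber r) 2
    rw [h1]
    exact Subtype.property _
  refine ⟨B, ⟨fun φ => ⟨hdom φ, ?_⟩, fun ψ => ?_⟩, hlim⟩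
  · refine lp.ext (funext fun n => ?_)
    change z • B φ n - (M.H₀ (B φ) n + (lam : ℂ) • hopMap M u (B φ) n) = φ n
    rw [heq, add_sub_cancel_left]
  · refine sub_eq_zero.1 (M.eq_zero_of_local_eq hu hC lam hz fun n => ?_)
    obtain ⟨φ, hφ⟩ : ∃ φ, φ = z • (ψ : Hil d r) - hamiltonian M u lam ψ := ⟨_, rfl⟩
    have h1 : φ n = z • (ψ : Hil d r) n -
        (M.H₀ (ψ : Hil d r) n + (lam : ℂ) • hopMap M u (ψ : Hil d r) n) := by rw [hφ]; rfl
    rw [← hφ, map_sub, map_sub]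
    change z • (B φ n - (ψ : Hil d r) n) = (M.H₀ (B φ) n - M.H₀ (ψ : Hil d r) n) +
      (lam : ℂ) • (hopMap M u (B φ) n - hopMap M u (ψ : Hil d r) n)
    rw [smul_sub, heq, h1, smul_sub]
    abel

end Model

end

/-! ### The thermodynamic limit of the fractional moments -/

section

variable {d r : ℕ}

/-- Almost surely the hoppings grow at most like `√|l|`, because `∑_l (1 + |l|)^{-2d} |v_{j,l}|^k`
has a finite expectation for all `k`. -/
theorem IsHopping.ae_growth {R : ℕ} {Ω : Type*} [MeasurableSpace Ω] {P : Measure Ω}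
    [IsProbabilityMeasure P] {α : ℝ} {ν : Site d → Measure ℝ} {v : Site d → Site d → Ω → ℝ}
    (hv : IsHopping P R α ν v) :
    ∀ᵐ ω ∂P, ∃ C : ℝ, ∀ j ∈ box d R, ∀ l, |v j l ω| ≤ C * √(1 + ‖l‖) := by
  have key : ∀ j ∈ box d R, ∀ᵐ ω ∂P, ∃ C : ℝ, 0 ≤ C ∧ ∀ l, |v j l ω| ≤ C * √(1 + ‖l‖) := by
    intro j hj
    have hm := hv.measurable j hj
    have : IsProbabilityMeasure (ν j) :=
      hv.law j hj 0 ▸ Measure.isProbabilityMeasure_map (hm 0).aemeasurable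
    -- any positive exponent of at least `4 d` will do; `4 d` itself vanishes for `d = 0`
    obtain ⟨C, hC⟩ := (hv.tails j hj).exists_lintegral_le (4 * (d + 1))
    have h1 : ∀ l, ∫⁻ ω, ENNReal.ofReal (((1 + ‖l‖) ^ (2 * d))⁻¹) *
        ENNReal.ofReal ((1 + |v j l ω|) ^ (4 * (d + 1))) ∂P ≤
        ENNReal.ofReal (((1 + ‖l‖) ^ (2 * d))⁻¹) * C := by
      intro l
      rw [lintegral_const_mul' _ _ ENNReal.ofReal_ne_top]
      refine mul_le_mul_right (le_trans ?_ hC) _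
      rw [← hv.law j hj l, lintegral_map (by fun_prop) (hm l)]
    have h2 : ∫⁻ ω, ∑' l, ENNReal.ofReal (((1 + ‖l‖) ^ (2 * d))⁻¹) *
        ENNReal.ofReal ((1 + |v j l ω|) ^ (4 * (d + 1))) ∂P ≠ ⊤ := by
      rw [lintegral_tsum fun l => by have := hm l; fun_prop]
      refine ne_top_of_le_ne_top ?_ (ENNReal.tsum_le_tsum h1)
      rw [ENNReal.tsum_mul_right, ← ENNReal.ofReal_tsum_of_nonneg (fun l => by positivity)
        (summable_site d)]
      exact ENNReal.mul_ne_top ENNReal.ofReal_ne_top ENNReal.coe_ne_top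
    filter_upwards [ae_lt_top' (AEMeasurable.tsum
      fun l => by have := hm l; fun_prop) h2] with ω hω
    obtain ⟨S, hS⟩ : ∃ S : ℝ, S = max 1 (∑' l, ENNReal.ofReal (((1 + ‖l‖) ^ (2 * d))⁻¹) *
        ENNReal.ofReal ((1 + |v j l ω|) ^ (4 * (d + 1)))).toReal := ⟨_, rfl⟩
    have hS1 : 1 ≤ S := hS ▸ le_max_left _ _
    refine ⟨S, by linarith, fun l => ?_⟩
    have h3 : ((1 + ‖l‖) ^ (2 * d))⁻¹ * (1 + |v j l ω|) ^ (4 * (d + 1)) ≤ S := by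
      refine le_trans ?_ (hS ▸ le_max_right _ _)
      refine (ENNReal.ofReal_le_iff_le_toReal hω.ne).1 ?_
      rw [ENNReal.ofReal_mul (by positivity)]
      exact ENNReal.le_tsum l
    rw [inv_mul_le_iff₀ (by positivity)] at h3
    have hl : 1 ≤ √(1 + ‖l‖) := Real.one_le_sqrt.2 (by linarith [norm_nonneg l])
    have h4 : (1 + |v j l ω|) ^ (4 * (d + 1)) ≤ (S * √(1 + ‖l‖)) ^ (4 * (d + 1)) := by
      rw [mul_pow, mul_comm (S ^ _)]
      refine h3.trans (mul_le_mul ?_ (le_self_pow₀ hS1 (by omega)) (by linarith) (by positivity))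
      have h5 : (1 + ‖l‖) ^ (2 * d) = √(1 + ‖l‖) ^ (4 * d) := by
        rw [show 4 * d = 2 * (2 * d) by ring, pow_mul (√(1 + ‖l‖)), Real.sq_sqrt (by positivity)]
      rw [h5]
      exact pow_le_pow_right₀ hl (by omega)
    have h6 := (pow_le_pow_iff_left₀ (by positivity) (by positivity) (by omega)).1 h4
    linarith
  have key' := (ae_ball_iff (box d R).countable_toSet).2 key
  filter_upwards [key'] with ω hω
  choose! C hC0 hC using hω
  refine ⟨∑ j ∈ box d R, C j, fun j hj l => (hC j hj l).trans ?_⟩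
  exact mul_le_mul_of_nonneg_right (Finset.single_le_sum (fun i hi => hC0 i hi) hj)
    (Real.sqrt_nonneg _)

lemma hsNorm_rpow_le (A : FiberMat r) {s : ℝ} (hs0 : 0 < s) (hs1 : s ≤ 1) :
    hsNorm A ^ s ≤ ∑ a, ∑ b, ‖A a b‖ ^ s := by
  have h0 : 0 ≤ ∑ a, ∑ b, ‖A a b‖ := by positivity
  have h1 : hsNorm A ≤ ∑ a, ∑ b, ‖A a b‖ := by
    refine Real.sqrt_le_iff.2 ⟨h0, ?_⟩
    rw [← Finset.sum_product', ← Finset.sum_product']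
    exact Finset.sum_sq_le_sq_sum_of_nonneg fun i _ => norm_nonneg _
  refine (Real.rpow_le_rpow (Real.sqrt_nonneg _) h1 hs0.le).trans ?_
  have h2 := norm_sum_rpow_le hs0 hs1 (Finset.univ ×ˢ Finset.univ)
    fun i : FiberIdx r × FiberIdx r => ((‖A i.1 i.2‖ : ℝ) : ℂ)
  rw [← Complex.ofReal_sum, Finset.sum_product, Finset.sum_product] at h2
  simpa only [Complex.norm_real, norm_norm, Real.norm_of_nonneg h0] using h2

/-- Fatou's lemma transfers fractional moment bounds from the finite-volume Hamiltonians. The Green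
matrices of the full Hamiltonian are measurable as almost sure limits; they are set to zero on the
null set without a resolvent. -/
theorem IsHopping.integral_green_le {M : Model d r} {Ω : Type*} [MeasurableSpace Ω]
    {P : Measure Ω} [IsProbabilityMeasure P] {α : ℝ} {ν : Site d → Measure ℝ}
    {v : Site d → Site d → Ω → ℝ} (hv : IsHopping P M.R α ν v) {s : ℝ} (hs0 : 0 < s) (hs1 : s ≤ 1)
    {lam : ℝ} (hlam : lam ≠ 0) {z : ℂ} (hz : z.im ≠ 0) (n m : Site d) {c : ℝ} (hc : 0 ≤ c)
    (h : ∀ L a b, ∫⁻ ω, ENNReal.ofReal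
      (‖M.finG (bonds d M.R L) lam z (fun j l => v j l ω) (basisState m b) n a‖ ^ s) ∂P ≤
        ENNReal.ofReal c) :
    Integrable (fun ω => hsNorm (green (hamiltonian M (fun j l => v j l ω) lam) z n m) ^ s) P ∧
      ∫ ω, hsNorm (green (hamiltonian M (fun j l => v j l ω) lam) z n m) ^ s ∂P ≤
        (Fintype.card (FiberIdx r)) ^ 2 * c := by
  obtain ⟨G, hG⟩ : ∃ G : Ω → FiberMat r,
      G = fun ω => green (hamiltonian M (fun j l => v j l ω) lam) z n m := ⟨_, rfl⟩
  obtain ⟨g, hg⟩ : ∃ g : ℕ → FiberIdx r → FiberIdx r → Ω → ℂ, ∀ L a b ω, g L a b ω =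
      M.finG (bonds d M.R L) lam z (fun j l => v j l ω) (basisState m b) n a :=
    ⟨_, fun _ _ _ _ => rfl⟩
  have hgm : ∀ L a b, Measurable (g L a b) := fun L a b => by
    rw [show g L a b = _ from funext (hg L a b)]
    exact M.measurable_finG_apply lam hz (fun p hp => hv.measurable _ (mem_bonds.1 hp).1 _)
      (fun ω => hv.isSymm L ω) _ _ _
  have hlim : ∀ a b, ∀ᵐ ω ∂P, Tendsto (fun L => g L a b ω) atTop (𝓝 (G ω a b)) := by
    intro a b
    filter_upwards [hv.ae_growth] with ω ⟨C, hC⟩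
    obtain ⟨B, hB, hBlim⟩ := M.exists_isResolvent (u := fun j l => v j l ω)
      (fun j hj l => congrFun (hv.symm j hj l) ω) hC hlam hz
    rw [hG]
    simp only [green_eq_block hB, hg]
    exact ((EuclideanSpace.proj (𝕜 := ℂ) a).continuous.tendsto _).comp (hBlim (basisState m b) n)
  have hGm : ∀ a b, AEMeasurable (fun ω => G ω a b) P := fun a b =>
    aemeasurable_of_tendsto_metrizable_ae atTop (fun L => (hgm L a b).aemeasurable) (hlim a b)
  have hent : ∀ a b, ∫⁻ ω, ENNReal.ofReal (‖G ω a b‖ ^ s) ∂P ≤ ENNReal.ofReal c := by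
    intro a b
    have h1 : ∀ᵐ ω ∂P, ENNReal.ofReal (‖G ω a b‖ ^ s) =
        liminf (fun L => ENNReal.ofReal (‖g L a b ω‖ ^ s)) atTop := by
      filter_upwards [hlim a b] with ω hω
      refine (Tendsto.liminf_eq ?_).symm
      exact (ENNReal.continuous_ofReal.tendsto _).comp (hω.norm.rpow_const (Or.inr hs0.le))
    rw [lintegral_congr_ae h1]
    refine (lintegral_liminf_le fun L => ?_).trans ?_
    · have := hgm L a b
      fun_prop
    · refine liminf_le_of_le (by isBoundedDefault) fun x hx => ?_
      obtain ⟨L, hL⟩ := hx.exists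
      refine hL.trans ?_
      simp only [hg]
      exact h L a b
  have hFm : AEMeasurable (fun ω => hsNorm (G ω) ^ s) P := by
    unfold hsNorm
    have := hGm
    fun_prop
  have hF0 : ∀ ω, 0 ≤ hsNorm (G ω) ^ s := fun ω => Real.rpow_nonneg (Real.sqrt_nonneg _) _
  have hle : ∫⁻ ω, ENNReal.ofReal (hsNorm (G ω) ^ s) ∂P ≤
      ENNReal.ofReal ((Fintype.card (FiberIdx r)) ^ 2 * c) := by
    calc _ ≤ ∫⁻ ω, ∑ i : FiberIdx r × FiberIdx r, ENNReal.ofReal (‖G ω i.1 i.2‖ ^ s) ∂P := by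
          refine lintegral_mono fun ω => ?_
          rw [← ENNReal.ofReal_sum_of_nonneg fun i _ => by positivity]
          refine ENNReal.ofReal_le_ofReal ((hsNorm_rpow_le _ hs0 hs1).trans_eq ?_)
          rw [Fintype.sum_prod_type]
      _ = ∑ i : FiberIdx r × FiberIdx r, ∫⁻ ω, ENNReal.ofReal (‖G ω i.1 i.2‖ ^ s) ∂P := by
          refine lintegral_finsetSum' _ fun i _ => ?_
          have := hGm i.1 i.2
          fun_prop
      _ ≤ ∑ i : FiberIdx r × FiberIdx r, ENNReal.ofReal c :=
          Finset.sum_le_sum fun i _ => hent i.1 i.2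
      _ = _ := by
          rw [← ENNReal.ofReal_sum_of_nonneg fun i _ => hc, Finset.sum_const, Finset.card_univ,
            Fintype.card_prod, nsmul_eq_mul]
          push_cast
          rw [sq]
  have hfin := hle.trans_lt ENNReal.ofReal_lt_top
  have hbd : ∫ ω, hsNorm (G ω) ^ s ∂P ≤ (Fintype.card (FiberIdx r)) ^ 2 * c := by
    rw [integral_eq_lintegral_of_nonneg_ae (Eventually.of_forall hF0) hFm.aestronglyMeasurable]
    exact ENNReal.toReal_le_of_le_ofReal (by positivity) hle
  subst hG
  exact ⟨⟨hFm.aestronglyMeasurable,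
    (hasFiniteIntegral_iff_ofReal (Eventually.of_forall hF0)).2 hfin⟩, hbd⟩

/-- The distance of a set of energies to the real spectrum also bounds the distance of the energies,
shifted into the complex plane, to the complex spectrum. -/
lemma le_dist_spectrum {A : Hil d r →L[ℂ] Hil d r} (hA : IsSelfAdjoint A) {S : Set ℝ} {E ε : ℝ}
    (hE : E ∈ S) {x : ℂ} (hx : x ∈ spectrum ℂ A) :
    setDist S (realSpectrum A) ≤ ‖(E + ε * Complex.I) - x‖ := by
  have hre : x = x.re := hA.mem_spectrum_eq_re hx
  have h1 : setDist S (realSpectrum A) ≤ dist E x.re := by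
    refine csInf_le ⟨0, ?_⟩ ⟨E, hE, x.re, ?_, rfl⟩
    · rintro _ ⟨_, _, _, _, rfl⟩
      exact dist_nonneg
    · change (x.re : ℂ) ∈ spectrum ℂ A
      rwa [← hre]
  refine h1.trans ?_
  have h2 := Complex.abs_re_le_norm ((E + ε * Complex.I) - x)
  simpa [Real.dist_eq] using h2

end

end BdG

theorem theorem1 (r : ℕ) (α : ℝ) (hα : 0 < α) :
    ∃ s₀ : ℝ, 0 < s₀ ∧ s₀ ≤ 1 ∧
      ∀ (d : ℕ) (M : BdG.Model d r)
        (Ω : Type*) [MeasurableSpace Ω] (P : Measure Ω) [IsProbabilityMeasure P]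
        (ν : BdG.Site d → Measure ℝ) (v : BdG.Site d → BdG.Site d → Ω → ℝ),
        BdG.IsHopping P M.R α ν v →
      ∀ K : ℝ, ∃ C₃ : ℝ, 0 < C₃ ∧
      ∀ s : ℝ, 0 < s → s < s₀ → ∃ C₁ : ℝ, 0 < C₁ ∧
      ∀ a b D : ℝ, a ≤ b → Set.Icc a b ⊆ Set.Icc (-K) K →
        D = BdG.setDist (Set.Icc a b) (BdG.realSpectrum M.H₀) → 0 < D →
      ∃ C₂ : ℝ, 0 < C₂ ∧
      ∀ lam : ℝ, 0 < lam → lam ≤ C₁ * D ^ (1 + 1 / s) →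
        (∀ᵐ ω ∂P, ∀ z : ℂ, z.im ≠ 0 →
          ∃ B, BdG.IsResolvent (BdG.hamiltonian M (fun j l => v j l ω) lam) z B) ∧
        ∀ E ∈ Set.Icc a b, ∀ ε : ℝ, ε ≠ 0 → ∀ n m : BdG.Site d,
          Integrable (fun ω => BdG.hsNorm (BdG.green
            (BdG.hamiltonian M (fun j l => v j l ω) lam) (E + ε * Complex.I) n m) ^ s) P ∧
          ∫ ω, BdG.hsNorm (BdG.green
            (BdG.hamiltonian M (fun j l => v j l ω) lam) (E + ε * Complex.I) n m) ^ s ∂P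
            ≤ C₂ * Real.exp (-(s * C₃ * D * ‖n - m‖)) := by
  -- the Green functions are rational of degree `4 r` in each coupling, and moments of the order
  -- `-4 r * 2 s` of the distance to a pole must be finite; the summand `1` takes care of `r = 0`
  refine ⟨min 1 (α / (8 * r + 1)), lt_min one_pos (by positivity), min_le_left _ _,
    fun d M Ω _ P _ ν v hv K => ?_⟩
  obtain ⟨C₃, hC₃, h⟩ := hv.exists_moment_bound hα (Dm := |K| + ‖M.H₀‖ + 1) (by positivity)
  refine ⟨C₃, hC₃, fun s hs0 hs => ?_⟩
  have hs1 : s ≤ 1 := (hs.trans_le (min_le_left _ _)).le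
  have hsα : ((4 * r : ℕ) : ℝ) * (2 * s) < α := by
    have h1 := hs.trans_le (min_le_right _ _)
    rw [lt_div_iff₀ (by positivity)] at h1
    push_cast
    linarith
  obtain ⟨C₁, hC₁, h⟩ := h s hs0 hs1 hsα
  refine ⟨C₁, hC₁, fun a b D hab hK hD hD0 => ?_⟩
  have hDm : D ≤ |K| + ‖M.H₀‖ + 1 := by
    -- the spectrum is not empty, as the infimum over the empty set is zero
    obtain ⟨x, hx⟩ : (BdG.realSpectrum M.H₀).Nonempty := by
      rw [Set.nonempty_iff_ne_empty]
      intro he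
      rw [hD, he, BdG.setDist, Set.image2_empty_right, Real.sInf_empty] at hD0
      exact hD0.false
    have h1 : D ≤ ‖((a : ℂ) + (0 : ℝ) * Complex.I) - x‖ :=
      hD ▸ BdG.le_dist_spectrum M.selfAdjoint (Set.left_mem_Icc.2 hab) hx
    have h2 : ‖(x : ℂ)‖ ≤ ‖M.H₀‖ * ‖(1 : BdG.Hil d r →L[ℂ] BdG.Hil d r)‖ :=
      spectrum.norm_le_norm_mul_of_mem hx
    have h3 : ‖(1 : BdG.Hil d r →L[ℂ] BdG.Hil d r)‖ ≤ 1 := ContinuousLinearMap.norm_id_le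
    have h4 : ‖(x : ℂ)‖ ≤ ‖M.H₀‖ := h2.trans (mul_le_of_le_one_right (norm_nonneg _) h3)
    have h5 : ‖(a : ℂ)‖ ≤ |K| := by
      rw [Complex.norm_real, Real.norm_eq_abs]
      have := hK (Set.left_mem_Icc.2 hab)
      exact (abs_le.2 ⟨this.1, this.2⟩).trans (le_abs_self K)
    rw [Complex.ofReal_zero, zero_mul, add_zero] at h1
    linarith [norm_sub_le (a : ℂ) (x : ℂ)]
  -- the summand `1` makes the constant positive for `r = 0`
  refine ⟨(Fintype.card (BdG.FiberIdx r)) ^ 2 * (2 * (2 / D) ^ s) + 1, by positivity,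
    fun lam hlam hle => ⟨?_, fun E hE ε hε n m => ?_⟩⟩
  · filter_upwards [hv.ae_growth] with ω ⟨C, hC⟩ z hz
    obtain ⟨B, hB, -⟩ := M.exists_isResolvent (u := fun j l => v j l ω)
      (fun j hj l => congrFun (hv.symm j hj l) ω) hC hlam.ne' hz
    exact ⟨B, hB⟩
  · have hz : ((E : ℂ) + ε * Complex.I).im ≠ 0 := by simpa using hε
    obtain ⟨h1, h2⟩ := hv.integral_green_le hs0 hs1 hlam.ne' hz n m (by positivity)
      fun L a b => h D lam hD0 hDm hlam hle _
        (fun x hx => hD ▸ BdG.le_dist_spectrum M.selfAdjoint hE hx) hz L n m a b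
    refine ⟨h1, h2.trans ?_⟩
    rw [← mul_assoc]
    exact mul_le_mul_of_nonneg_right (le_add_of_nonneg_right zero_le_one) (Real.exp_pos _).le
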